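/- Let $E$ be a complex normed space of finite dimension $D\ge 1$ (for instance $\mathbb{C}^D$ with the Euclidean norm), let $X,Y$ be linear operators on $E$, and let $\|\cdot\|$ denote operator norms; for $E=\mathbb{C}^D$ with the Euclidean norm this is the largest singular value. Let $\operatorname{spec}(X)=\{x_k\}$ be contained in the strip $\{\varphi<\operatorname{Im}z<\varphi+2\pi\}$ for some $\varphi\in\mathbb{R}$. Let $\log$ be the branch of the logarithm on $\mathbb{C}\setminus\{ye^{i\varphi}:y\ge0\}$ with imaginary part in $(\varphi,\varphi+2\pi)$, let $g(z)=z/(1-e^{-z})$, $g(0)=1$, and $\operatorname{ad}_X=[X,\,\cdot\,]$. For a function $h$ analytic near the spectrum of an operator $A$ put $h(A)=\frac1{2\pi i}\oint_\Gamma h(z)(z-A)^{-1}\,dz$, where $\Gamma$ consists of small positively oriented circles around the points of the spectrum. For an operator $A$ with spectral radius $r=r(A)$ and for $R>0$ put $$M_{\log}(A,R)=(r+R)\Bigl(1+\sqrt{\log^2(r+R)+\max[\varphi^2,(\varphi+2\pi)^2]}\Bigr),$$ and, with $\delta=2\pi-\max_{z\in\operatorname{spec}(A)}|\operatorname{Im}z|$,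 $$M_g(A,R)=\frac2\pi\sqrt{(r+R)^2+(2\pi-\delta+R)^2}\,\Bigl(\frac{2\pi-\delta+R}{2}\coth\frac{r+R}{2}+\frac{r+R}{s}\Bigr),$$ where $s=|\sin(\delta-R)|$ if $\cos(\delta-R)>0$ and $s=1$ otherwise. Let $$\delta_1=\min_k\min_{y\ge0}|e^{x_k}-ye^{i\varphi}|,\qquad \delta_2=2\pi-\max_{k,l}\operatorname{Im}(x_k-x_l),\qquad \alpha=\max_k\operatorname{Re}x_k,$$ let $0<R<\min(\delta_1,\delta_2)$ and $M=\max[M_{\log}(e^X,R),M_g(\operatorname{ad}_X,R)]$. Let $\nu>0$ satisfy $\nu e^{\alpha+\nu}\le R/2$ and $2D\nu\le R/2$, let $T_\nu:\mathbb{C}^D\to E$ (with the Euclidean norm on $\mathbb{C}^D$) be a linear isomorphism such that $T_\nu^{-1}XT_\nu$ is a Jordan matrix in which the entries $1$ on the superdiagonal are replaced by $\nu$, and let $\chi_\nu=\|T_\nu^{-1}\|\,\|T_\nu\|$. Then $\log e^X=X$, the operator $g(\operatorname{ad}_X)$ is defined, and for every $t\ge0$ with $$q(t):=\Bigl(1+\frac{8MD^4}{R^2}\Bigr)\frac{2D^2e^{\alpha+\nu}}{R}\,t\,\chi_\nu\|Y\|\,e^{t\chi_\nu\|Y\|}<1$$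 the operator $\log(e^Xe^{tY})$ is defined and $$\log(e^Xe^{tY})=X+t\,g(\operatorname{ad}_X)(Y)+W(t),\qquad \|W(t)\|\le\frac{32M^2D^9e^{\alpha+\nu}}{R^4}\cdot\frac{t^2\chi_\nu^3\|Y\|^2e^{t\chi_\nu\|Y\|}}{1-q(t)}.$$ -/

import Mathlib

open scoped Real Topology

noncomputable section

namespace BCHBound

/-- `IsPrimaryFunction h a b` says that `b` is the primary function `h(a)`, given by the
Dunford-Taylor integral `(2 π i)⁻¹ ∮_Γ h(z) (z - a)⁻¹ dz`: the stem function `h` is analytic in a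
neighbourhood of the spectrum of `a`, and the contour `Γ` consists of positively oriented circles
of a common radius `r` around the points of the spectrum of `a`. Every small enough `r > 0` gives
a contour in the domain of analyticity of `h` whose interiors are disjoint and cover the spectrum,
and all these contours give the value `b`. It is used only for `a` with finite spectrum. -/
def IsPrimaryFunction {A : Type*} [NormedRing A] [NormedAlgebra ℂ A]
    (h : ℂ → ℂ) (a b : A) : Prop :=
  (∀ x ∈ spectrum ℂ a, AnalyticAt ℂ h x) ∧
    ∀ᶠ r : ℝ in 𝓝[>] 0,
      (2 * (π : ℂ) * Complex.I)⁻¹ •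
        (∑ᶠ x ∈ spectrum ℂ a, ∮ z in C(x, r), h z • resolvent a z) = b

/-- The value of a primary function is unique. -/
theorem IsPrimaryFunction.unique {A : Type*} [NormedRing A] [NormedAlgebra ℂ A]
    {h : ℂ → ℂ} {a b c : A} (hb : IsPrimaryFunction h a b) (hc : IsPrimaryFunction h a c) :
    b = c := by
  obtain ⟨r, h1, h2⟩ := (hb.2.and hc.2).exists
  exact h1.symm.trans h2

/-- The branch of the logarithm with cut `{y e^{iφ} | y ≥ 0}` and imaginary part in
`(φ, φ + 2π)` off the cut. The number `-(z e^{-iφ})` has its argument in `(-π, π)` there,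
and `z` is obtained from it by a rotation by `φ + π`. -/
def logBranch (φ : ℝ) (z : ℂ) : ℂ :=
  Complex.log (-(z * Complex.exp (-((φ : ℂ) * Complex.I)))) + ((φ : ℂ) + (π : ℂ)) * Complex.I

/-- The stem function `g(z) = z / (1 - e^{-z})`, `g(0) = 1`. -/
def bchG (z : ℂ) : ℂ := if z = 0 then 1 else z / (1 - Complex.exp (-z))

/-- The superoperator `ad_a = [a, •]`. -/
def ad {A : Type*} [NormedRing A] [NormedAlgebra ℂ A] (a : A) : A →L[ℂ] A :=
  ContinuousLinearMap.mul ℂ A a - (ContinuousLinearMap.mul ℂ A).flip a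

theorem ad_apply {A : Type*} [NormedRing A] [NormedAlgebra ℂ A] (a b : A) :
    ad a b = a * b - b * a := by
  simp [ad]

/-- `M_log(a, R)`, for the branch of the logarithm with cut in the direction `φ`. -/
def mLog {A : Type*} [NormedRing A] [NormedAlgebra ℂ A] (φ : ℝ) (a : A) (R : ℝ) : ℝ :=
  ((spectralRadius ℂ a).toReal + R) *
    (1 + √(Real.log ((spectralRadius ℂ a).toReal + R) ^ 2 + max (φ ^ 2) ((φ + 2 * π) ^ 2)))

/-- `M_g(a, R)` in terms of the spectral radius `r` and of the gap `δ` between the spectrum of `a`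
and the lines `Im z = ± 2π`; `cosh / sinh` is the hyperbolic cotangent, and the `if` is
`θ(cos) |sin| + θ(-cos)` with the step function `θ` (both alternatives agree if the cosine
is zero). -/
def mG {A : Type*} [NormedRing A] [NormedAlgebra ℂ A] (a : A) (R : ℝ) : ℝ :=
  let r : ℝ := (spectralRadius ℂ a).toReal
  let δ : ℝ := 2 * π - ⨆ x : spectrum ℂ a, |(x : ℂ).im|
  2 / π * √((r + R) ^ 2 + (2 * π - δ + R) ^ 2) *
    ((2 * π - δ + R) / 2 * (Real.cosh ((r + R) / 2) / Real.sinh ((r + R) / 2)) +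
      (r + R) / (if 0 < Real.cos (δ - R) then |Real.sin (δ - R)| else 1))

/-- The gap `δ₁ = min_k min_{y ≥ 0} |e^{x_k} - y e^{iφ}|`. -/
def gapOne {A : Type*} [NormedRing A] [NormedAlgebra ℂ A] (φ : ℝ) (a : A) : ℝ :=
  ⨅ x : spectrum ℂ a, ⨅ y : Set.Ici (0 : ℝ),
    ‖Complex.exp (x : ℂ) - ((y : ℝ) : ℂ) * Complex.exp ((φ : ℂ) * Complex.I)‖

/-- The gap `δ₂ = 2π - max_{k,l} Im (x_k - x_l)`. -/
def gapTwo {A : Type*} [NormedRing A] [NormedAlgebra ℂ A] (a : A) : ℝ :=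
  2 * π - ⨆ x : spectrum ℂ a, ⨆ y : spectrum ℂ a, ((x : ℂ) - (y : ℂ)).im

/-- The largest real part `α = max_k Re x_k` of the spectrum. -/
def maxRe {A : Type*} [NormedRing A] [NormedAlgebra ℂ A] (a : A) : ℝ :=
  ⨆ x : spectrum ℂ a, (x : ℂ).re

/-- `J` is a Jordan matrix whose off-diagonal nonzero entries, all of them on the superdiagonal
inside a Jordan block (that is, between equal diagonal entries), are `ν` instead of `1`. -/
def IsScaledJordan {D : ℕ} (ν : ℝ) (J : Matrix (Fin D) (Fin D) ℂ) : Prop :=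
  ∀ i j : Fin D, i ≠ j → J i j ≠ 0 → (j : ℕ) = i + 1 ∧ J i j = (ν : ℂ) ∧ J i i = J j j

end BCHBound

end

/-!
In the coordinates `T` the operator `X` becomes a scaled Jordan matrix `J = Λ + K`, with `Λ` the
diagonal and `K` a nilpotent part that commutes with `Λ` and has operator norm at most `ν`.
Conjugation by `T` is an isomorphism of algebras; it preserves spectra, exponentials and primary
functions (`IsPrimaryFunction.map`) and multiplies norms by at most `χ` in either direction
(`exists_algEquiv_of_coordinates`), so the statement reduces to matrices with the norm of `ℂ^D`.

The small circles that define a primary function are replaced by fixed contours, on which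
perturbations can be controlled. A `WeightedContour` absorbs the stem function into its weights, so
that `h(a)` is the integral of the resolvent of `a`; a Cauchy formula for numbers near the spectrum
is all that is needed for this integral to be the primary function (`isPrimaryFunction_resInt`).
For the logarithm the contour is the boundary of a disc slit along the cut (`logContour`): the two
edges of the slit see values of the logarithm that differ by `2πi`, so the slit carries the weight
`-1` with respect to `dz`. For `g` it is the boundary of a rectangle (`bchContour`). The radius of
the disc and the sides of the rectangle leave distance `R` to the spectra of `e^J` and `ad J`, and
the total masses of the two contours are bounded by `M_log` and `M_g` (`logContour_mass_le`,
`bchContour_mass_le_mG`). Outside the slit disc and the rectangle the resolvents of `e^Λ` and `ad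
Λ` are bounded by `1/R` and `D/R`, the latter as a Schur multiplier; the conditions on `ν` make
`e^J` and `ad J` perturbations that at most double these bounds (`IsScaledJordan.resolvent_exp`,
`IsScaledJordan.resolvent_ad`). By the second resolvent identity, both functions are then defined
and Lipschitz near `e^J` and `ad J`, with explicit constants
(`WeightedContour.norm_resInt_sub_le`).

The identities `e^{log a} = a` and `log e^X = X` (`exp_log`, `log_exp`) follow by deforming the
operator to a scalar one inside the slit disc, respectively the strip, since the logarithm has the
expected derivative along commuting directions. Put `Z(s) = log (e^J e^{sb})`. Duhamel's formula
for the derivative of `e^{Z(s)} = e^J e^{sb}` reads `b = ∫₀¹ e^{-u ad Z} Z' du`, and `g(ad Z)`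
inverts this integral of exponentials (`bchG_mul_integral_exp`), whence `Z' = g(ad Z) b`
(`deriv_eq_bchG_ad_apply`). The remainder therefore has the derivative `W' = (g(ad Z) - g(ad J))
b`, and the mean value inequality bounds it by the two Lipschitz estimates
(`norm_log_exp_mul_exp_sub_le`). This gives the claimed bound with smaller powers of `D`
(`IsScaledJordan.exists_log_exp_mul_exp`, `error_bound_le`).
-/

noncomputable section

namespace BCHBound

open Complex MeasureTheory

set_option linter.unusedSectionVars false

/-! ### Resolvents -/

section Resolvent

variable {A : Type*} [NormedRing A] [NormedAlgebra ℂ A]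

theorem sub_mul_resolvent {a : A} {z : ℂ} (hz : z ∉ spectrum ℂ a) :
    (algebraMap ℂ A z - a) * resolvent a z = 1 :=
  Ring.mul_inverse_cancel _ (spectrum.notMem_iff.mp hz)

theorem resolvent_mul_sub {a : A} {z : ℂ} (hz : z ∉ spectrum ℂ a) :
    resolvent a z * (algebraMap ℂ A z - a) = 1 :=
  Ring.inverse_mul_cancel _ (spectrum.notMem_iff.mp hz)

theorem resolvent_eq_of_mul_eq_one {a b : A} {z : ℂ} (hz : z ∉ spectrum ℂ a)
    (h : (algebraMap ℂ A z - a) * b = 1) : resolvent a z = b := by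
  rw [← mul_one (resolvent a z), ← h, ← mul_assoc, resolvent_mul_sub hz, one_mul]

theorem smul_resolvent {a : A} {z : ℂ} (hz : z ∉ spectrum ℂ a) :
    z • resolvent a z = a * resolvent a z + 1 := by
  have h := sub_mul_resolvent hz
  rw [sub_mul, Algebra.algebraMap_eq_smul_one, smul_one_mul] at h
  rw [← h]; abel

theorem commute_resolvent {a b : A} (h : Commute a b) (z : ℂ) : Commute (resolvent a z) b := by
  have h1 : Commute (algebraMap ℂ A z - a) b := Commute.sub_left (Algebra.commutes z b) h
  by_cases hz : z ∈ spectrum ℂ a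
  · rw [spectrum.resolvent_zero_of_mem_spectrum hz]; exact Commute.zero_left b
  · have e := sub_mul_resolvent hz
    have e' := resolvent_mul_sub hz
    calc resolvent a z * b
        = resolvent a z * (b * (algebraMap ℂ A z - a)) * resolvent a z := by
          rw [mul_assoc, mul_assoc b, e, mul_one]
      _ = b * resolvent a z := by
          rw [← h1.eq, ← mul_assoc, e', one_mul]

/-- The second resolvent identity. -/
theorem resolvent_sub_resolvent {a b : A} {z : ℂ} (ha : z ∉ spectrum ℂ a)
    (hb : z ∉ spectrum ℂ b) :
    resolvent b z - resolvent a z = resolvent b z * (b - a) * resolvent a z := by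
  have h : b - a = (algebraMap ℂ A z - a) - (algebraMap ℂ A z - b) := by abel
  rw [h, mul_sub, sub_mul, mul_assoc, sub_mul_resolvent ha, resolvent_mul_sub hb, mul_one, one_mul]

/-- The first resolvent identity. -/
theorem resolvent_sub_resolvent_point {a : A} {z w : ℂ} (hz : z ∉ spectrum ℂ a)
    (hw : w ∉ spectrum ℂ a) :
    resolvent a z - resolvent a w = (w - z) • (resolvent a z * resolvent a w) := by
  have h : algebraMap ℂ A (w - z) = (algebraMap ℂ A w - a) - (algebraMap ℂ A z - a) := by
    rw [map_sub]; abel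
  rw [← mul_smul_comm, ← algebraMap_smul A, smul_eq_mul, h, sub_mul, mul_sub,
    sub_mul_resolvent hw, mul_one, ← mul_assoc, resolvent_mul_sub hz, one_mul]

theorem resolvent_algebraMap {c z : ℂ} (h : z ≠ c) :
    resolvent (algebraMap ℂ A c) z = algebraMap ℂ A (z - c)⁻¹ := by
  have hu : IsUnit (algebraMap ℂ A z - algebraMap ℂ A c) := by
    rw [← map_sub]; exact (IsUnit.mk0 _ (sub_ne_zero.mpr h)).map _
  refine resolvent_eq_of_mul_eq_one (spectrum.notMem_iff.mpr hu) ?_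
  rw [← map_sub, ← map_mul, mul_inv_cancel₀ (sub_ne_zero.mpr h), map_one]

theorem resolvent_complex (c z : ℂ) : resolvent c z = (z - c)⁻¹ := by
  rw [resolvent, Ring.inverse_eq_inv']; rfl

theorem spectrum_complex (c : ℂ) : spectrum ℂ c = {c} := by
  ext z
  rw [spectrum.mem_iff, isUnit_iff_ne_zero, not_not, sub_eq_zero]; rfl

variable [CompleteSpace A]

theorem continuousOn_resolvent (a : A) : ContinuousOn (resolvent a) (spectrum ℂ a)ᶜ := fun z hz =>
  (spectrum.hasDerivAt_resolvent_const_left (a := a) (k := z)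
    (not_not.mp hz)).continuousAt.continuousWithinAt

theorem hasDerivAt_resolvent_comp {a : A} {γ : ℝ → ℂ} {γ' : ℂ} {s : ℝ} (hγ : HasDerivAt γ γ' s)
    (h : γ s ∉ spectrum ℂ a) : HasDerivAt (fun s => resolvent a (γ s))
      (-(γ' • (resolvent a (γ s) * resolvent a (γ s)))) s := by
  have h1 : HasDerivAt (resolvent a) (-resolvent a (γ s) ^ 2) (γ s) :=
    spectrum.hasDerivAt_resolvent_const_left (not_not.mp h)
  exact (h1.scomp s hγ).congr_deriv (by rw [smul_neg, sq])

/-- A perturbation of size `δ` with `κ δ < 1` keeps a point with resolvent bound `κ` off the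
spectrum. -/
theorem notMem_spectrum_of_norm_sub_lt {a b : A} {z : ℂ} {κ δ : ℝ} (hz : z ∉ spectrum ℂ a)
    (hκ : ‖resolvent a z‖ ≤ κ) (hδ : ‖b - a‖ ≤ δ) (h : κ * δ < 1) : z ∉ spectrum ℂ b := by
  have h1 : ‖resolvent a z * (b - a)‖ < 1 :=
    (norm_mul_le _ _).trans_lt ((mul_le_mul hκ hδ (norm_nonneg _)
      ((norm_nonneg _).trans hκ)).trans_lt h)
  have h2 : algebraMap ℂ A z - b = (algebraMap ℂ A z - a) * (1 - resolvent a z * (b - a)) := by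
    rw [mul_sub, ← mul_assoc, sub_mul_resolvent hz, one_mul, mul_one]; abel
  rw [spectrum.notMem_iff, h2]
  exact (spectrum.notMem_iff.mp hz).mul (Units.oneSub _ h1).isUnit

theorem norm_resolvent_le_of_norm_sub_le {a b : A} {z : ℂ} {κ δ : ℝ} (hz : z ∉ spectrum ℂ a)
    (hκ : ‖resolvent a z‖ ≤ κ) (hδ : ‖b - a‖ ≤ δ) (h : κ * δ < 1) :
    ‖resolvent b z‖ ≤ κ / (1 - κ * δ) := by
  have hb := notMem_spectrum_of_norm_sub_lt hz hκ hδ h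
  have h1 := resolvent_sub_resolvent hz hb
  rw [le_div_iff₀ (by linarith)]
  have h2 : ‖resolvent b z‖ ≤ ‖resolvent b z‖ * δ * κ + κ := by
    calc ‖resolvent b z‖ = ‖resolvent b z * (b - a) * resolvent a z + resolvent a z‖ := by
          rw [← h1]; congr 1; abel
      _ ≤ ‖resolvent b z‖ * ‖b - a‖ * ‖resolvent a z‖ + ‖resolvent a z‖ :=
          (norm_add_le _ _).trans (add_le_add_left (norm_mul₃_le) _)
      _ ≤ _ := by
          have := (norm_nonneg _).trans hδ
          gcongr
  nlinarith

theorem norm_resolvent_sub_le {a b : A} {z : ℂ} {κ δ : ℝ} (hz : z ∉ spectrum ℂ a)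
    (hκ : ‖resolvent a z‖ ≤ κ) (hδ : ‖b - a‖ ≤ δ) (h : κ * δ < 1) :
    ‖resolvent b z - resolvent a z‖ ≤ κ ^ 2 * δ / (1 - κ * δ) := by
  have hb := notMem_spectrum_of_norm_sub_lt hz hκ hδ h
  have hκ0 : 0 ≤ κ := (norm_nonneg _).trans hκ
  have hδ0 : 0 ≤ δ := (norm_nonneg _).trans hδ
  have h3 := norm_resolvent_le_of_norm_sub_le hz hκ hδ h
  rw [resolvent_sub_resolvent hz hb]
  calc _ ≤ ‖resolvent b z‖ * ‖b - a‖ * ‖resolvent a z‖ := norm_mul₃_le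
    _ ≤ κ / (1 - κ * δ) * δ * κ := by
        gcongr
    _ = _ := by ring

theorem isCompact_norm_resolvent_le {a : A} {K : Set ℂ} (hK : IsCompact K)
    (hd : Disjoint K (spectrum ℂ a)) : ∃ κ > 0, ∀ z ∈ K, ‖resolvent a z‖ ≤ κ := by
  obtain ⟨κ, h⟩ := hK.exists_bound_of_continuousOn
    ((continuousOn_resolvent a).mono hd.subset_compl_right)
  exact ⟨max κ 1, by positivity, fun z hz => (h z hz).trans (le_max_left _ _)⟩

end Resolvent

/-! ### Weighted contours -/

/-- A finite family of continuous curves `pt i : [lo i, hi i] → ℂ` with continuous complex weights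
`wt i`. It stands for the functional `f ↦ ∑ i, ∫ s in lo i..hi i, wt i s • f (pt i s)`: line
integrals and integrals of the jump of a function over a cut are of this form. -/
structure WeightedContour (ι : Type) where
  /-- The left endpoints of the parameter intervals. -/
  lo : ι → ℝ
  /-- The right endpoints of the parameter intervals. -/
  hi : ι → ℝ
  le : ∀ i, lo i ≤ hi i
  /-- The weights. -/
  wt : ι → ℝ → ℂ
  /-- The curves. -/
  pt : ι → ℝ → ℂ
  continuous_wt : ∀ i, Continuous (wt i)
  continuous_pt : ∀ i, Continuous (pt i)

namespace WeightedContour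

variable {ι : Type} [Fintype ι] (C : WeightedContour ι)
variable {F : Type*} [NormedAddCommGroup F] [NormedSpace ℂ F]
variable {G : Type*} [NormedAddCommGroup G] [NormedSpace ℂ G]

/-- The integral of `f` over the weighted contour. -/
def eval (f : ℂ → F) : F := ∑ i, ∫ s in C.lo i..C.hi i, C.wt i s • f (C.pt i s)

/-- The union of the traces of the curves. -/
def carrier : Set ℂ := ⋃ i, C.pt i '' Set.Icc (C.lo i) (C.hi i)

/-- The total mass of the weights. -/
def mass : ℝ := ∑ i, ∫ s in C.lo i..C.hi i, ‖C.wt i s‖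

theorem mass_nonneg : 0 ≤ C.mass :=
  Finset.sum_nonneg fun i _ => intervalIntegral.integral_nonneg (C.le i) fun _ _ => norm_nonneg _

theorem isCompact_carrier : IsCompact C.carrier :=
  isCompact_iUnion fun i => isCompact_Icc.image (C.continuous_pt i)

theorem pt_mem {i : ι} {s : ℝ} (hs : s ∈ Set.Icc (C.lo i) (C.hi i)) : C.pt i s ∈ C.carrier :=
  Set.mem_iUnion.mpr ⟨i, s, hs, rfl⟩

theorem pt_mem' {i : ι} {s : ℝ} (hs : s ∈ Set.uIcc (C.lo i) (C.hi i)) : C.pt i s ∈ C.carrier :=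
  C.pt_mem (by rwa [Set.uIcc_of_le (C.le i)] at hs)

theorem continuousOn_comp_pt {f : ℂ → F} (hf : ContinuousOn f C.carrier) (i : ι) :
    ContinuousOn (fun s => f (C.pt i s)) (Set.Icc (C.lo i) (C.hi i)) :=
  hf.comp (C.continuous_pt i).continuousOn fun _ hs => C.pt_mem hs

theorem intervalIntegrable {f : ℂ → F} (hf : ContinuousOn f C.carrier) (i : ι) :
    IntervalIntegrable (fun s => C.wt i s • f (C.pt i s)) volume (C.lo i) (C.hi i) := by
  apply ContinuousOn.intervalIntegrable
  rw [Set.uIcc_of_le (C.le i)]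
  exact (C.continuous_wt i).continuousOn.smul (C.continuousOn_comp_pt hf i)

theorem eval_congr {f g : ℂ → F} (h : Set.EqOn f g C.carrier) : C.eval f = C.eval g :=
  Finset.sum_congr rfl fun i _ => intervalIntegral.integral_congr fun s hs => by
    simp only [h (C.pt_mem' hs)]

theorem eval_sub {f g : ℂ → F} (hf : ContinuousOn f C.carrier) (hg : ContinuousOn g C.carrier) :
    C.eval (fun z => f z - g z) = C.eval f - C.eval g := by
  simp only [eval, smul_sub, ← Finset.sum_sub_distrib]
  exact Finset.sum_congr rfl fun i _ =>
    intervalIntegral.integral_sub (C.intervalIntegrable hf i) (C.intervalIntegrable hg i)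

theorem eval_clm [CompleteSpace F] [CompleteSpace G] (L : F →L[ℂ] G) {f : ℂ → F}
    (hf : ContinuousOn f C.carrier) : C.eval (fun z => L (f z)) = L (C.eval f) := by
  simp only [eval, map_sum]
  refine Finset.sum_congr rfl fun i _ => ?_
  rw [← L.intervalIntegral_comp_comm (C.intervalIntegrable hf i)]
  simp

theorem norm_eval_le {f : ℂ → F} {κ : ℝ} (h : ∀ z ∈ C.carrier, ‖f z‖ ≤ κ) :
    ‖C.eval f‖ ≤ C.mass * κ := by
  rw [eval, mass, Finset.sum_mul]
  refine (norm_sum_le _ _).trans (Finset.sum_le_sum fun i _ => ?_)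
  rw [← intervalIntegral.integral_mul_const]
  refine intervalIntegral.norm_integral_le_of_norm_le (C.le i) ?_
    ((C.continuous_wt i).norm.mul continuous_const |>.intervalIntegrable _ _)
  refine Filter.Eventually.of_forall fun s hs => ?_
  rw [norm_smul]
  exact mul_le_mul_of_nonneg_left (h _ (C.pt_mem (Set.Ioc_subset_Icc_self hs))) (norm_nonneg _)

variable {A : Type*} [NormedRing A] [NormedAlgebra ℂ A] [CompleteSpace A]

/-- The value of the functional calculus of the contour: the integral of the resolvent. -/
def resInt (a : A) : A := C.eval (resolvent a)

theorem continuousOn_resolvent {a : A} (h : Disjoint C.carrier (spectrum ℂ a)) :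
    ContinuousOn (resolvent a) C.carrier :=
  (BCHBound.continuousOn_resolvent a).mono h.subset_compl_right

theorem commute_eval {f : ℂ → A} {b : A} (hf : ContinuousOn f C.carrier)
    (h : ∀ z, Commute (f z) b) : Commute (C.eval f) b := by
  have h1 := C.eval_clm ((ContinuousLinearMap.mul ℂ A).flip b) hf
  have h2 := C.eval_clm (ContinuousLinearMap.mul ℂ A b) hf
  simp only [ContinuousLinearMap.flip_apply, ContinuousLinearMap.mul_apply'] at h1 h2
  change C.eval f * b = b * C.eval f
  rw [← h1, ← h2]
  exact C.eval_congr fun z _ => (h z).eq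

theorem commute_resInt {a b : A} (h : Disjoint C.carrier (spectrum ℂ a)) (hb : Commute a b) :
    Commute (C.resInt a) b :=
  C.commute_eval (C.continuousOn_resolvent h) fun z => commute_resolvent hb z

theorem disjoint_of_norm_sub_le {a b : A} {κ δ : ℝ} (h : Disjoint C.carrier (spectrum ℂ a))
    (hκ : ∀ z ∈ C.carrier, ‖resolvent a z‖ ≤ κ) (hδ : ‖b - a‖ ≤ δ) (hκδ : κ * δ < 1) :
    Disjoint C.carrier (spectrum ℂ b) :=
  Set.disjoint_left.mpr fun z hz =>
    notMem_spectrum_of_norm_sub_lt (Set.disjoint_left.mp h hz) (hκ z hz) hδ hκδ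

theorem norm_resInt_sub_le {a b : A} {κ δ : ℝ} (h : Disjoint C.carrier (spectrum ℂ a))
    (hκ : ∀ z ∈ C.carrier, ‖resolvent a z‖ ≤ κ) (hδ : ‖b - a‖ ≤ δ) (hκδ : κ * δ < 1) :
    ‖C.resInt b - C.resInt a‖ ≤ C.mass * (κ ^ 2 * δ / (1 - κ * δ)) := by
  rw [resInt, resInt, ← C.eval_sub
    (C.continuousOn_resolvent (C.disjoint_of_norm_sub_le h hκ hδ hκδ)) (C.continuousOn_resolvent h)]
  exact C.norm_eval_le fun z hz =>
    norm_resolvent_sub_le (Set.disjoint_left.mp h hz) (hκ z hz) hδ hκδ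

/-- Differentiation under the integral sign; the remainder is quadratic by the second resolvent
identity. -/
theorem hasDerivAt_resInt {a : ℝ → A} {a' : A} {s : ℝ} (ha : HasDerivAt a a' s)
    (h : Disjoint C.carrier (spectrum ℂ (a s))) :
    HasDerivAt (fun t => C.resInt (a t))
      (C.eval fun z => resolvent (a s) z * a' * resolvent (a s) z) s := by
  obtain ⟨κ, hκ0, hκ⟩ := isCompact_norm_resolvent_le C.isCompact_carrier h
  have hR := C.continuousOn_resolvent h
  -- `d b` is the derivative of `C.resInt` at `a s` in the direction `b`.
  set d : A → A := fun b => C.eval fun z => resolvent (a s) z * b * resolvent (a s) z with hd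
  have hdc : ∀ b : A, ContinuousOn (fun z => resolvent (a s) z * b * resolvent (a s) z)
    C.carrier := fun b => (hR.mul continuousOn_const).mul hR
  have hdn : ∀ b, ‖d b‖ ≤ C.mass * (κ * κ) * ‖b‖ := fun b => by
    rw [mul_assoc]
    refine C.norm_eval_le fun z hz => norm_mul₃_le.trans ?_
    have := hκ z hz
    calc _ ≤ κ * ‖b‖ * κ := by gcongr
      _ = _ := by ring
  have hquad : ∀ b, ‖b - a s‖ ≤ 1 / (2 * κ) →
      ‖C.resInt b - C.resInt (a s) - d (b - a s)‖ ≤ C.mass * (2 * κ ^ 3) * ‖b - a s‖ ^ 2 := by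
    intro b hb
    have hκδ : κ * ‖b - a s‖ ≤ 1 / 2 := by
      calc _ ≤ κ * (1 / (2 * κ)) := by gcongr
        _ = 1 / 2 := by field_simp
    have hb' := C.disjoint_of_norm_sub_le h hκ le_rfl (by linarith : κ * ‖b - a s‖ < 1)
    rw [resInt, resInt, ← C.eval_sub (C.continuousOn_resolvent hb') hR, mul_assoc]
    simp only [hd]
    rw [← C.eval_sub (f := fun z => resolvent b z - resolvent (a s) z)
      ((C.continuousOn_resolvent hb').sub hR) (hdc _)]
    refine C.norm_eval_le fun z hz => ?_
    have hz1 := Set.disjoint_left.mp h hz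
    have hz2 := Set.disjoint_left.mp hb' hz
    rw [resolvent_sub_resolvent hz1 hz2, ← sub_mul, ← sub_mul]
    have h3 := norm_resolvent_sub_le hz1 (hκ z hz) le_rfl (by linarith : κ * ‖b - a s‖ < 1)
    have h4 : κ ^ 2 * ‖b - a s‖ / (1 - κ * ‖b - a s‖) ≤ 2 * κ ^ 2 * ‖b - a s‖ := by
      rw [div_le_iff₀ (by linarith)]
      nlinarith [mul_nonneg (sq_nonneg κ) (norm_nonneg (b - a s))]
    calc _ ≤ ‖resolvent b z - resolvent (a s) z‖ * ‖b - a s‖ * ‖resolvent (a s) z‖ := norm_mul₃_le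
      _ ≤ (2 * κ ^ 2 * ‖b - a s‖) * ‖b - a s‖ * κ := by
          gcongr
          · exact h3.trans h4
          · exact hκ z hz
      _ = _ := by ring
  have hsub : ∀ b c, d (b - c) = d b - d c := fun b c => by
    simp only [hd]
    rw [← C.eval_sub (hdc b) (hdc c)]
    exact C.eval_congr fun z _ => by simp only [mul_sub, sub_mul]
  have hsmul : ∀ (x : ℝ) b, d (x • b) = x • d b := fun x b => by
    have := C.eval_clm ((x : ℂ) • ContinuousLinearMap.id ℂ A) (hdc b)
    simp only [_root_.smul_apply, ContinuousLinearMap.id_apply,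
      Complex.coe_smul] at this
    simp only [hd]
    rw [← this]
    exact C.eval_congr fun z _ => by simp
  rw [hasDerivAt_iff_isLittleO]
  have hlin := (hasDerivAt_iff_isLittleO.mp ha)
  have h1 : (fun t => d (a t - a s - (t - s) • a')) =o[𝓝 s] fun t => t - s :=
    (Asymptotics.IsBigO.of_bound _ (Filter.Eventually.of_forall fun t => hdn _)).trans_isLittleO
      hlin
  have hcont : Filter.Tendsto (fun t => a t - a s) (𝓝 s) (𝓝 0) := by
    simpa using (ha.continuousAt.tendsto.sub_const (a s))
  have h2 : (fun t => C.resInt (a t) - C.resInt (a s) - d (a t - a s)) =o[𝓝 s] fun t => t - s := by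
    have hev : ∀ᶠ t in 𝓝 s, ‖a t - a s‖ ≤ 1 / (2 * κ) := by
      have := hcont.norm
      rw [norm_zero] at this
      exact this.eventually_le_const (by positivity)
    refine (Asymptotics.IsBigO.of_bound (g := fun t => ‖a t - a s‖ ^ 2) (C.mass * (2 * κ ^ 3))
      (hev.mono fun t ht => ?_)).trans_isLittleO ?_
    · rw [norm_pow, norm_norm]; exact hquad _ ht
    · exact ((Asymptotics.isLittleO_norm_pow_id (E' := A) one_lt_two).comp_tendsto
        hcont).trans_isBigO ha.isBigO_sub
  refine (h2.add h1).congr_left fun t => ?_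
  rw [hsub (a t - a s), hsmul]
  simp only [hd]
  abel

end WeightedContour

/-! ### Small circles around the spectrum -/

section Circles

variable {A : Type*} [NormedRing A] [NormedAlgebra ℂ A] [FiniteDimensional ℂ A]

theorem mem_spectrum_of_mul_eq_smul {a v : A} {z : ℂ} (hv : v ≠ 0) (h : a * v = z • v) :
    z ∈ spectrum ℂ a := by
  intro hu
  refine hv ((spectrum.mem_resolventSet_iff.mp hu).mul_right_eq_zero.mp ?_)
  rw [sub_mul, h, Algebra.algebraMap_eq_smul_one, smul_one_mul, sub_self]

theorem mem_spectrum_of_mul_eq_smul_right {a v : A} {z : ℂ} (hv : v ≠ 0) (h : v * a = z • v) :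
    z ∈ spectrum ℂ a := by
  intro hu
  refine hv ((spectrum.mem_resolventSet_iff.mp hu).mul_left_eq_zero.mp ?_)
  rw [mul_sub, h, Algebra.algebraMap_eq_smul_one, mul_smul_one, sub_self]

theorem exists_mul_eq_smul {a : A} {z : ℂ} (hz : z ∈ spectrum ℂ a) :
    ∃ v : A, v ≠ 0 ∧ a * v = z • v := by
  by_contra! hne
  apply hz
  set b := algebraMap ℂ A z - a with hb
  have hinj : ∀ v, b * v = 0 → v = 0 := by
    intro v hv
    by_contra h0
    apply hne v h0
    rw [hb, sub_mul, Algebra.algebraMap_eq_smul_one, smul_one_mul, sub_eq_zero] at hv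
    exact hv.symm
  have hsurj : Function.Surjective (LinearMap.mulLeft ℂ b) :=
    LinearMap.surjective_of_injective ((injective_iff_map_eq_zero _).mpr hinj)
  obtain ⟨u, hu⟩ := hsurj 1
  have hu' : b * u = 1 := hu
  have hub : u * b = 1 := by
    rw [← sub_eq_zero]
    apply hinj
    rw [mul_sub, ← mul_assoc, hu', one_mul, mul_one, sub_self]
  exact ⟨⟨b, u, hu', hub⟩, rfl⟩

theorem spectrum_finite (a : A) : (spectrum ℂ a).Finite := by
  refine ((Algebra.lmul ℂ A a).finite_hasEigenvalue).subset fun z hz => ?_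
  obtain ⟨v, hv, h⟩ := exists_mul_eq_smul hz
  exact Module.End.hasEigenvalue_of_hasEigenvector
    (Module.End.hasEigenvector_iff.mpr ⟨Module.End.mem_eigenspace_iff.mpr h, hv⟩)

/-- On a generalized eigenvector the resolvent is a finite Laurent polynomial. -/
theorem resolvent_mul_of_pow_mul_eq_zero {a v : A} {x z : ℂ} {k : ℕ} (hz : z ∉ spectrum ℂ a)
    (hzx : z ≠ x) (hv : (a - algebraMap ℂ A x) ^ k * v = 0) :
    resolvent a z * v =
      ∑ j ∈ Finset.range k, ((z - x) ^ (j + 1))⁻¹ • ((a - algebraMap ℂ A x) ^ j * v) := by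
  have hzx' : z - x ≠ 0 := sub_ne_zero.mpr hzx
  have key : ∀ k : ℕ, (algebraMap ℂ A z - a) *
      ∑ j ∈ Finset.range k, ((z - x) ^ (j + 1))⁻¹ • ((a - algebraMap ℂ A x) ^ j * v) =
      v - ((z - x) ^ k)⁻¹ • ((a - algebraMap ℂ A x) ^ k * v) := by
    intro k
    induction k with
    | zero => simp
    | succ k ih =>
      have e : algebraMap ℂ A z - a =
          algebraMap ℂ A (z - x) - (a - algebraMap ℂ A x) := by rw [map_sub]; abel
      rw [Finset.sum_range_succ, mul_add, ih, e, mul_smul_comm, sub_mul,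
        Algebra.algebraMap_eq_smul_one (z - x), smul_one_mul, smul_sub, smul_smul, ← mul_assoc,
        ← pow_succ', pow_succ (z - x), mul_inv, mul_assoc, inv_mul_cancel₀ hzx', mul_one]
      abel
  have h := key k
  rw [hv, smul_zero, sub_zero] at h
  conv_lhs => rw [← h]
  rw [← mul_assoc, resolvent_mul_sub hz, one_mul]

theorem circleIntegral_inv_sub_pow_of_notMem {x y : ℂ} {r : ℝ} (hr : 0 < r)
    (h : x ∉ Metric.closedBall y r) (j : ℕ) : (∮ z in C(y, r), ((z - x) ^ (j + 1))⁻¹) = 0 := by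
  refine circleIntegral_eq_zero_of_differentiable_on_off_countable hr.le
    Set.countable_empty ?_ ?_
  · refine ContinuousOn.inv₀ (by fun_prop) fun z hz => pow_ne_zero _ (sub_ne_zero.mpr ?_)
    rintro rfl; exact h hz
  · intro z hz
    refine DifferentiableAt.inv (by fun_prop) (pow_ne_zero _ (sub_ne_zero.mpr ?_))
    rintro rfl; exact h (Metric.ball_subset_closedBall hz.1)

theorem circleIntegral_inv_sub_pow_self (x : ℂ) {r : ℝ} (hr : 0 < r) (j : ℕ) :
    (∮ z in C(x, r), ((z - x) ^ (j + 1))⁻¹) = if j = 0 then 2 * π * I else 0 := by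
  split_ifs with hj
  · subst hj
    simpa using circleIntegral.integral_sub_center_inv x hr.ne'
  · have := circleIntegral.integral_sub_zpow_of_ne (n := -(j + 1 : ℕ)) (by omega) x x r
    simpa only [zpow_neg, zpow_natCast] using this

variable [CompleteSpace A]

theorem continuousOn_resolvent_sphere {a : A} {x : ℂ} {r : ℝ}
    (h : Disjoint (Metric.sphere x r) (spectrum ℂ a)) :
    ContinuousOn (resolvent a) (Metric.sphere x r) :=
  (continuousOn_resolvent a).mono h.subset_compl_right

theorem circleIntegral_clm {F G : Type*} [NormedAddCommGroup F] [NormedSpace ℂ F] [CompleteSpace F]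
    [NormedAddCommGroup G] [NormedSpace ℂ G] [CompleteSpace G] (L : F →L[ℂ] G) {f : ℂ → F} {x : ℂ}
    {r : ℝ} (hf : CircleIntegrable f x r) : (∮ z in C(x, r), L (f z)) = L (∮ z in C(x, r), f z) := by
  rw [circleIntegral, circleIntegral, ← L.intervalIntegral_comp_comm hf.out]
  simp

/-- The Riesz projections of all points of the spectrum add up to the identity. -/
theorem sum_circleIntegral_resolvent {a : A} {r : ℝ} (hr : 0 < r) {S : Finset ℂ}
    (hS : (S : Set ℂ) = spectrum ℂ a)
    (hsep : ∀ x ∈ S, ∀ y ∈ S, x ≠ y → x ∉ Metric.closedBall y r) :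
    ∑ y ∈ S, (∮ z in C(y, r), resolvent a z) = (2 * π * I) • (1 : A) := by
  have hsph : ∀ y ∈ S, Disjoint (Metric.sphere y r) (spectrum ℂ a) := by
    intro y hy
    refine Set.disjoint_left.mpr fun z hz hz' => ?_
    rw [← hS] at hz'
    by_cases h : z = y
    · subst h; rw [mem_sphere_iff_norm] at hz; simp at hz; linarith
    · exact hsep z hz' y hy h (Metric.sphere_subset_closedBall hz)
  set P : A := ∑ y ∈ S, (∮ z in C(y, r), resolvent a z) with hP
  suffices h : LinearMap.ker (LinearMap.mulLeft ℂ (P - (2 * π * I) • (1 : A))) = ⊤ by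
    have h1 : (1 : A) ∈ LinearMap.ker (LinearMap.mulLeft ℂ (P - (2 * π * I) • (1 : A))) := by
      rw [h]; trivial
    rw [LinearMap.mem_ker, LinearMap.mulLeft_apply, mul_one, sub_eq_zero] at h1
    exact h1
  rw [eq_top_iff, ← Module.End.iSup_maxGenEigenspace_eq_top (Algebra.lmul ℂ A a)]
  refine iSup_le fun x v hv => ?_
  rw [LinearMap.mem_ker, LinearMap.mulLeft_apply]
  obtain ⟨k, hk⟩ := (Module.End.mem_maxGenEigenspace _ _ _).mp hv
  have hk : (a - algebraMap ℂ A x) ^ k * v = 0 := by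
    have e : Algebra.lmul ℂ A a - x • (1 : Module.End ℂ A) =
        Algebra.lmul ℂ A (a - algebraMap ℂ A x) := by
      rw [map_sub, AlgHom.commutes, Algebra.algebraMap_eq_smul_one]
    rw [e, ← map_pow] at hk
    exact hk
  by_cases hx : x ∈ spectrum ℂ a
  swap
  · have hu : IsUnit (a - algebraMap ℂ A x) := by
      rw [← neg_sub]; exact (spectrum.notMem_iff.mp hx).neg
    rw [(hu.pow k).mul_right_eq_zero.mp hk, mul_zero]
  have hterm : ∀ y ∈ S, (∮ z in C(y, r), resolvent a z) * v =
      ∑ j ∈ Finset.range k, (∮ z in C(y, r), ((z - x) ^ (j + 1))⁻¹) •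
        ((a - algebraMap ℂ A x) ^ j * v) := by
    intro y hy
    have hc := continuousOn_resolvent_sphere (hsph y hy)
    have hne : ∀ z ∈ Metric.sphere y r, z ≠ x := by
      rintro z hz rfl; exact Set.disjoint_left.mp (hsph y hy) hz hx
    have h1 := circleIntegral_clm ((ContinuousLinearMap.mul ℂ A).flip v)
      (hc.circleIntegrable hr.le)
    simp only [ContinuousLinearMap.flip_apply, ContinuousLinearMap.mul_apply'] at h1
    rw [← h1, circleIntegral.integral_congr hr.le (fun z hz =>
      resolvent_mul_of_pow_mul_eq_zero (Set.disjoint_left.mp (hsph y hy) hz) (hne z hz) hk),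
      circleIntegral.integral_fun_sum]
    · exact Finset.sum_congr rfl fun j _ => circleIntegral.integral_smul_const _ _ _ _
    · intro j _
      refine ContinuousOn.circleIntegrable hr.le (ContinuousOn.smul (ContinuousOn.inv₀
        (by fun_prop) fun z hz => pow_ne_zero _ (sub_ne_zero.mpr (hne z hz))) continuousOn_const)
  have hxS : x ∈ S := by rw [← Finset.mem_coe, hS]; exact hx
  rw [sub_mul, smul_one_mul, sub_eq_zero, hP, Finset.sum_mul, Finset.sum_congr rfl hterm,
    Finset.sum_eq_single_of_mem x hxS]
  · simp only [circleIntegral_inv_sub_pow_self x hr, ite_smul, zero_smul]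
    rw [Finset.sum_ite_eq']
    split_ifs with h0
    · simp
    · have : k = 0 := by simpa using h0
      subst this
      simp only [pow_zero, one_mul] at hk
      rw [hk, smul_zero]
  · intro y hy hyx
    refine Finset.sum_eq_zero fun j _ => ?_
    rw [circleIntegral_inv_sub_pow_of_notMem hr (hsep x hxS y hy hyx.symm), zero_smul]

/-- By the first resolvent identity the integrand is `(w - z)⁻¹ R(w)` plus `R(z) R(w)`, and the scalar
factor of the former is holomorphic in the disc. -/
theorem circleIntegral_inv_smul_resolvent {a : A} {y : ℂ} {r : ℝ} (hr : 0 < r)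
    (hsph : Disjoint (Metric.sphere y r) (spectrum ℂ a)) {w : ℂ} (hwa : w ∉ spectrum ℂ a)
    (hw : w ∉ Metric.closedBall y r) :
    (∮ z in C(y, r), (w - z)⁻¹ • resolvent a z) =
      (∮ z in C(y, r), resolvent a z) * resolvent a w := by
  have hc := continuousOn_resolvent_sphere hsph
  have hne : ∀ z ∈ Metric.closedBall y r, w - z ≠ 0 := by
    intro z hz h; rw [sub_eq_zero] at h; subst h; exact hw hz
  have hci : ContinuousOn (fun z => (w - z)⁻¹) (Metric.closedBall y r) :=
    ContinuousOn.inv₀ (by fun_prop) hne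
  have hzero : (∮ z in C(y, r), (w - z)⁻¹) = 0 := by
    refine circleIntegral_eq_zero_of_differentiable_on_off_countable hr.le
      Set.countable_empty hci fun z hz => ?_
    exact DifferentiableAt.inv (by fun_prop) (hne z (Metric.ball_subset_closedBall hz.1))
  have h1 := circleIntegral_clm ((ContinuousLinearMap.mul ℂ A).flip (resolvent a w))
    (hc.circleIntegrable hr.le)
  simp only [ContinuousLinearMap.flip_apply, ContinuousLinearMap.mul_apply'] at h1
  have hsplit : ∀ z ∈ Metric.sphere y r, (w - z)⁻¹ • resolvent a z =
      (w - z)⁻¹ • resolvent a w + resolvent a z * resolvent a w := by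
    intro z hz
    have := resolvent_sub_resolvent_point (Set.disjoint_left.mp hsph hz) hwa
    rw [sub_eq_iff_eq_add'] at this
    rw [this, smul_add, smul_smul, inv_mul_cancel₀ (hne z (Metric.sphere_subset_closedBall hz)),
      one_smul, ← this]
  rw [circleIntegral.integral_congr hr.le hsplit, circleIntegral.integral_add,
    circleIntegral.integral_smul_const, hzero, zero_smul, zero_add, h1]
  · exact ((hci.mono Metric.sphere_subset_closedBall).smul
      continuousOn_const).circleIntegrable hr.le
  · exact (hc.mul continuousOn_const).circleIntegrable hr.le

/-- Fubini's theorem for a circle and a weighted contour. -/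
theorem circleIntegral_eval {ι : Type} [Fintype ι] (C : WeightedContour ι) {a : A} {y : ℂ} {r : ℝ}
    (hr : 0 < r) (hsph : Disjoint (Metric.sphere y r) (spectrum ℂ a))
    (hC : Disjoint C.carrier (Metric.sphere y r)) :
    (∮ z in C(y, r), C.eval (fun w => (w - z)⁻¹) • resolvent a z) =
      C.eval fun w => ∮ z in C(y, r), (w - z)⁻¹ • resolvent a z := by
  have hc := continuousOn_resolvent_sphere hsph
  have hcm : ∀ θ, circleMap y r θ ∈ Metric.sphere y r := circleMap_mem_sphere y hr.le
  have hRc : Continuous fun θ => resolvent a (circleMap y r θ) :=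
    hc.comp_continuous (continuous_circleMap y r) hcm
  have hcont : ∀ i, ContinuousOn (Function.uncurry fun (θ s : ℝ) =>
      deriv (circleMap y r) θ • ((C.wt i s * (C.pt i s - circleMap y r θ)⁻¹) •
        resolvent a (circleMap y r θ))) (Set.univ ×ˢ Set.Icc (C.lo i) (C.hi i)) := by
    intro i
    have h1 : Continuous fun p : ℝ × ℝ => circleMap y r p.1 :=
      (continuous_circleMap y r).comp continuous_fst
    have h2 : Continuous fun p : ℝ × ℝ => C.pt i p.2 := (C.continuous_pt i).comp continuous_snd
    have h3 : Continuous fun p : ℝ × ℝ => C.wt i p.2 := (C.continuous_wt i).comp continuous_snd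
    have h4 : Continuous fun p : ℝ × ℝ => resolvent a (circleMap y r p.1) :=
      hRc.comp continuous_fst
    have h5 : Continuous fun p : ℝ × ℝ => deriv (circleMap y r) p.1 := by
      simp only [deriv_circleMap]
      exact ((continuous_circleMap 0 r).comp continuous_fst).mul continuous_const
    have h6 : ContinuousOn (fun p : ℝ × ℝ => (C.pt i p.2 - circleMap y r p.1)⁻¹)
        (Set.univ ×ˢ Set.Icc (C.lo i) (C.hi i)) := by
      refine ContinuousOn.inv₀ (h2.sub h1).continuousOn fun p hp h => ?_
      exact Set.disjoint_left.mp hC (C.pt_mem hp.2) (by rw [sub_eq_zero.mp h]; exact hcm _)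
    exact h5.continuousOn.smul ((h3.continuousOn.mul h6).smul h4.continuousOn)
  have hl : ∀ θ, deriv (circleMap y r) θ • (C.eval (fun w => (w - circleMap y r θ)⁻¹) •
      resolvent a (circleMap y r θ)) = ∑ i, ∫ s in C.lo i..C.hi i,
        deriv (circleMap y r) θ • ((C.wt i s * (C.pt i s - circleMap y r θ)⁻¹) •
        resolvent a (circleMap y r θ)) := by
    intro θ
    rw [WeightedContour.eval, Finset.sum_smul, Finset.smul_sum]
    refine Finset.sum_congr rfl fun i _ => ?_
    rw [intervalIntegral.integral_smul, intervalIntegral.integral_smul_const]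
    rfl
  have hint : ∀ i, IntegrableOn (Function.uncurry fun (θ s : ℝ) =>
      deriv (circleMap y r) θ • ((C.wt i s * (C.pt i s - circleMap y r θ)⁻¹) •
        resolvent a (circleMap y r θ)))
      (Set.uIcc 0 (2 * π) ×ˢ Set.uIcc (C.lo i) (C.hi i)) := by
    intro i
    refine ContinuousOn.integrableOn_compact (isCompact_uIcc.prod isCompact_uIcc) ?_
    rw [Set.uIcc_of_le (C.le i)]
    exact (hcont i).mono (Set.prod_mono_left (Set.subset_univ _))
  rw [circleIntegral, intervalIntegral.integral_congr fun θ _ => hl θ,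
    intervalIntegral.integral_finsetSum]
  · rw [WeightedContour.eval]
    refine Finset.sum_congr rfl fun i _ => ?_
    rw [intervalIntegral_intervalIntegral_swap ((hint i).mono_set
      (Set.prod_mono Set.uIoc_subset_uIcc Set.uIoc_subset_uIcc))]
    refine intervalIntegral.integral_congr fun s _ => ?_
    simp only [circleIntegral]
    rw [← intervalIntegral.integral_smul]
    refine intervalIntegral.integral_congr fun θ _ => ?_
    simp only [smul_smul]
    congr 1; ring
  · intro i _
    have h := (hint i).mono_set (Set.prod_mono Set.uIoc_subset_uIcc Set.uIoc_subset_uIcc)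
    rw [IntegrableOn, Measure.volume_eq_prod, ← Measure.prod_restrict] at h
    rw [intervalIntegrable_iff]
    refine h.integral_prod_left.congr (Filter.Eventually.of_forall fun θ => ?_)
    simp only [intervalIntegral.integral_of_le (C.le i), Set.uIoc_of_le (C.le i)]
    rfl

/-- A stem function with a Cauchy representation over a weighted contour off the spectrum has the
integral of the resolvent over this contour as its primary function. -/
theorem isPrimaryFunction_resInt {ι : Type} [Fintype ι] (C : WeightedContour ι) {a : A} {h : ℂ → ℂ}
    (hd : Disjoint C.carrier (spectrum ℂ a)) (ha : ∀ x ∈ spectrum ℂ a, AnalyticAt ℂ h x)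
    (hrep : ∀ x ∈ spectrum ℂ a, ∀ᶠ z in 𝓝 x, h z = C.eval fun w => (w - z)⁻¹) :
    IsPrimaryFunction h a (C.resInt a) := by
  refine ⟨ha, ?_⟩
  set S := (spectrum_finite a).toFinset with hSdef
  have hS : (S : Set ℂ) = spectrum ℂ a := (spectrum_finite a).coe_toFinset
  have hmem : ∀ x ∈ S, x ∈ spectrum ℂ a := fun x hx => by rwa [← hS]
  have hpos : ∀ᶠ r : ℝ in 𝓝[>] 0, 0 < r := self_mem_nhdsWithin
  have hsmall : ∀ (x : ℂ) {U : Set ℂ}, U ∈ 𝓝 x →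
      ∀ᶠ r : ℝ in 𝓝[>] 0, Metric.closedBall x r ⊆ U := by
    intro x U hU
    obtain ⟨ε, hε, hsub⟩ := Metric.nhds_basis_closedBall.mem_iff.mp hU
    filter_upwards [Ioc_mem_nhdsGT hε] with r hr
    exact (Metric.closedBall_subset_closedBall hr.2).trans hsub
  have h1 : ∀ᶠ r : ℝ in 𝓝[>] 0, ∀ x ∈ S, ∀ y ∈ S, x ≠ y → x ∉ Metric.closedBall y r := by
    rw [Filter.eventually_all_finset]
    intro x _
    rw [Filter.eventually_all_finset]
    intro y _
    by_cases hxy : x = y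
    · exact Filter.Eventually.of_forall fun r h => absurd hxy h
    · filter_upwards [hsmall y (isOpen_ne.mem_nhds (Ne.symm hxy))] with r hr _ hx
      exact hr hx rfl
  have h2 : ∀ᶠ r : ℝ in 𝓝[>] 0, ∀ x ∈ S, Metric.closedBall x r ⊆ C.carrierᶜ := by
    rw [Filter.eventually_all_finset]
    intro x hx
    exact hsmall x (C.isCompact_carrier.isClosed.isOpen_compl.mem_nhds
      fun h => Set.disjoint_left.mp hd h (hmem x hx))
  have h3 : ∀ᶠ r : ℝ in 𝓝[>] 0, ∀ x ∈ S,
      Metric.closedBall x r ⊆ {z | h z = C.eval fun w => (w - z)⁻¹} := by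
    rw [Filter.eventually_all_finset]
    exact fun x hx => hsmall x (hrep x (hmem x hx))
  filter_upwards [hpos, h1, h2, h3] with r hr hsep hcar hh
  have hsph : ∀ y ∈ S, Disjoint (Metric.sphere y r) (spectrum ℂ a) := by
    intro y hy
    refine Set.disjoint_left.mpr fun z hz hz' => ?_
    rw [← hS] at hz'
    by_cases h : z = y
    · subst h; rw [mem_sphere_iff_norm] at hz; simp at hz; linarith
    · exact hsep z hz' y hy h (Metric.sphere_subset_closedBall hz)
  have hterm : ∀ y ∈ S, (∮ z in C(y, r), h z • resolvent a z) =
      (∮ z in C(y, r), resolvent a z) * C.resInt a := by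
    intro y hy
    have hcar' : ∀ w ∈ C.carrier, w ∉ Metric.closedBall y r := fun w hw hw' => hcar y hy hw' hw
    have h4 := C.eval_clm (ContinuousLinearMap.mul ℂ A (∮ z in C(y, r), resolvent a z))
      (C.continuousOn_resolvent hd)
    simp only [ContinuousLinearMap.mul_apply'] at h4
    rw [WeightedContour.resInt, ← h4,
      ← C.eval_congr (fun w hw => circleIntegral_inv_smul_resolvent hr (hsph y hy)
        (Set.disjoint_left.mp hd hw) (hcar' w hw)),
      ← circleIntegral_eval C hr (hsph y hy) (Set.disjoint_left.mpr fun w hw hw' =>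
        hcar' w hw (Metric.sphere_subset_closedBall hw'))]
    refine circleIntegral.integral_congr hr.le fun z hz => ?_
    have hz' : h z = _ := hh y hy (Metric.sphere_subset_closedBall hz)
    simp only [hz']
  rw [finsum_mem_eq_finite_toFinset_sum _ (spectrum_finite a), ← hSdef,
    Finset.sum_congr rfl hterm, ← Finset.sum_mul, sum_circleIntegral_resolvent hr hS hsep,
    smul_one_mul, smul_smul, inv_mul_cancel₀ two_pi_I_ne_zero, one_smul]

end Circles

/-! ### Exponentials -/

section Exponential

open NormedSpace

variable {A : Type*} [NormedRing A] [NormedAlgebra ℂ A] [CompleteSpace A]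

theorem continuous_exp : Continuous (exp : A → A) := by
  let +nondep : NormedAlgebra ℚ A := .restrictScalars ℚ ℂ A
  exact exp_continuous

theorem exp_add_of_commute {a b : A} (h : Commute a b) : exp (a + b) = exp a * exp b := by
  let +nondep : NormedAlgebra ℚ A := .restrictScalars ℚ ℂ A
  exact NormedSpace.exp_add_of_commute h

theorem commute_exp_right {a b : A} (h : Commute a b) : Commute a (exp b) := by
  let +nondep : NormedAlgebra ℚ A := .restrictScalars ℚ ℂ A
  exact h.exp_right

theorem exp_neg_mul_exp (a : A) : exp (-a) * exp a = 1 := by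
  rw [← exp_add_of_commute ((Commute.refl a).neg_left), neg_add_cancel, NormedSpace.exp_zero]

theorem exp_mul_exp_neg (a : A) : exp a * exp (-a) = 1 := by
  rw [← exp_add_of_commute ((Commute.refl a).neg_right), add_neg_cancel, NormedSpace.exp_zero]

theorem exp_algebraMap (z : ℂ) : exp (algebraMap ℂ A z) = algebraMap ℂ A (Complex.exp z) := by
  rw [Complex.exp_eq_exp_ℂ, algebraMap_exp_comm]

theorem exp_mul_eq_smul {a v : A} {x : ℂ} (h : a * v = x • v) :
    exp a * v = Complex.exp x • v := by
  have hpow : ∀ n : ℕ, a ^ n * v = x ^ n • v := by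
    intro n
    induction n with
    | zero => simp
    | succ n ih => rw [pow_succ', mul_assoc, ih, mul_smul_comm, h, smul_smul, ← pow_succ]
  have h1 := (exp_series_hasSum_exp' (𝕂 := ℂ) a).mul_right v
  have h2 := (exp_series_hasSum_exp' (𝕂 := ℂ) x).smul_const v
  rw [← Complex.exp_eq_exp_ℂ] at h2
  refine h1.unique (h2.congr_fun fun n => ?_)
  rw [smul_mul_assoc, hpow, smul_smul, smul_eq_mul]

theorem norm_exp_le [NormOneClass A] (a : A) : ‖exp a‖ ≤ Real.exp ‖a‖ := by
  have h2 : HasSum (fun n : ℕ => ((n.factorial : ℝ)⁻¹) • ‖a‖ ^ n) (Real.exp ‖a‖) := by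
    rw [Real.exp_eq_exp_ℝ]; exact exp_series_hasSum_exp' (𝕂 := ℝ) ‖a‖
  refine (exp_series_hasSum_exp' (𝕂 := ℂ) a).norm_le_of_bounded h2 fun n => ?_
  rw [norm_smul, norm_inv, Complex.norm_natCast, smul_eq_mul]
  exact mul_le_mul_of_nonneg_left (norm_pow_le _ _) (by positivity)

theorem hasDerivAt_exp_smul (a : A) (u : ℝ) :
    HasDerivAt (fun u : ℝ => exp (u • a)) (a * exp (u • a)) u :=
  hasDerivAt_exp_smul_const' a u

theorem exp_sub_exp (a b : A) :
    exp a - exp b = ∫ u in (0 : ℝ)..1, exp (u • a) * (a - b) * exp ((1 - u) • b) := by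
  have hd : ∀ u : ℝ, HasDerivAt (fun u : ℝ => exp (u • a) * exp ((1 - u) • b))
      (exp (u • a) * (a - b) * exp ((1 - u) • b)) u := by
    intro u
    have h1 := hasDerivAt_exp_smul_const (𝕂 := ℝ) a u
    have h2 := (hasDerivAt_exp_smul b (1 - u)).scomp u ((hasDerivAt_id u).const_sub 1)
    refine (h1.mul h2).congr_deriv ?_
    simp only [Function.comp_apply, neg_one_smul]
    noncomm_ring
  have hc : Continuous fun u : ℝ => exp (u • a) * (a - b) * exp ((1 - u) • b) := by
    have := continuous_exp (A := A)
    fun_prop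
  rw [intervalIntegral.integral_eq_sub_of_hasDerivAt (fun u _ => hd u)
    (hc.intervalIntegrable _ _)]
  simp

/-- Duhamel's formula for the derivative of the exponential of a path. -/
theorem hasDerivAt_exp_comp {f : ℝ → A} {f' : A} {s : ℝ} (hf : HasDerivAt f f' s) :
    HasDerivAt (fun t => exp (f t))
      (∫ u in (0 : ℝ)..1, exp (u • f s) * f' * exp ((1 - u) • f s)) s := by
  rw [hasDerivAt_iff_tendsto_slope] at hf ⊢
  have hK : Continuous fun p : A × A =>
      ∫ u in (0 : ℝ)..1, exp (u • p.1) * p.2 * exp ((1 - u) • f s) := by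
    apply intervalIntegral.continuous_parametric_intervalIntegral_of_continuous'
    have := continuous_exp (A := A)
    unfold Function.uncurry
    fun_prop
  have hcont : Filter.Tendsto f (𝓝[≠] s) (𝓝 (f s)) :=
    (hasDerivAt_iff_tendsto_slope.mpr hf).continuousAt.continuousWithinAt.tendsto
  refine ((hK.tendsto (f s, f')).comp (hcont.prodMk_nhds hf)).congr fun t => ?_
  simp only [Function.comp_apply, slope_def_module]
  rw [exp_sub_exp, ← intervalIntegral.integral_smul]
  refine intervalIntegral.integral_congr fun u _ => ?_
  simp only [mul_smul_comm, smul_mul_assoc]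

theorem hasDerivAt_exp_comp_of_commute {f : ℝ → A} {f' : A} {s : ℝ} (hf : HasDerivAt f f' s)
    (h : Commute (f s) f') : HasDerivAt (fun t => exp (f t)) (f' * exp (f s)) s := by
  convert hasDerivAt_exp_comp hf using 1
  have : ∀ u : ℝ, exp (u • f s) * f' * exp ((1 - u) • f s) = f' * exp (f s) := by
    intro u
    rw [← (commute_exp_right (h.symm.smul_right u)).eq, mul_assoc, ← exp_add_of_commute,
      ← add_smul, add_sub_cancel, one_smul]
    exact ((Commute.refl _).smul_left _).smul_right _
  simp [this]

theorem norm_exp_sub_one_le [NormOneClass A] (a : A) : ‖exp a - 1‖ ≤ ‖a‖ * Real.exp ‖a‖ := by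
  have h := exp_sub_exp a 0
  simp only [NormedSpace.exp_zero, sub_zero, smul_zero, mul_one] at h
  rw [h]
  have := intervalIntegral.norm_integral_le_of_norm_le_const (a := (0 : ℝ)) (b := 1)
    (f := fun u : ℝ => exp (u • a) * a) (C := ‖a‖ * Real.exp ‖a‖) ?_
  · simpa using this
  intro u hu
  rw [Set.uIoc_of_le zero_le_one] at hu
  calc _ ≤ ‖exp (u • a)‖ * ‖a‖ := norm_mul_le _ _
    _ ≤ Real.exp ‖a‖ * ‖a‖ := by
        gcongr
        refine (norm_exp_le _).trans (Real.exp_le_exp.mpr ?_)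
        rw [norm_smul, Real.norm_of_nonneg hu.1.le]
        exact mul_le_of_le_one_left (norm_nonneg _) hu.2
    _ = _ := mul_comm _ _

end Exponential

/-! ### Spectra of commuting elements -/

section Joint

/-- An operator that commutes with `T` maps each eigenspace of `T` to itself and has an eigenvector
there. -/
theorem exists_joint_eigenvector {V : Type*} [AddCommGroup V] [Module ℂ V] [FiniteDimensional ℂ V]
    {S T : Module.End ℂ V} (h : Commute S T) {μ : ℂ} {v : V} (hv : v ≠ 0) (hT : T v = μ • v) :
    ∃ w : V, w ≠ 0 ∧ ∃ x : ℂ, S w = x • w ∧ T w = μ • w := by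
  have hmaps : ∀ w ∈ T.eigenspace μ, S w ∈ T.eigenspace μ := by
    intro w hw
    rw [Module.End.mem_eigenspace_iff] at hw ⊢
    have := LinearMap.congr_fun h.eq w
    simp only [Module.End.mul_apply] at this
    rw [← this, hw, map_smul]
  have hne : Nontrivial (T.eigenspace μ) :=
    ⟨⟨⟨v, Module.End.mem_eigenspace_iff.mpr hT⟩, 0, fun h0 => hv (congrArg Subtype.val h0)⟩⟩
  obtain ⟨x, hx⟩ := Module.End.exists_eigenvalue (S.restrict hmaps)
  obtain ⟨w, hw⟩ := hx.exists_hasEigenvector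
  refine ⟨w, fun h0 => hw.2 (Subtype.ext h0), x, ?_, Module.End.mem_eigenspace_iff.mp w.2⟩
  exact congrArg Subtype.val hw.apply_eq_smul

variable {A : Type*} [NormedRing A] [NormedAlgebra ℂ A] [FiniteDimensional ℂ A]

/-- In a finite dimensional algebra every point of the spectrum is an eigenvalue of left
multiplication, so commuting elements have joint spectral values. The spectral mapping lemmas below
read off the points of the spectrum from such a joint eigenvector. -/
theorem exists_joint_mul_eq_smul {a b : A} (h : Commute a b) {z : ℂ} (hz : z ∈ spectrum ℂ b) :
    ∃ v : A, v ≠ 0 ∧ ∃ x ∈ spectrum ℂ a, a * v = x • v ∧ b * v = z • v := by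
  obtain ⟨v, hv, hb⟩ := exists_mul_eq_smul hz
  obtain ⟨w, hw, x, h1, h2⟩ := exists_joint_eigenvector (S := Algebra.lmul ℂ A a)
    (T := Algebra.lmul ℂ A b) (h.map (Algebra.lmul ℂ A)) hv hb
  exact ⟨w, hw, x, mem_spectrum_of_mul_eq_smul hw h1, h1, h2⟩

theorem smul_left_cancel_of_ne {v : A} (hv : v ≠ 0) {x y : ℂ} (h : x • v = y • v) : x = y :=
  smul_left_injective ℂ hv h

theorem spectrum_exp [CompleteSpace A] {a : A} {z : ℂ} (hz : z ∈ spectrum ℂ (NormedSpace.exp a)) :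
    ∃ x ∈ spectrum ℂ a, z = Complex.exp x := by
  obtain ⟨v, hv, x, hx, h1, h2⟩ :=
    exists_joint_mul_eq_smul (commute_exp_right (Commute.refl a)) hz
  exact ⟨x, hx, smul_left_cancel_of_ne hv (h2.symm.trans (exp_mul_eq_smul h1))⟩

theorem spectrum_smul_add {a : A} {s : ℝ} {c z : ℂ}
    (hz : z ∈ spectrum ℂ (s • a + algebraMap ℂ A c)) : ∃ x ∈ spectrum ℂ a, z = s * x + c := by
  have hcomm : Commute a (s • a + algebraMap ℂ A c) :=
    ((Commute.refl a).smul_right s).add_right (Algebra.commutes c a).symm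
  obtain ⟨v, hv, x, hx, h1, h2⟩ := exists_joint_mul_eq_smul hcomm hz
  refine ⟨x, hx, smul_left_cancel_of_ne hv (h2.symm.trans ?_)⟩
  rw [add_mul, smul_mul_assoc, h1, Algebra.algebraMap_eq_smul_one, smul_one_mul, add_smul,
    mul_smul, Complex.coe_smul]

end Joint

/-! ### Deformation of the operator inside a contour -/

namespace WeightedContour

variable {ι : Type} [Fintype ι] (C : WeightedContour ι)
variable {A : Type*} [NormedRing A] [NormedAlgebra ℂ A] [CompleteSpace A] [FiniteDimensional ℂ A]

/-- If the squares of all resolvents integrate to zero over a contour, as they do over a closed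
curve with its line element, then the integral of the resolvent does not change as an operator is
contracted to zero with its spectrum off the contour. -/
theorem resInt_eq_resInt_zero {a : A}
    (hsq : ∀ b : A, Disjoint C.carrier (spectrum ℂ b) →
      C.eval (fun z => resolvent b z * resolvent b z) = 0)
    (h : ∀ s ∈ Set.Icc (0 : ℝ) 1, Disjoint C.carrier (spectrum ℂ (s • a))) :
    C.resInt a = C.resInt 0 := by
  have hd : ∀ s ∈ Set.Icc (0 : ℝ) 1, HasDerivAt (fun s : ℝ => C.resInt (s • a)) 0 s := by
    intro s hs
    have h1 := C.hasDerivAt_resInt ((hasDerivAt_id s).smul_const a) (h s hs)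
    simp only [id, one_smul] at h1
    have hR := C.continuousOn_resolvent (h s hs)
    have h2 := C.eval_clm (f := fun z => resolvent (s • a) z * resolvent (s • a) z)
      (ContinuousLinearMap.mul ℂ A a) (hR.mul hR)
    simp only [ContinuousLinearMap.mul_apply'] at h2
    rw [hsq _ (h s hs), mul_zero] at h2
    convert h1 using 1
    rw [← h2]
    refine C.eval_congr fun z _ => ?_
    have hc : Commute (resolvent (s • a) z) a :=
      commute_resolvent ((Commute.refl a).smul_left s) z
    simp only [hc.eq, mul_assoc]
  have := constant_of_has_deriv_right_zero
    (fun s hs => (hd s hs).continuousAt.continuousWithinAt)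
    (fun s hs => (hd s (Set.Ico_subset_Icc_self hs)).hasDerivWithinAt) 1 (by simp)
  simpa using this

end WeightedContour

/-! ### The logarithm on a keyhole contour -/

/-- The disc of radius `ρ` around zero, slit along the ray `{y e^{iφ} | y ≥ 0}`. -/
def slitDisc (φ ρ : ℝ) : Set ℂ :=
  {z | ‖z‖ < ρ ∧ ∀ y : ℝ, 0 ≤ y → z ≠ y * Complex.exp (φ * I)}

/-- The boundary of the slit disc. On the circle of radius `ρ` the weight is the logarithm times
the line element, and on the cut it is the jump of the logarithm, both divided by `2 π i`. -/
def logContour (φ : ℝ) {ρ : ℝ} (hρ : 0 < ρ) : WeightedContour (Fin 2) where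
  lo := ![φ, 0]
  hi := ![φ + 2 * π, ρ]
  le := by
    intro i
    fin_cases i
    · simp [Real.pi_pos.le]
    · simpa using hρ.le
  wt := ![fun θ => (2 * π : ℂ)⁻¹ * ((Real.log ρ + θ * I) * (ρ * Complex.exp (θ * I))),
    fun _ => -Complex.exp (φ * I)]
  pt := ![fun θ => ρ * Complex.exp (θ * I), fun y => y * Complex.exp (φ * I)]
  continuous_wt := by
    intro i
    fin_cases i
    · simp only [Fin.zero_eta, Matrix.cons_val_zero]; fun_prop
    · exact continuous_const
  continuous_pt := by
    intro i
    fin_cases i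
    · simp only [Fin.zero_eta, Matrix.cons_val_zero]; fun_prop
    · exact (by fun_prop : Continuous fun y : ℝ => y * Complex.exp (φ * I))

section LogContour

variable {φ ρ : ℝ} (hρ : 0 < ρ)
variable {F : Type*} [NormedAddCommGroup F] [NormedSpace ℂ F]

theorem logContour_eval (f : ℂ → F) : (logContour φ hρ).eval f =
    (∫ θ in φ..φ + 2 * π, ((2 * π : ℂ)⁻¹ * ((Real.log ρ + θ * I) * (ρ * Complex.exp (θ * I)))) •
      f (ρ * Complex.exp (θ * I))) +
    ∫ y in (0 : ℝ)..ρ, (-Complex.exp (φ * I)) • f (y * Complex.exp (φ * I)) := by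
  rw [WeightedContour.eval, Fin.sum_univ_two]
  rfl

theorem mem_logContour_carrier {z : ℂ} : z ∈ (logContour φ hρ).carrier ↔
    (∃ θ ∈ Set.Icc φ (φ + 2 * π), ρ * Complex.exp (θ * I) = z) ∨
    ∃ y ∈ Set.Icc 0 ρ, y * Complex.exp (φ * I) = z := by
  rw [WeightedContour.carrier, Set.mem_iUnion, Fin.exists_fin_two]
  rfl

/-- The slit has mass `ρ`; on the circle `|log ρ + iθ|` is largest at an end of the range of `θ`. -/
theorem logContour_mass_le : (logContour φ hρ).mass ≤
    ρ * (1 + √(Real.log ρ ^ 2 + max (φ ^ 2) ((φ + 2 * π) ^ 2))) := by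
  have h0 : (logContour φ hρ).mass =
      (∫ θ in φ..φ + 2 * π,
        ‖(2 * π : ℂ)⁻¹ * ((Real.log ρ + θ * I) * (ρ * Complex.exp (θ * I)))‖) +
      ∫ y in (0 : ℝ)..ρ, ‖-Complex.exp (φ * I)‖ := by
    rw [WeightedContour.mass, Fin.sum_univ_two]
    rfl
  set m := √(Real.log ρ ^ 2 + max (φ ^ 2) ((φ + 2 * π) ^ 2)) with hm
  have h1 : (∫ y in (0 : ℝ)..ρ, ‖-Complex.exp (φ * I)‖) = ρ := by
    simp [Complex.norm_exp_ofReal_mul_I]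
  have hpi := Real.pi_pos
  have h2 : ∀ θ ∈ Set.Icc φ (φ + 2 * π),
      ‖(2 * π : ℂ)⁻¹ * ((Real.log ρ + θ * I) * (ρ * Complex.exp (θ * I)))‖ ≤
        (2 * π)⁻¹ * (m * ρ) := by
    intro θ hθ
    have h3 : ‖(Real.log ρ + θ * I : ℂ)‖ ≤ m := by
      rw [Complex.norm_add_mul_I, hm]
      apply Real.sqrt_le_sqrt
      have : θ ^ 2 ≤ max (φ ^ 2) ((φ + 2 * π) ^ 2) := by
        rcases le_total 0 θ with h | h
        · exact le_max_of_le_right (by nlinarith [hθ.2])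
        · exact le_max_of_le_left (by nlinarith [hθ.1])
      linarith
    rw [norm_mul, norm_mul, norm_mul, Complex.norm_exp_ofReal_mul_I, mul_one, Complex.norm_real,
      Real.norm_of_nonneg hρ.le, norm_inv, norm_mul, Complex.norm_ofNat, Complex.norm_real,
      Real.norm_of_nonneg hpi.le]
    gcongr
  have h4 := intervalIntegral.integral_mono_on (μ := volume) (by linarith : φ ≤ φ + 2 * π)
    (((logContour φ hρ).continuous_wt 0).norm.intervalIntegrable φ (φ + 2 * π))
    (continuous_const.intervalIntegrable φ (φ + 2 * π)) h2
  have h5 : (∫ _ in φ..φ + 2 * π, (2 * π)⁻¹ * (m * ρ)) = m * ρ := by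
    rw [intervalIntegral.integral_const, smul_eq_mul]
    field_simp
    ring
  rw [h0, h1]
  calc _ ≤ m * ρ + ρ := by rw [← h5]; exact add_le_add_left h4 _
    _ = _ := by ring

theorem disjoint_logContour_slitDisc : Disjoint (logContour φ hρ).carrier (slitDisc φ ρ) := by
  refine Set.disjoint_left.mpr fun z hz hz' => ?_
  rcases (mem_logContour_carrier hρ).mp hz with ⟨θ, _, rfl⟩ | ⟨y, hy, rfl⟩
  · have := hz'.1
    rw [norm_mul, Complex.norm_exp_ofReal_mul_I, mul_one, Complex.norm_real,
      Real.norm_of_nonneg hρ.le] at this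
    exact lt_irrefl _ this
  · exact hz'.2 y hy.1 rfl

theorem exp_mul_exp_neg_mul_I (φ : ℝ) :
    Complex.exp (-(φ * I)) * Complex.exp (φ * I) = 1 := by
  rw [← Complex.exp_add, neg_add_cancel, Complex.exp_zero]

theorem neg_rotate_add_mem_slitPlane {z : ℂ} (hz : ∀ y : ℝ, 0 ≤ y → z ≠ y * Complex.exp (φ * I))
    {y : ℝ} (hy : 0 ≤ y) : y - z * Complex.exp (-(φ * I)) ∈ slitPlane := by
  rw [Complex.mem_slitPlane_iff]
  by_contra! h
  obtain ⟨h1, h2⟩ := h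
  set u := z * Complex.exp (-(φ * I)) with hu
  simp only [sub_re, ofReal_re, sub_im, ofReal_im, zero_sub, neg_eq_zero] at h1 h2
  refine hz u.re (by linarith) ?_
  have : (u.re : ℂ) = u := Complex.ext (by simp) (by simp [h2])
  rw [this, hu, mul_assoc, exp_mul_exp_neg_mul_I, mul_one]

theorem analyticAt_logBranch {z : ℂ} (hz : ∀ y : ℝ, 0 ≤ y → z ≠ y * Complex.exp (φ * I)) :
    AnalyticAt ℂ (logBranch φ) z := by
  have h := neg_rotate_add_mem_slitPlane hz le_rfl
  rw [ofReal_zero, zero_sub] at h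
  unfold logBranch
  exact ((analyticAt_id.mul analyticAt_const).neg.clog h).add analyticAt_const

/-- The mean value property of `log (1 - w ζ)` on the unit circle. -/
theorem integral_log_one_sub {w : ℂ} (hw : ‖w‖ < 1) (φ : ℝ) :
    ∫ θ in φ..φ + 2 * π, Complex.log (1 - w * Complex.exp (-(θ * I))) = 0 := by
  have hmem : ∀ ζ ∈ Metric.closedBall (0 : ℂ) 1, 1 - w * ζ ∈ slitPlane := by
    intro ζ hζ
    rw [mem_closedBall_zero_iff] at hζ
    refine Complex.mem_slitPlane_iff.mpr (Or.inl ?_)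
    have h1 : ‖w * ζ‖ < 1 := by
      rw [norm_mul]
      exact (mul_le_of_le_one_right (norm_nonneg _) hζ).trans_lt hw
    have h2 := (Complex.re_le_norm (w * ζ)).trans_lt h1
    simp only [sub_re, one_re]; linarith
  have hdiff : DiffContOnCl ℂ (fun ζ => Complex.log (1 - w * ζ)) (Metric.ball 0 1) := by
    apply DifferentiableOn.diffContOnCl
    rw [closure_ball 0 one_ne_zero]
    intro ζ hζ
    have h : DifferentiableAt ℂ (fun ζ => 1 - w * ζ) ζ := by fun_prop
    exact (h.clog (hmem ζ hζ)).differentiableWithinAt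
  have h1 := hdiff.circleIntegral_sub_inv_smul (Metric.mem_ball_self one_pos)
  simp only [mul_zero, sub_zero, Complex.log_one, smul_zero, circleIntegral] at h1
  set g : ℝ → ℂ := fun θ => Complex.log (1 - w * Complex.exp (θ * I)) with hg
  have h2 : (∫ θ in (0 : ℝ)..2 * π, g θ) = 0 := by
    have : ∀ θ : ℝ, deriv (circleMap 0 1) θ • ((circleMap 0 1 θ)⁻¹ •
        Complex.log (1 - w * circleMap 0 1 θ)) = I * g θ := by
      intro θ
      have hne : circleMap 0 1 θ ≠ 0 := circleMap_ne_center one_ne_zero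
      rw [deriv_circleMap, smul_smul, smul_eq_mul]
      change circleMap 0 1 θ * I * (circleMap 0 1 θ)⁻¹ * _ = _
      rw [mul_right_comm (circleMap 0 1 θ), mul_inv_cancel₀ hne, one_mul]
      simp [circleMap, hg]
    simp only [this] at h1
    rw [intervalIntegral.integral_const_mul] at h1
    exact (mul_eq_zero.mp h1).resolve_left I_ne_zero
  have hper : Function.Periodic g (2 * π) := by
    intro θ
    simp only [hg]
    rw [ofReal_add, add_mul, Complex.exp_add]
    simp [Complex.exp_two_pi_mul_I]
  calc _ = ∫ θ in φ..φ + 2 * π, g (-θ) := by simp [hg]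
    _ = ∫ θ in -(φ + 2 * π)..-φ, g θ := intervalIntegral.integral_comp_neg g
    _ = ∫ θ in (0 : ℝ)..0 + 2 * π, g θ := by
        rw [← hper.intervalIntegral_add_eq (-(φ + 2 * π)) 0]
        congr 1; ring
    _ = 0 := by rw [zero_add, h2]

/-- Cauchy's formula for the logarithm on the slit disc. -/
theorem logContour_eval_inv_sub {z : ℂ} (hz : z ∈ slitDisc φ ρ) :
    (logContour φ hρ).eval (fun w => (w - z)⁻¹) = logBranch φ z := by
  have hpi : (2 * π : ℂ) ≠ 0 := by simp [Real.pi_ne_zero]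
  have hρ' : (ρ : ℂ) ≠ 0 := by exact_mod_cast hρ.ne'
  have hzρ : ‖z / ρ‖ < 1 := by
    rw [norm_div, Complex.norm_real, Real.norm_of_nonneg hρ.le, div_lt_one hρ]
    exact hz.1
  have hE : ∀ θ : ℝ, Complex.exp (-(θ * I)) ≠ 0 := fun θ => Complex.exp_ne_zero _
  have hEE : ∀ θ : ℝ, Complex.exp (θ * I) = (Complex.exp (-(θ * I)))⁻¹ := fun θ => by
    rw [Complex.exp_neg, inv_inv]
  have hslit : ∀ θ : ℝ, 1 - z / ρ * Complex.exp (-(θ * I)) ∈ slitPlane := by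
    intro θ
    refine Complex.mem_slitPlane_iff.mpr (Or.inl ?_)
    have h1 : ‖z / ρ * Complex.exp (-(θ * I))‖ < 1 := by
      rw [norm_mul, ← neg_mul, ← ofReal_neg, Complex.norm_exp_ofReal_mul_I, mul_one]
      exact hzρ
    have h2 := (Complex.re_le_norm _).trans_lt h1
    simp only [sub_re, one_re]; linarith
  have hne : ∀ θ : ℝ, (ρ * Complex.exp (θ * I) - z) ≠ 0 := by
    intro θ h
    have := hz.1
    rw [← sub_eq_zero.mp h, norm_mul, Complex.norm_exp_ofReal_mul_I, mul_one, Complex.norm_real,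
      Real.norm_of_nonneg hρ.le] at this
    exact lt_irrefl _ this
  set L : ℝ → ℂ := fun θ => Complex.log (1 - z / ρ * Complex.exp (-(θ * I))) with hL
  have hLd : ∀ θ : ℝ, HasDerivAt L (I * z / (ρ * Complex.exp (θ * I) - z)) θ := by
    intro θ
    have h1 : HasDerivAt (fun θ : ℝ => 1 - z / ρ * Complex.exp (-(θ * I)))
        (-(z / ρ * (Complex.exp (-(θ * I)) * (-I)))) θ := by
      have := ((((hasDerivAt_id θ).ofReal_comp.mul_const I).neg.cexp).const_mul (z / ρ)).const_sub 1
      simpa using this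
    refine (h1.clog_real (hslit θ)).congr_deriv ?_
    have hs := slitPlane_ne_zero (hslit θ)
    have hn := hne θ
    rw [hEE] at hn ⊢
    have hEθ := hE θ
    generalize Complex.exp (-(θ * I)) = E at *
    have hs' : (ρ : ℂ) - z * E ≠ 0 := by
      intro h0; apply hs; field_simp; rw [h0, mul_zero]
    have hn' : ρ * E⁻¹ - z = (ρ - z * E) / E := by field_simp
    have hs'' : 1 - z / ρ * E = (ρ - z * E) / ρ := by field_simp
    rw [hn', hs'']
    field_simp
  -- An antiderivative of the integrand over the circle, up to the term `L` of mean value zero.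
  have hPd : ∀ θ : ℝ, HasDerivAt
      (fun θ : ℝ => (Real.log ρ + θ * I) * (θ - I * L θ) - I * θ ^ 2 / 2)
      (L θ + (Real.log ρ + θ * I) * (ρ * Complex.exp (θ * I)) *
        (ρ * Complex.exp (θ * I) - z)⁻¹) θ := by
    intro θ
    have h1 : HasDerivAt (fun θ : ℝ => (θ : ℂ)) 1 θ := (hasDerivAt_id θ).ofReal_comp
    have h2 := (((h1.mul_const I).const_add (Real.log ρ : ℂ)).mul
      (h1.sub ((hLd θ).const_mul I))).sub (((h1.pow 2).const_mul I).div_const 2)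
    refine h2.congr_deriv ?_
    have hn := hne θ
    simp only [Pi.sub_apply]
    have hF : ρ * Complex.exp (θ * I) * (ρ * Complex.exp (θ * I) - z)⁻¹ =
        1 - I * (I * z / (ρ * Complex.exp (θ * I) - z)) := by
      field_simp
      linear_combination z * I_sq
    rw [mul_assoc (Real.log ρ + θ * I), hF]
    push_cast
    linear_combination -L θ * I_sq
  have hLc : Continuous L := continuous_iff_continuousAt.mpr fun θ => (hLd θ).continuousAt
  have hcirc : ∀ θ : ℝ, L (θ + 2 * π) = L θ := by
    intro θ
    simp only [hL]
    push_cast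
    rw [add_mul, neg_add, Complex.exp_add, Complex.exp_neg (2 * π * I), Complex.exp_two_pi_mul_I,
      inv_one, mul_one]
  have hcirc1 : (∫ θ in φ..φ + 2 * π, (Real.log ρ + θ * I) * (ρ * Complex.exp (θ * I)) *
      (ρ * Complex.exp (θ * I) - z)⁻¹) = 2 * π * (Real.log ρ + (φ + π) * I + L φ) := by
    have hci : Continuous fun θ : ℝ => (Real.log ρ + θ * I) * (ρ * Complex.exp (θ * I)) *
      (ρ * Complex.exp (θ * I) - z)⁻¹ := by
      refine Continuous.mul (by fun_prop) (Continuous.inv₀ (by fun_prop) hne)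
    have h1 := intervalIntegral.integral_eq_sub_of_hasDerivAt (a := φ) (b := φ + 2 * π)
      (fun θ _ => hPd θ) ((hLc.add hci).intervalIntegrable _ _)
    rw [intervalIntegral.integral_add (hLc.intervalIntegrable _ _) (hci.intervalIntegrable _ _),
      integral_log_one_sub hzρ, zero_add, hcirc] at h1
    rw [h1]
    push_cast
    have hI := I_sq
    ring_nf
    simp only [hI]
    ring
  set u := z * Complex.exp (-(φ * I)) with hu
  have hmem : ∀ y : ℝ, 0 ≤ y → y - u ∈ slitPlane := fun y hy =>
    neg_rotate_add_mem_slitPlane hz.2 hy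
  have hray : (∫ y in (0 : ℝ)..ρ, (-Complex.exp (φ * I)) • (y * Complex.exp (φ * I) - z)⁻¹) =
      Complex.log (-u) - Complex.log (ρ - u) := by
    have h1 : ∀ y ∈ Set.uIcc 0 ρ, HasDerivAt (fun y : ℝ => -Complex.log (y - u))
        ((-Complex.exp (φ * I)) • (y * Complex.exp (φ * I) - z)⁻¹) y := by
      intro y hy
      rw [Set.uIcc_of_le hρ.le] at hy
      have h2 : HasDerivAt (fun y : ℝ => (y : ℂ) - u) 1 y :=
        (hasDerivAt_id y).ofReal_comp.sub_const u
      refine (h2.clog_real (hmem y hy.1)).neg.congr_deriv ?_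
      have h3 := slitPlane_ne_zero (hmem y hy.1)
      have h4 : y * Complex.exp (φ * I) - z = Complex.exp (φ * I) * (y - u) := by
        rw [hu, mul_sub, mul_left_comm, ← Complex.exp_add, add_neg_cancel, Complex.exp_zero]
        ring
      rw [h4, smul_eq_mul, mul_inv, neg_mul, mul_inv_cancel_left₀ (Complex.exp_ne_zero _),
        one_div]
    rw [intervalIntegral.integral_eq_sub_of_hasDerivAt h1]
    · simp only [ofReal_zero, zero_sub]; ring
    · refine ContinuousOn.intervalIntegrable fun y hy => ?_
      rw [Set.uIcc_of_le hρ.le] at hy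
      have h : ContinuousAt (fun y : ℝ => (y * Complex.exp (φ * I) - z)⁻¹) y :=
        ContinuousAt.inv₀ (by fun_prop) (sub_ne_zero.mpr (hz.2 y hy.1).symm)
      exact (continuousAt_const.mul h).continuousWithinAt
  have hlog : Complex.log (ρ - u) = Real.log ρ + L φ := by
    have : ρ - u = (ρ : ℂ) * (1 - z / ρ * Complex.exp (-(φ * I))) := by
      rw [hu]; field_simp
    rw [this, Complex.log_ofReal_mul hρ (slitPlane_ne_zero (hslit φ))]
  rw [logContour_eval, hray, hlog, logBranch]
  simp only [smul_eq_mul, mul_assoc (2 * π : ℂ)⁻¹]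
  rw [intervalIntegral.integral_const_mul, hcirc1, ← mul_assoc, inv_mul_cancel₀ hpi]
  ring

end LogContour

/-! ### The logarithm of an operator -/

section OperatorLog

variable {φ ρ : ℝ} (hρ : 0 < ρ)
variable {A : Type*} [NormedRing A] [NormedAlgebra ℂ A] [CompleteSpace A] [FiniteDimensional ℂ A]

theorem disjoint_logContour {a : A} (ha : spectrum ℂ a ⊆ slitDisc φ ρ) :
    Disjoint (logContour φ hρ).carrier (spectrum ℂ a) :=
  (disjoint_logContour_slitDisc hρ).mono_right ha

/-- The circle of radius `ρ` with its line element divided by `i`. -/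
def circleContour (φ : ℝ) (ρ : ℝ) : WeightedContour Unit where
  lo _ := φ
  hi _ := φ + 2 * π
  le _ := by linarith [Real.pi_pos]
  wt _ θ := ρ * Complex.exp (θ * I)
  pt _ θ := ρ * Complex.exp (θ * I)
  continuous_wt _ := by fun_prop
  continuous_pt _ := by fun_prop

theorem circleContour_eval {F : Type*} [NormedAddCommGroup F] [NormedSpace ℂ F] (f : ℂ → F) :
    (circleContour φ ρ).eval f = ∫ θ in φ..φ + 2 * π, (ρ * Complex.exp (θ * I)) •
      f (ρ * Complex.exp (θ * I)) := by
  rw [WeightedContour.eval, Fintype.sum_unique]; rfl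

theorem norm_eq_of_mem_circleContour (hρ : 0 < ρ) {z : ℂ} (hz : z ∈ (circleContour φ ρ).carrier) :
    ‖z‖ = ρ := by
  obtain ⟨_, θ, _, rfl⟩ := Set.mem_iUnion.mp hz
  change ‖ρ * Complex.exp (θ * I)‖ = ρ
  rw [norm_mul, Complex.norm_exp_ofReal_mul_I, mul_one, Complex.norm_real,
    Real.norm_of_nonneg hρ.le]

theorem hasDerivAt_circle (ρ θ : ℝ) : HasDerivAt (fun θ : ℝ => ρ * Complex.exp (θ * I))
    (I * (ρ * Complex.exp (θ * I))) θ := by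
  have := (((hasDerivAt_id θ).ofReal_comp.mul_const I).cexp).const_mul (ρ : ℂ)
  refine this.congr_deriv ?_
  simp only [id]; push_cast; ring

theorem circle_periodic (ρ φ : ℝ) : (ρ : ℂ) * Complex.exp ((φ + 2 * π : ℝ) * I) =
    ρ * Complex.exp (φ * I) := by
  push_cast
  rw [add_mul, Complex.exp_add, Complex.exp_two_pi_mul_I, mul_one]

theorem spectrum_smul {a : A} {s : ℝ} {z : ℂ} (hz : z ∈ spectrum ℂ (s • a)) :
    ∃ x ∈ spectrum ℂ a, z = s * x := by
  obtain ⟨x, hx, h⟩ := spectrum_smul_add (a := a) (s := s) (c := 0) (by simpa using hz)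
  exact ⟨x, hx, by simpa using h⟩

/-- The total Riesz projection of an operator with spectrum inside a circle. -/
theorem circleContour_resInt (hρ : 0 < ρ) {a : A} (ha : ∀ x ∈ spectrum ℂ a, ‖x‖ < ρ) :
    (circleContour φ ρ).resInt a = (2 * π : ℂ) • (1 : A) := by
  rw [WeightedContour.resInt_eq_resInt_zero]
  · rw [WeightedContour.resInt, circleContour_eval]
    have h : ∀ θ : ℝ, (ρ * Complex.exp (θ * I)) •
        resolvent (0 : A) (ρ * Complex.exp (θ * I)) = 1 := by
      intro θ
      have hne : (ρ * Complex.exp (θ * I)) ≠ 0 :=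
        mul_ne_zero (by exact_mod_cast hρ.ne') (Complex.exp_ne_zero _)
      have := resolvent_algebraMap (A := A) hne
      rw [map_zero, sub_zero] at this
      rw [this, Algebra.algebraMap_eq_smul_one, smul_smul, mul_inv_cancel₀ hne, one_smul]
    simp only [h]
    rw [intervalIntegral.integral_const, add_sub_cancel_left, ← Complex.coe_smul]
    push_cast; rfl
  · intro b hb
    have hb' : ∀ θ ∈ Set.uIcc φ (φ + 2 * π), (ρ * Complex.exp (θ * I) : ℂ) ∉ spectrum ℂ b :=
      fun θ hθ => Set.disjoint_left.mp hb ((circleContour φ ρ).pt_mem' (i := ()) hθ)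
    rw [circleContour_eval]
    have h1 : ∀ θ ∈ Set.uIcc φ (φ + 2 * π), HasDerivAt
        (fun θ : ℝ => I • resolvent b (ρ * Complex.exp (θ * I)))
        ((ρ * Complex.exp (θ * I)) • (resolvent b (ρ * Complex.exp (θ * I)) *
          resolvent b (ρ * Complex.exp (θ * I)))) θ := by
      intro θ hθ
      refine ((hasDerivAt_resolvent_comp (hasDerivAt_circle ρ θ) (hb' θ hθ)).const_smul
        I).congr_deriv ?_
      rw [← neg_smul, smul_smul]
      congr 1
      linear_combination -(ρ * Complex.exp (θ * I)) * I_sq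
    rw [intervalIntegral.integral_eq_sub_of_hasDerivAt h1
      ((circleContour φ ρ).intervalIntegrable (f := fun z => resolvent b z * resolvent b z)
        (((circleContour φ ρ).continuousOn_resolvent hb).mul
        ((circleContour φ ρ).continuousOn_resolvent hb)) ()), circle_periodic, sub_self]
  · intro s hs
    refine Set.disjoint_left.mpr fun z hz hz' => ?_
    obtain ⟨x, hx, rfl⟩ := spectrum_smul hz'
    have h1 := norm_eq_of_mem_circleContour hρ hz
    rw [norm_mul, Complex.norm_real, Real.norm_of_nonneg hs.1] at h1
    have h2 := ha x hx
    nlinarith [norm_nonneg x, hs.2]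

/-- The value of `(2πi)⁻¹ ∮ z⁻¹ (z - a)⁻¹ dz` is zero: `z R(z) = a R(z) + 1`, and `∮ R` accounts for the
term `1`, so `a` times the integral is zero. -/
theorem integral_resolvent_circle (hρ : 0 < ρ) {a : A} (ha : spectrum ℂ a ⊆ slitDisc φ ρ) :
    ∫ θ in φ..φ + 2 * π, resolvent a (ρ * Complex.exp (θ * I)) = 0 := by
  have hd : Disjoint (circleContour φ ρ).carrier (spectrum ℂ a) := by
    refine Set.disjoint_left.mpr fun z hz hz' => ?_
    have h1 := norm_eq_of_mem_circleContour hρ hz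
    have h2 := (ha hz').1
    linarith
  have h0 : (0 : ℂ) ∉ spectrum ℂ a := fun h => (ha h).2 0 le_rfl (by simp)
  have hR : ContinuousOn (fun θ : ℝ => resolvent a (ρ * Complex.exp (θ * I)))
      (Set.uIcc φ (φ + 2 * π)) := by
    rw [Set.uIcc_of_le (by linarith [Real.pi_pos])]
    exact (circleContour φ ρ).continuousOn_comp_pt
      ((circleContour φ ρ).continuousOn_resolvent hd) ()
  have h1 := circleContour_resInt (φ := φ) hρ fun x hx => (ha hx).1
  have h2 : ∀ θ ∈ Set.uIcc φ (φ + 2 * π), (ρ * Complex.exp (θ * I)) •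
      resolvent a (ρ * Complex.exp (θ * I)) =
        a * resolvent a (ρ * Complex.exp (θ * I)) + 1 := fun θ hθ =>
    smul_resolvent (Set.disjoint_left.mp hd ((circleContour φ ρ).pt_mem' (i := ()) hθ))
  have haR : IntervalIntegrable (fun θ : ℝ => a * resolvent a (ρ * Complex.exp (θ * I))) volume
      φ (φ + 2 * π) := (continuousOn_const.mul hR).intervalIntegrable
  rw [WeightedContour.resInt, circleContour_eval, intervalIntegral.integral_congr h2,
    intervalIntegral.integral_add haR
      (continuous_const.intervalIntegrable _ _), intervalIntegral.integral_const,
    add_sub_cancel_left, ← Complex.coe_smul (2 * π)] at h1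
  push_cast at h1
  rw [add_eq_right] at h1
  have h3 := (ContinuousLinearMap.mul ℂ A a).intervalIntegral_comp_comm
    (hR.intervalIntegrable (μ := volume))
  simp only [ContinuousLinearMap.mul_apply'] at h3
  rw [h3] at h1
  exact (spectrum.zero_notMem_iff ℂ |>.mp h0).mul_right_eq_zero.mp h1

/-- Differentiating the logarithm of an operator in a direction that commutes with it: the
derivative of the logarithm is the inverse. Integration by parts on both parts of the contour. -/
theorem logContour_eval_resolvent_mul_resolvent {a : A} (ha : spectrum ℂ a ⊆ slitDisc φ ρ) :
    (logContour φ hρ).eval (fun z => resolvent a z * resolvent a z) = -resolvent a (0 : ℂ) := by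
  have hd := disjoint_logContour hρ ha
  have hR := (logContour φ hρ).continuousOn_resolvent hd
  have h1 : ∀ θ ∈ Set.uIcc φ (φ + 2 * π), (ρ * Complex.exp (θ * I) : ℂ) ∉ spectrum ℂ a :=
    fun θ hθ => Set.disjoint_left.mp hd ((logContour φ hρ).pt_mem' (i := 0) hθ)
  have h2 : ∀ y ∈ Set.uIcc 0 ρ, (y * Complex.exp (φ * I) : ℂ) ∉ spectrum ℂ a :=
    fun y hy => Set.disjoint_left.mp hd ((logContour φ hρ).pt_mem' (i := 1) hy)
  have hi1 : IntervalIntegrable (fun θ : ℝ =>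
      ((2 * π : ℂ)⁻¹ * ((Real.log ρ + θ * I) * (ρ * Complex.exp (θ * I)))) •
      (resolvent a (ρ * Complex.exp (θ * I)) * resolvent a (ρ * Complex.exp (θ * I)))) volume
      φ (φ + 2 * π) := (logContour φ hρ).intervalIntegrable (f := fun z => resolvent a z * resolvent a z)
    (hR.mul hR) 0
  have hi2 := (logContour φ hρ).intervalIntegrable (f := fun z => resolvent a z * resolvent a z)
    (hR.mul hR) 1
  have hRc : ContinuousOn (fun θ : ℝ => resolvent a (ρ * Complex.exp (θ * I)))
      (Set.uIcc φ (φ + 2 * π)) := by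
    rw [Set.uIcc_of_le (by linarith [Real.pi_pos])]
    exact (logContour φ hρ).continuousOn_comp_pt hR 0
  have hray : (∫ y in (0 : ℝ)..ρ, (-Complex.exp (φ * I)) •
      (resolvent a (y * Complex.exp (φ * I)) * resolvent a (y * Complex.exp (φ * I)))) =
      resolvent a (ρ * Complex.exp (φ * I)) - resolvent a (0 : ℂ) := by
    have h3 : ∀ y ∈ Set.uIcc 0 ρ, HasDerivAt
        (fun y : ℝ => resolvent a (y * Complex.exp (φ * I)))
        ((-Complex.exp (φ * I)) • (resolvent a (y * Complex.exp (φ * I)) *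
          resolvent a (y * Complex.exp (φ * I)))) y := by
      intro y hy
      have h4 : HasDerivAt (fun y : ℝ => y * Complex.exp (φ * I)) (Complex.exp (φ * I)) y := by
        simpa using (hasDerivAt_id y).ofReal_comp.mul_const (Complex.exp (φ * I))
      exact (hasDerivAt_resolvent_comp h4 (h2 y hy)).congr_deriv (by rw [neg_smul])
    rw [intervalIntegral.integral_eq_sub_of_hasDerivAt h3 hi2]
    simp
  have hcirc : (∫ θ in φ..φ + 2 * π,
      ((2 * π : ℂ)⁻¹ * ((Real.log ρ + θ * I) * (ρ * Complex.exp (θ * I)))) •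
      (resolvent a (ρ * Complex.exp (θ * I)) * resolvent a (ρ * Complex.exp (θ * I)))) =
      -resolvent a (ρ * Complex.exp (φ * I)) := by
    have h3 : ∀ θ ∈ Set.uIcc φ (φ + 2 * π), HasDerivAt
        (fun θ : ℝ => ((2 * π : ℂ)⁻¹ * (I * (Real.log ρ + θ * I))) •
          resolvent a (ρ * Complex.exp (θ * I)))
        (((2 * π : ℂ)⁻¹ * ((Real.log ρ + θ * I) * (ρ * Complex.exp (θ * I)))) •
          (resolvent a (ρ * Complex.exp (θ * I)) * resolvent a (ρ * Complex.exp (θ * I))) -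
          (2 * π : ℂ)⁻¹ • resolvent a (ρ * Complex.exp (θ * I))) θ := by
      intro θ hθ
      have h4 : HasDerivAt (fun θ : ℝ => (2 * π : ℂ)⁻¹ * (I * (Real.log ρ + θ * I)))
          ((2 * π : ℂ)⁻¹ * (I * I)) θ := by
        have := ((((hasDerivAt_id θ).ofReal_comp.mul_const I).const_add
          (Real.log ρ : ℂ)).const_mul I).const_mul ((2 * π : ℂ)⁻¹)
        simpa using this
      refine (h4.smul (hasDerivAt_resolvent_comp (hasDerivAt_circle ρ θ)
        (h1 θ hθ))).congr_deriv ?_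
      rw [I_mul_I, mul_neg_one, neg_smul, ← neg_smul (I * _), smul_smul, sub_eq_add_neg]
      congr 2
      linear_combination (2 * π : ℂ)⁻¹ * (-(Real.log ρ + θ * I) * (ρ * Complex.exp (θ * I))) * I_sq
    have hi3 : IntervalIntegrable (fun θ : ℝ => (2 * π : ℂ)⁻¹ •
        resolvent a (ρ * Complex.exp (θ * I))) volume φ (φ + 2 * π) :=
      (continuousOn_const.smul hRc).intervalIntegrable
    have h5 := intervalIntegral.integral_eq_sub_of_hasDerivAt h3 (hi1.sub hi3)
    rw [intervalIntegral.integral_sub hi1 hi3, intervalIntegral.integral_smul,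
      integral_resolvent_circle hρ ha, smul_zero, sub_zero] at h5
    refine h5.trans ?_
    rw [circle_periodic, ← sub_smul, ← neg_one_smul ℂ]
    congr 1
    have hpi : (π : ℂ) ≠ 0 := by simp [Real.pi_ne_zero]
    push_cast
    field_simp
    linear_combination (2 * π : ℂ) * I_sq
  rw [logContour_eval, hray, hcirc]
  abel

theorem mul_neg_resolvent_zero {a : A} (h0 : (0 : ℂ) ∉ spectrum ℂ a) :
    -resolvent a (0 : ℂ) * a = 1 := by
  have := resolvent_mul_sub h0
  rwa [map_zero, zero_sub, mul_neg, ← neg_mul] at this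

theorem zero_notMem_spectrum {a : A} (ha : spectrum ℂ a ⊆ slitDisc φ ρ) :
    (0 : ℂ) ∉ spectrum ℂ a := fun h => (ha h).2 0 le_rfl (by simp)

/-- Along a path whose derivative at `s` commutes with its value, the logarithm has the derivative
`a' a⁻¹`, as for numbers. -/
theorem hasDerivAt_log_of_commute {a : ℝ → A} {a' : A} {s : ℝ} (ha : HasDerivAt a a' s)
    (hc : Commute (a s) a') (h : spectrum ℂ (a s) ⊆ slitDisc φ ρ) :
    HasDerivAt (fun t => (logContour φ hρ).resInt (a t)) (a' * -resolvent (a s) (0 : ℂ)) s := by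
  have hd := disjoint_logContour hρ h
  have hR := (logContour φ hρ).continuousOn_resolvent hd
  refine ((logContour φ hρ).hasDerivAt_resInt ha hd).congr_deriv ?_
  have h1 := (logContour φ hρ).eval_clm (f := fun z => resolvent (a s) z * resolvent (a s) z)
    (ContinuousLinearMap.mul ℂ A a') (hR.mul hR)
  simp only [ContinuousLinearMap.mul_apply'] at h1
  rw [← logContour_eval_resolvent_mul_resolvent hρ h, ← h1]
  refine (logContour φ hρ).eval_congr fun z _ => ?_
  simp only [(commute_resolvent hc z).eq, mul_assoc]

theorem isPrimaryFunction_log {a : A} (ha : spectrum ℂ a ⊆ slitDisc φ ρ) :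
    IsPrimaryFunction (logBranch φ) a ((logContour φ hρ).resInt a) := by
  refine isPrimaryFunction_resInt _ (disjoint_logContour hρ ha)
    (fun x hx => analyticAt_logBranch (ha hx).2) fun x hx => ?_
  have h1 : ∀ᶠ z in 𝓝 x, ‖z‖ < ρ :=
    (continuous_norm.tendsto x).eventually_lt_const (ha hx).1
  have h2 : ∀ᶠ z in 𝓝 x, -(z * Complex.exp (-(φ * I))) ∈ slitPlane := by
    have h3 := neg_rotate_add_mem_slitPlane (ha hx).2 le_rfl
    rw [ofReal_zero, zero_sub] at h3
    exact (by fun_prop : Continuous fun z : ℂ => -(z * Complex.exp (-(φ * I)))).continuousAt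
      |>.eventually (isOpen_slitPlane.mem_nhds h3)
  filter_upwards [h1, h2] with z hz1 hz2
  refine (logContour_eval_inv_sub hρ ⟨hz1, ?_⟩).symm
  rintro y hy rfl
  rw [mul_assoc, ← Complex.exp_add, add_neg_cancel, Complex.exp_zero, mul_one,
    Complex.mem_slitPlane_iff] at hz2
  simp at hz2
  linarith

theorem log_algebraMap {c : ℂ} (hc : c ∈ slitDisc φ ρ) :
    (logContour φ hρ).resInt (algebraMap ℂ A c) = algebraMap ℂ A (logBranch φ c) := by
  rw [← logContour_eval_inv_sub hρ hc]
  have hne : ∀ w ∈ (logContour φ hρ).carrier, w ≠ c := by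
    rintro w hw rfl
    exact Set.disjoint_left.mp (disjoint_logContour_slitDisc hρ) hw hc
  have h1 := (logContour φ hρ).eval_clm (f := fun w => (w - c)⁻¹)
    ((ContinuousLinearMap.id ℂ ℂ).smulRight (1 : A))
    (ContinuousOn.inv₀ (by fun_prop) fun w hw => sub_ne_zero.mpr (hne w hw))
  simp only [ContinuousLinearMap.smulRight_apply, ContinuousLinearMap.id_apply] at h1
  rw [WeightedContour.resInt, Algebra.algebraMap_eq_smul_one ((logContour φ hρ).eval _), ← h1]
  refine (logContour φ hρ).eval_congr fun w hw => ?_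
  rw [resolvent_algebraMap (hne w hw), Algebra.algebraMap_eq_smul_one]

theorem logBranch_opposite {τ : ℝ} (hτ : 0 < τ) (φ : ℝ) :
    logBranch φ (-(τ * Complex.exp (φ * I))) = Real.log τ + (φ + π) * I := by
  rw [logBranch, neg_mul, neg_neg, mul_assoc, ← Complex.exp_add, add_neg_cancel, Complex.exp_zero,
    mul_one, Complex.ofReal_log hτ.le]

theorem opposite_notMem_ray {τ : ℝ} (hτ : 0 < τ) (φ : ℝ) {y : ℝ} (hy : 0 ≤ y) :
    -(τ * Complex.exp (φ * I)) ≠ y * Complex.exp (φ * I) := by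
  intro h
  rw [← neg_mul] at h
  have h2 := mul_right_cancel₀ (Complex.exp_ne_zero _) h
  have : -τ = y := by exact_mod_cast h2
  linarith

/-- The slit disc is star-shaped around the points opposite to the cut, so an operator can be
deformed to a scalar one with its spectrum in the slit disc. -/
theorem exp_log {a : A} (ha : spectrum ℂ a ⊆ slitDisc φ ρ) :
    NormedSpace.exp ((logContour φ hρ).resInt a) = a := by
  -- The point `c` lies opposite to the cut, at half the radius of the disc.
  set τ := ρ / 2 with hτ
  have hτ0 : 0 < τ := by positivity
  set c : ℂ := -(τ * Complex.exp (φ * I)) with hc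
  have hcn : ‖c‖ = τ := by
    rw [hc, norm_neg, norm_mul, Complex.norm_exp_ofReal_mul_I, mul_one, Complex.norm_real,
      Real.norm_of_nonneg hτ0.le]
  have hcs : c ∈ slitDisc φ ρ := ⟨by rw [hcn, hτ]; linarith, fun y hy =>
    opposite_notMem_ray hτ0 φ hy⟩
  set p : ℝ → A := fun s => s • a + algebraMap ℂ A ((1 - s : ℝ) * c) with hp
  have hps : ∀ s ∈ Set.Icc (0 : ℝ) 1, spectrum ℂ (p s) ⊆ slitDisc φ ρ := by
    intro s hs z hz
    obtain ⟨x, hx, rfl⟩ := spectrum_smul_add hz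
    obtain ⟨hx1, hx2⟩ := ha hx
    constructor
    · calc _ ≤ s * ‖x‖ + (1 - s) * τ := by
            refine (norm_add_le _ _).trans ?_
            rw [norm_mul, norm_mul, Complex.norm_real, Complex.norm_real,
              Real.norm_of_nonneg hs.1, Real.norm_of_nonneg (sub_nonneg.mpr hs.2), hcn]
        _ < ρ := by
            rcases hs.1.eq_or_lt with h | h
            · rw [← h]; linarith
            · nlinarith [hs.2]
    · intro y hy h
      rcases hs.1.eq_or_lt with h0 | h0
      · rw [← h0] at h
        simp only [ofReal_zero, zero_mul, zero_add, sub_zero, ofReal_one, one_mul] at h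
        exact hcs.2 y hy h
      · refine hx2 ((y + (1 - s) * τ) / s) (div_nonneg (add_nonneg hy
          (mul_nonneg (sub_nonneg.mpr hs.2) hτ0.le)) hs.1) ?_
        have hs0 : (s : ℂ) ≠ 0 := by exact_mod_cast h0.ne'
        push_cast at h ⊢
        field_simp
        rw [hc] at h
        linear_combination h
  have hpd : ∀ s, HasDerivAt p (a - algebraMap ℂ A c) s := by
    intro s
    have h1 : HasDerivAt (fun s : ℝ => algebraMap ℂ A ((1 - s : ℝ) * c)) (-algebraMap ℂ A c) s := by
      have : (fun s : ℝ => algebraMap ℂ A ((1 - s : ℝ) * c)) =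
          fun s : ℝ => (1 - s) • algebraMap ℂ A c := by
        funext s
        rw [map_mul, ← Algebra.smul_def, Complex.coe_smul]
      rw [this]
      simpa using ((hasDerivAt_id s).const_sub 1).smul_const (algebraMap ℂ A c)
    exact (((hasDerivAt_id s).smul_const a).add h1).congr_deriv (by simp [sub_eq_add_neg])
  have hca : ∀ s, Commute (p s) a := fun s =>
    ((Commute.refl a).smul_left s).add_left (Algebra.commutes _ a)
  have hcp : ∀ s, Commute (p s) (a - algebraMap ℂ A c) := fun s =>
    (hca s).sub_right (Algebra.commutes c (p s)).symm
  set L : ℝ → A := fun s => (logContour φ hρ).resInt (p s) with hL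
  have hLd : ∀ s ∈ Set.Icc (0 : ℝ) 1,
      HasDerivAt L ((a - algebraMap ℂ A c) * -resolvent (p s) (0 : ℂ)) s := fun s hs =>
    hasDerivAt_log_of_commute hρ (hpd s) (hcp s) (hps s hs)
  -- With `L = log p` one has `L' p = p'`, so `e^{-L} p` is constant along the segment.
  have hconst : ∀ s ∈ Set.Icc (0 : ℝ) 1,
      HasDerivAt (fun s => NormedSpace.exp (-L s) * p s) 0 s := by
    intro s hs
    have hd := disjoint_logContour hρ (hps s hs)
    have hcR : Commute (resolvent (p s) (0 : ℂ)) (p s) := commute_resolvent (Commute.refl _) 0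
    have hcL : ∀ b, Commute (p s) b → Commute (L s) b := fun b hb =>
      (logContour φ hρ).commute_resInt hd hb
    have h1 : Commute (L s) ((a - algebraMap ℂ A c) * -resolvent (p s) (0 : ℂ)) :=
      (hcL _ (hcp s)).mul_right (hcL _ hcR.symm).neg_right
    have h2 := hasDerivAt_exp_comp_of_commute (hLd s hs).neg (h1.neg_left.neg_right)
    refine (h2.mul (hpd s)).congr_deriv ?_
    have h3 := mul_neg_resolvent_zero (zero_notMem_spectrum (hps s hs))
    have h4 : Commute (p s) (NormedSpace.exp (-L s)) :=
      commute_exp_right (hcL _ (Commute.refl _)).symm.neg_right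
    have h5 : Commute (a - algebraMap ℂ A c) (NormedSpace.exp (-L s)) :=
      commute_exp_right (hcL _ (hcp s)).symm.neg_right
    simp only [Pi.neg_apply]
    rw [mul_assoc, ← h4.eq, ← mul_assoc, neg_mul, mul_assoc _ _ (p s), h3, mul_one, neg_mul,
      h5.eq, neg_add_cancel]
  have h1 := constant_of_has_deriv_right_zero
    (fun s hs => (hconst s hs).continuousAt.continuousWithinAt)
    (fun s hs => (hconst s (Set.Ico_subset_Icc_self hs)).hasDerivWithinAt) 1 (by simp)
  have hp0 : p 0 = algebraMap ℂ A c := by simp [hp]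
  have hp1 : p 1 = a := by simp [hp]
  have hL0 : NormedSpace.exp (-L 0) * p 0 = 1 := by
    have hexp : Complex.exp (logBranch φ c) = c := by
      rw [hc, logBranch_opposite hτ0, Complex.exp_add, ← Complex.ofReal_exp, Real.exp_log hτ0,
        add_mul, Complex.exp_add, Complex.exp_pi_mul_I]
      ring
    rw [hL]
    simp only [hp0]
    rw [log_algebraMap hρ hcs, ← map_neg, exp_algebraMap, ← map_mul, Complex.exp_neg, hexp,
      inv_mul_cancel₀, map_one]
    rw [← norm_ne_zero_iff, hcn]; exact hτ0.ne'
  rw [hL0, hp1] at h1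
  have h2 : NormedSpace.exp ((logContour φ hρ).resInt a) = NormedSpace.exp (L 1) := by
    rw [hL]; simp only [hp1]
  rw [h2, ← mul_one (NormedSpace.exp (L 1)), ← h1, ← mul_assoc, exp_mul_exp_neg, one_mul]

theorem cexp_notMem_ray {x : ℂ} (hx : φ < x.im ∧ x.im < φ + 2 * π) {y : ℝ} (hy : 0 ≤ y) :
    Complex.exp x ≠ y * Complex.exp (φ * I) := by
  intro h
  have hy0 : 0 < y := by
    refine hy.lt_of_ne fun h0 => Complex.exp_ne_zero x ?_
    rw [h, ← h0]; simp
  rw [← Real.exp_log hy0, Complex.ofReal_exp, ← Complex.exp_add, Complex.exp_eq_exp_iff_exists_int]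
    at h
  obtain ⟨n, hn⟩ := h
  have him := congrArg Complex.im hn
  simp only [add_im, mul_im, ofReal_im, ofReal_re, I_re, I_im, mul_one, mul_zero, zero_add,
    add_zero, intCast_re, intCast_im, mul_re, re_ofNat, im_ofNat, zero_mul, sub_zero] at him
  have h1 : (0 : ℝ) < n := by nlinarith [Real.pi_pos]
  have h2 : (n : ℝ) < 1 := by nlinarith [Real.pi_pos]
  have h3 : 0 < n := by exact_mod_cast h1
  have h4 : n < 1 := by exact_mod_cast h2
  omega

/-- The strip is convex, so an operator with spectrum in the strip can be deformed to a scalar one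
with its spectrum in the strip. -/
theorem log_exp {X : A} (hX : ∀ x ∈ spectrum ℂ X, φ < x.im ∧ x.im < φ + 2 * π)
    (hX' : ∀ x ∈ spectrum ℂ X, Real.exp x.re < ρ) :
    (logContour φ hρ).resInt (NormedSpace.exp X) = X := by
  -- The number `c` lies on the middle line of the strip, where `|e^c| < ρ`.
  set c : ℂ := Real.log (ρ / 2) + (φ + π) * I with hc
  have hcre : c.re = Real.log (ρ / 2) := by simp [hc]
  have hcim : c.im = φ + π := by simp [hc]
  have hρ2 : 0 < ρ / 2 := by positivity
  set V : A := X - algebraMap ℂ A c with hV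
  set p : ℝ → A := fun s => NormedSpace.exp (s • V) * algebraMap ℂ A (Complex.exp c) with hp
  have hpe : ∀ s, p s = NormedSpace.exp (s • X + algebraMap ℂ A ((1 - s : ℝ) * c)) := by
    intro s
    have : s • X + algebraMap ℂ A ((1 - s : ℝ) * c) = s • V + algebraMap ℂ A c := by
      rw [hV, smul_sub, ofReal_sub, sub_mul, map_sub, map_mul (algebraMap ℂ A) (s : ℂ),
        ← Algebra.smul_def (s : ℂ), Complex.coe_smul, ofReal_one, one_mul]
      abel
    rw [this, exp_add_of_commute (Algebra.commutes c _).symm, exp_algebraMap]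
  have hpi := Real.pi_pos
  have hps : ∀ s ∈ Set.Icc (0 : ℝ) 1, spectrum ℂ (p s) ⊆ slitDisc φ ρ := by
    intro s hs z hz
    rw [hpe] at hz
    obtain ⟨w, hw, rfl⟩ := spectrum_exp hz
    obtain ⟨x, hx, rfl⟩ := spectrum_smul_add hw
    obtain ⟨h1, h2⟩ := hX x hx
    have h3 : x.re < Real.log ρ := by
      rw [Real.lt_log_iff_exp_lt hρ]; exact hX' x hx
    have h4 : Real.log (ρ / 2) < Real.log ρ := Real.log_lt_log hρ2 (by linarith)
    constructor
    · rw [Complex.norm_exp, ← Real.lt_log_iff_exp_lt hρ]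
      simp only [add_re, re_ofReal_mul, hcre]
      rcases hs.1.eq_or_lt with h | h
      · rw [← h]; linarith
      · nlinarith [hs.2]
    · intro y hy
      refine cexp_notMem_ray ?_ hy
      simp only [add_im, im_ofReal_mul, hcim]
      rcases hs.1.eq_or_lt with h | h
      · rw [← h]; constructor <;> linarith
      · constructor <;> nlinarith [hs.2]
  have hpd : ∀ s, HasDerivAt p (V * p s) s := fun s =>
    ((hasDerivAt_exp_smul V s).mul_const _).congr_deriv (by simp only [hp, mul_assoc])
  have hcV : ∀ s, Commute (p s) V := fun s =>
    (((commute_exp_right ((Commute.refl V).smul_right s)).symm).mul_left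
      (Algebra.commutes _ V))
  have hd : ∀ s ∈ Set.Icc (0 : ℝ) 1,
      HasDerivAt (fun s => (logContour φ hρ).resInt (p s) - s • V) 0 s := by
    intro s hs
    have h1 := hasDerivAt_log_of_commute hρ (hpd s) ((hcV s).mul_right (Commute.refl _))
      (hps s hs)
    refine (h1.sub ((hasDerivAt_id s).smul_const V)).congr_deriv ?_
    have h3 := mul_neg_resolvent_zero (zero_notMem_spectrum (hps s hs))
    have h4 : Commute (resolvent (p s) (0 : ℂ)) (p s) := commute_resolvent (Commute.refl _) 0
    rw [mul_assoc, ← h4.neg_left.eq, h3, mul_one, one_smul, sub_self]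
  have h1 := constant_of_has_deriv_right_zero
    (fun s hs => (hd s hs).continuousAt.continuousWithinAt)
    (fun s hs => (hd s (Set.Ico_subset_Icc_self hs)).hasDerivWithinAt) 1 (by simp)
  have hp1 : p 1 = NormedSpace.exp X := by rw [hpe]; simp
  have hexp : Complex.exp c = -((ρ / 2 : ℝ) * Complex.exp (φ * I)) := by
    rw [hc, Complex.exp_add, ← Complex.ofReal_exp, Real.exp_log hρ2,
      add_mul, Complex.exp_add, Complex.exp_pi_mul_I]
    ring
  have hp0 : p 0 = algebraMap ℂ A (Complex.exp c) := by simp [hpe, exp_algebraMap]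
  have hcs : Complex.exp c ∈ slitDisc φ ρ := by
    constructor
    · rw [Complex.norm_exp, hcre, Real.exp_log hρ2]; linarith
    · intro y hy; rw [hexp]; exact opposite_notMem_ray hρ2 φ hy
  rw [hp1, hp0, one_smul, zero_smul, sub_zero, log_algebraMap hρ hcs, hexp,
    logBranch_opposite hρ2, sub_eq_iff_eq_add, hV] at h1
  rw [h1]
  abel

end OperatorLog

/-! ### Integrals over the boundary of a rectangle -/

namespace WeightedContour

variable {ι : Type} [Fintype ι] (C : WeightedContour ι)
variable {F : Type*} [NormedAddCommGroup F] [NormedSpace ℂ F]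

/-- Multiply the weights of a contour by a function on it. -/
def reweight (f : ℂ → ℂ) (hf : ∀ i, Continuous fun s => f (C.pt i s)) : WeightedContour ι where
  lo := C.lo
  hi := C.hi
  le := C.le
  wt i s := C.wt i s * f (C.pt i s)
  pt := C.pt
  continuous_wt i := (C.continuous_wt i).mul (hf i)
  continuous_pt := C.continuous_pt

variable {f : ℂ → ℂ} (hf : ∀ i, Continuous fun s => f (C.pt i s))

theorem reweight_eval (g : ℂ → F) : (C.reweight f hf).eval g = C.eval fun z => f z • g z := by
  simp only [eval, reweight, mul_smul]

theorem eval_smul {g : ℂ → F} (c : ℂ) (hg : ContinuousOn g C.carrier) [CompleteSpace F] :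
    C.eval (fun z => c • g z) = c • C.eval g := by
  simpa using C.eval_clm (c • ContinuousLinearMap.id ℂ F) hg

/-- Differentiation under the integral sign with respect to an exponential parameter. -/
theorem hasDerivAt_eval_exp [CompleteSpace F] {g : ℂ → F} (hg : ContinuousOn g C.carrier) (u : ℝ) :
    HasDerivAt (fun u : ℝ => C.eval fun z => Complex.exp (-(u * z)) • g z)
      (C.eval fun z => (-z * Complex.exp (-(u * z))) • g z) u := by
  unfold eval
  refine HasDerivAt.fun_sum fun i _ => ?_
  have hgc := C.continuousOn_comp_pt hg i
  rw [← Set.uIcc_of_le (C.le i)] at hgc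
  have hwt := C.continuous_wt i
  have hpt := C.continuous_pt i
  have hF : ∀ u : ℝ, ContinuousOn (fun s => C.wt i s • Complex.exp (-(u * C.pt i s)) •
      g (C.pt i s)) (Set.uIcc (C.lo i) (C.hi i)) := fun u => by
    have h1 : Continuous fun s => Complex.exp (-(u * C.pt i s)) := by fun_prop
    exact hwt.continuousOn.smul (h1.continuousOn.smul hgc)
  have hF' : ContinuousOn (fun s => C.wt i s • (-C.pt i s * Complex.exp (-(u * C.pt i s))) •
      g (C.pt i s)) (Set.uIcc (C.lo i) (C.hi i)) := by
    have h1 : Continuous fun s => -C.pt i s * Complex.exp (-(u * C.pt i s)) := by fun_prop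
    exact hwt.continuousOn.smul (h1.continuousOn.smul hgc)
  have hb : ContinuousOn (fun s => ‖C.wt i s‖ * (‖C.pt i s‖ *
      Real.exp ((|u| + 1) * ‖C.pt i s‖) * ‖g (C.pt i s)‖)) (Set.uIcc (C.lo i) (C.hi i)) := by
    have h1 : Continuous fun s => ‖C.pt i s‖ * Real.exp ((|u| + 1) * ‖C.pt i s‖) := by fun_prop
    exact hwt.norm.continuousOn.mul (h1.continuousOn.mul hgc.norm)
  refine (intervalIntegral.hasDerivAt_integral_of_dominated_loc_of_deriv_le
    (F := fun (u : ℝ) s => C.wt i s • Complex.exp (-(u * C.pt i s)) • g (C.pt i s))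
    (F' := fun (u : ℝ) s => C.wt i s • (-C.pt i s * Complex.exp (-(u * C.pt i s))) •
      g (C.pt i s)) (Metric.ball_mem_nhds u one_pos)
    (Filter.Eventually.of_forall fun u => ?_) (hF u).intervalIntegrable ?_
    (Filter.Eventually.of_forall fun s _ v hv => ?_) hb.intervalIntegrable
    (Filter.Eventually.of_forall fun s _ v _ => ?_)).2
  · exact ((hF u).mono Set.uIoc_subset_uIcc).aestronglyMeasurable measurableSet_uIoc
  · exact (hF'.mono Set.uIoc_subset_uIcc).aestronglyMeasurable measurableSet_uIoc
  · rw [norm_smul, norm_smul, norm_mul, norm_neg, Complex.norm_exp]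
    have hv' : |v| ≤ |u| + 1 := by
      rw [Metric.mem_ball, Real.dist_eq] at hv
      have := abs_sub_abs_le_abs_sub v u
      linarith
    have h2 : (-(v * C.pt i s)).re ≤ (|u| + 1) * ‖C.pt i s‖ := by
      calc _ ≤ ‖-(v * C.pt i s)‖ := Complex.re_le_norm _
        _ = |v| * ‖C.pt i s‖ := by rw [norm_neg, norm_mul, Complex.norm_real, Real.norm_eq_abs]
        _ ≤ _ := by gcongr
    gcongr
  · have h1 : HasDerivAt (fun v : ℝ => Complex.exp (-(v * C.pt i s)))
        (-C.pt i s * Complex.exp (-(v * C.pt i s))) v := by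
      have := (((hasDerivAt_id v).ofReal_comp.mul_const (C.pt i s)).neg).cexp
      refine this.congr_deriv ?_
      simp only [id, Pi.neg_apply]; push_cast; ring
    exact (h1.smul_const _).const_smul _

end WeightedContour

/-- The positively oriented boundary of the rectangle `[-a, a] × [-H, H]` with its line element
divided by `2 π i`. -/
def rectContour {a H : ℝ} (ha : 0 < a) (hH : 0 < H) : WeightedContour (Fin 4) where
  lo := ![-a, -a, -H, -H]
  hi := ![a, a, H, H]
  le i := by
    fin_cases i
    · simpa using ha.le
    · simpa using ha.le
    · simpa using hH.le
    · simpa using hH.le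
  wt i _ := (2 * π * I)⁻¹ * ![1, -1, I, -I] i
  pt := ![fun x => x + (-H : ℝ) * I, fun x => x + H * I, fun y => a + y * I,
    fun y => (-a : ℝ) + y * I]
  continuous_wt _ := continuous_const
  continuous_pt i := by
    fin_cases i
    · exact (by fun_prop : Continuous fun x : ℝ => x + (-H : ℝ) * I)
    · exact (by fun_prop : Continuous fun x : ℝ => x + H * I)
    · exact (by fun_prop : Continuous fun y : ℝ => a + y * I)
    · exact (by fun_prop : Continuous fun y : ℝ => (-a : ℝ) + y * I)

/-- The open rectangle `(-a, a) × (-H, H)`. -/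
def openRect (a H : ℝ) : Set ℂ := {z | |z.re| < a ∧ |z.im| < H}

section Rect

variable {a H : ℝ} (ha : 0 < a) (hH : 0 < H)
variable {F : Type*} [NormedAddCommGroup F] [NormedSpace ℂ F]

theorem rectContour_eval (f : ℂ → F) : (rectContour ha hH).eval f =
    (2 * π * I : ℂ)⁻¹ • ((∫ x : ℝ in -a..a, f (x + (-H : ℝ) * I)) -
      (∫ x : ℝ in -a..a, f (x + H * I)) + I • (∫ y : ℝ in -H..H, f (a + y * I)) -
      I • ∫ y : ℝ in -H..H, f ((-a : ℝ) + y * I)) := by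
  rw [WeightedContour.eval, Fin.sum_univ_four]
  simp only [rectContour, Matrix.cons_val, intervalIntegral.integral_smul, mul_smul,
    neg_smul, smul_neg, smul_add,
    intervalIntegral.integral_neg, sub_eq_add_neg, mul_neg, mul_one]

theorem mem_rectContour_carrier {z : ℂ} : z ∈ (rectContour ha hH).carrier ↔
    (∃ x ∈ Set.Icc (-a) a, x + (-H : ℝ) * I = z) ∨ (∃ x ∈ Set.Icc (-a) a, x + H * I = z) ∨
    (∃ y ∈ Set.Icc (-H) H, a + y * I = z) ∨ ∃ y ∈ Set.Icc (-H) H, (-a : ℝ) + y * I = z := by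
  rw [WeightedContour.carrier, Set.mem_iUnion]
  constructor
  · rintro ⟨i, h⟩
    fin_cases i
    · exact Or.inl h
    · exact Or.inr (Or.inl h)
    · exact Or.inr (Or.inr (Or.inl h))
    · exact Or.inr (Or.inr (Or.inr h))
  · rintro (h | h | h | h)
    exacts [⟨0, h⟩, ⟨1, h⟩, ⟨2, h⟩, ⟨3, h⟩]

theorem rectContour_cases {z : ℂ} (hz : z ∈ (rectContour ha hH).carrier) :
    (|z.re| ≤ a ∧ |z.im| = H) ∨ (|z.re| = a ∧ |z.im| ≤ H) := by
  rcases (mem_rectContour_carrier ha hH).mp hz with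
    ⟨x, hx, rfl⟩ | ⟨x, hx, rfl⟩ | ⟨x, hx, rfl⟩ | ⟨x, hx, rfl⟩
  · left; simpa [abs_le, abs_of_pos hH] using hx
  · left; simpa [abs_le, abs_of_pos hH] using hx
  · right; simpa [abs_le, abs_of_pos ha] using hx
  · right; simpa [abs_le, abs_of_pos ha] using hx

theorem disjoint_rectContour_openRect :
    Disjoint (rectContour ha hH).carrier (openRect a H) := by
  refine Set.disjoint_left.mpr fun z hz hz' => ?_
  rcases rectContour_cases ha hH hz with h | h
  · exact hz'.2.ne h.2
  · exact hz'.1.ne h.1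

/-- The Cauchy-Goursat theorem. -/
theorem rectContour_eval_eq_zero [CompleteSpace F] {f : ℂ → F} {s : Set ℂ} (hs : s.Countable)
    (hc : ∀ z : ℂ, |z.im| ≤ H → ContinuousAt f z)
    (hd : ∀ z : ℂ, |z.im| < H → z ∉ s → DifferentiableAt ℂ f z) :
    (rectContour ha hH).eval f = 0 := by
  rw [rectContour_eval]
  have him : ∀ z : ℂ, z.im ∈ Set.uIcc (-H) H → |z.im| ≤ H := fun z hz => by
    rw [Set.uIcc_of_le (by linarith)] at hz
    exact abs_le.mpr hz
  have := integral_boundary_rect_eq_zero_of_differentiable_on_off_countable f ⟨-a, -H⟩ ⟨a, H⟩ s hs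
    (fun z hz => (hc z (him z hz.2)).continuousWithinAt) (fun z hz => hd z (by
      have h := hz.1.2
      simp only [Set.mem_preimage, Set.mem_Ioo] at h
      rw [min_eq_left (by linarith), max_eq_right (by linarith)] at h
      exact abs_lt.mpr h) hz.2)
  simp only at this
  rw [this, smul_zero]

variable {A : Type*} [NormedRing A] [NormedAlgebra ℂ A] [CompleteSpace A]

/-- The derivative of the resolvent is minus its square, so the square integrates to zero over a closed
curve. -/
theorem rectContour_eval_resolvent_mul_resolvent {b : A}
    (hb : Disjoint (rectContour ha hH).carrier (spectrum ℂ b)) :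
    (rectContour ha hH).eval (fun z => resolvent b z * resolvent b z) = 0 := by
  have hR := (rectContour ha hH).continuousOn_resolvent hb
  have hmem : ∀ i, ∀ s ∈ Set.uIcc ((rectContour ha hH).lo i) ((rectContour ha hH).hi i),
      (rectContour ha hH).pt i s ∉ spectrum ℂ b := fun i s hs =>
    Set.disjoint_left.mp hb ((rectContour ha hH).pt_mem' hs)
  have hint : ∀ i, IntervalIntegrable (fun s => resolvent b ((rectContour ha hH).pt i s) *
      resolvent b ((rectContour ha hH).pt i s)) volume ((rectContour ha hH).lo i)
      ((rectContour ha hH).hi i) := fun i => by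
    apply ContinuousOn.intervalIntegrable
    rw [Set.uIcc_of_le ((rectContour ha hH).le i)]
    have := (rectContour ha hH).continuousOn_comp_pt hR i
    exact this.mul this
  have hseg : ∀ (p q : ℝ) (γ : ℝ → ℂ) (γ' : ℂ), (∀ s, HasDerivAt γ γ' s) →
      (∀ s ∈ Set.uIcc p q, γ s ∉ spectrum ℂ b) →
      IntervalIntegrable (fun s => resolvent b (γ s) * resolvent b (γ s)) volume p q →
      γ' • (∫ s in p..q, resolvent b (γ s) * resolvent b (γ s)) =
        resolvent b (γ p) - resolvent b (γ q) := by
    intro p q γ γ' hγ hn hi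
    have := intervalIntegral.integral_eq_sub_of_hasDerivAt
      (fun s hs => hasDerivAt_resolvent_comp (hγ s) (hn s hs)) (hi.smul γ').neg
    simp only [intervalIntegral.integral_neg, intervalIntegral.integral_smul] at this
    rw [← neg_sub, ← this, neg_neg]
  have hx : ∀ (c : ℂ) (s : ℝ), HasDerivAt (fun x : ℝ => x + c) 1 s := fun c s =>
    (hasDerivAt_id s).ofReal_comp.add_const c
  have hy : ∀ (c : ℂ) (s : ℝ), HasDerivAt (fun y : ℝ => c + y * I) I s := fun c s => by
    simpa using ((hasDerivAt_id s).ofReal_comp.mul_const I).const_add c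
  have h0 := hseg (-a) a _ 1 (hx _) (hmem 0) (hint 0)
  have h1 := hseg (-a) a _ 1 (hx _) (hmem 1) (hint 1)
  have h2 := hseg (-H) H _ I (hy _) (hmem 2) (hint 2)
  have h3 := hseg (-H) H _ I (hy _) (hmem 3) (hint 3)
  rw [one_smul] at h0 h1
  rw [rectContour_eval, h0, h1, h2, h3]
  simp only [smul_eq_zero, inv_eq_zero]
  right
  abel

/-- The winding number of the rectangle around the origin, as the sum of the changes of the argument
along the four sides. -/
theorem rectContour_eval_inv : (rectContour ha hH).eval (fun z => z⁻¹) = 1 := by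
  have hlog : ∀ c q : ℝ, 0 < c → (∫ y in -q..q, (c + y * I : ℂ)⁻¹) =
      -I * (Complex.log (c + q * I) - Complex.log (c - q * I)) := by
    intro c q hc
    have hs : ∀ y : ℝ, (c + y * I : ℂ) ∈ slitPlane := fun y =>
      Complex.mem_slitPlane_iff.mpr (Or.inl (by simpa using hc))
    have hd : ∀ y : ℝ, HasDerivAt (fun y : ℝ => -I * Complex.log (c + y * I))
        (c + y * I : ℂ)⁻¹ y := by
      intro y
      have h1 : HasDerivAt (fun y : ℝ => (c + y * I : ℂ)) I y := by
        simpa using ((hasDerivAt_id y).ofReal_comp.mul_const I).const_add (c : ℂ)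
      refine ((h1.clog_real (hs y)).const_mul (-I)).congr_deriv ?_
      rw [← mul_div_assoc, neg_mul, I_mul_I, neg_neg, one_div]
    rw [intervalIntegral.integral_eq_sub_of_hasDerivAt (fun y _ => hd y)]
    · push_cast; ring_nf
    · exact (Continuous.inv₀ (by fun_prop) fun y => slitPlane_ne_zero (hs y)).intervalIntegrable _ _
  have hne : ∀ z : ℂ, (-z)⁻¹ = -z⁻¹ := fun z => inv_neg
  have e0 : ∀ x : ℝ, (x + (-H : ℝ) * I : ℂ)⁻¹ = I * (H + x * I : ℂ)⁻¹ := by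
    intro x
    have : (x + (-H : ℝ) * I : ℂ) = -I * (H + x * I) := by
      push_cast; linear_combination x * I_sq
    rw [this, mul_inv, inv_neg, inv_I, neg_neg]
  have e1 : ∀ x : ℝ, (x + H * I : ℂ)⁻¹ = -I * (H + (-x : ℝ) * I : ℂ)⁻¹ := by
    intro x
    have : (x + H * I : ℂ) = I * (H + (-x : ℝ) * I) := by
      push_cast; linear_combination x * I_sq
    rw [this, mul_inv, inv_I]
  have e3 : ∀ y : ℝ, ((-a : ℝ) + y * I : ℂ)⁻¹ = -(a + (-y : ℝ) * I : ℂ)⁻¹ := by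
    intro y
    rw [← inv_neg]
    congr 1; push_cast; ring
  have hrev : ∀ (c q : ℝ), (∫ y in -q..q, (c + (-y : ℝ) * I : ℂ)⁻¹) =
      ∫ y in -q..q, (c + y * I : ℂ)⁻¹ := fun c q => by
    rw [intervalIntegral.integral_comp_neg (fun y : ℝ => (c + y * I : ℂ)⁻¹), neg_neg]
  -- The remaining logarithms are those of conjugate corners, rotated by a right angle.
  have hl1 : Complex.log (H + a * I) = Complex.log (a - H * I) + π / 2 * I := by
    have : (H + a * I : ℂ) = I * (a - H * I) := by linear_combination H * I_sq
    have h0 : (a - H * I : ℂ) ≠ 0 := fun h => ha.ne' (by simpa using congrArg Complex.re h)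
    rw [this, (Complex.log_mul_eq_add_log_iff I_ne_zero h0).mpr, Complex.log_I, add_comm]
    rw [Complex.arg_I]
    have := Complex.abs_arg_lt_pi_div_two_iff.mpr (Or.inl (by simpa using ha : 0 < (a - H * I : ℂ).re))
    rw [abs_lt] at this
    constructor <;> linarith [Real.pi_pos]
  have hl2 : Complex.log (H - a * I) = Complex.log (a + H * I) - π / 2 * I := by
    have : (H - a * I : ℂ) = -I * (a + H * I) := by linear_combination H * I_sq
    have h0 : (a + H * I : ℂ) ≠ 0 := fun h => ha.ne' (by simpa using congrArg Complex.re h)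
    rw [this, (Complex.log_mul_eq_add_log_iff (neg_ne_zero.mpr I_ne_zero) h0).mpr,
      Complex.log_neg_I]
    · ring
    rw [Complex.arg_neg_I]
    have := Complex.abs_arg_lt_pi_div_two_iff.mpr (Or.inl (by simpa using ha : 0 < (a + H * I : ℂ).re))
    rw [abs_lt] at this
    constructor <;> linarith [Real.pi_pos]
  rw [rectContour_eval]
  simp only [e0, e1, e3, intervalIntegral.integral_const_mul, intervalIntegral.integral_neg, hrev,
    hlog H a hH, hlog a H ha, smul_eq_mul, hl1, hl2]
  have hpi : (2 * π * I : ℂ) ≠ 0 := two_pi_I_ne_zero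
  rw [inv_mul_eq_one₀ hpi]
  linear_combination (2 * π * I) * I_sq

/-- The total Riesz projection of an operator with spectrum in the rectangle. -/
theorem rectContour_resInt [FiniteDimensional ℂ A] {b : A} (hb : spectrum ℂ b ⊆ openRect a H) :
    (rectContour ha hH).resInt b = 1 := by
  rw [WeightedContour.resInt_eq_resInt_zero]
  · have hne : ∀ z ∈ (rectContour ha hH).carrier, z ≠ 0 := by
      rintro z hz rfl
      exact Set.disjoint_left.mp (disjoint_rectContour_openRect ha hH) hz (by simp [openRect, ha, hH])
    have h1 := (rectContour ha hH).eval_clm (f := fun z => z⁻¹)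
      ((ContinuousLinearMap.id ℂ ℂ).smulRight (1 : A)) (ContinuousOn.inv₀ (by fun_prop) hne)
    simp only [ContinuousLinearMap.smulRight_apply, ContinuousLinearMap.id_apply,
      rectContour_eval_inv, one_smul] at h1
    rw [← h1]
    refine (rectContour ha hH).eval_congr fun z hz => ?_
    have := resolvent_algebraMap (A := A) (hne z hz)
    rw [map_zero, sub_zero] at this
    rw [this, Algebra.algebraMap_eq_smul_one]
  · exact fun c hc => rectContour_eval_resolvent_mul_resolvent ha hH hc
  · intro s hs
    refine (disjoint_rectContour_openRect ha hH).mono_right fun z hz => ?_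
    obtain ⟨x, hx, rfl⟩ := spectrum_smul hz
    obtain ⟨h1, h2⟩ := hb hx
    simp only [openRect, Set.mem_ofPred_eq, re_ofReal_mul, im_ofReal_mul, abs_mul, abs_of_nonneg hs.1]
    exact ⟨(mul_le_of_le_one_left (abs_nonneg _) hs.2).trans_lt h1,
      (mul_le_of_le_one_left (abs_nonneg _) hs.2).trans_lt h2⟩

theorem rectContour_eval_inv_sub {z : ℂ} (hz : z ∈ openRect a H) :
    (rectContour ha hH).eval (fun w => (w - z)⁻¹) = 1 := by
  have := rectContour_resInt (A := ℂ) ha hH (b := z) (by rw [spectrum_complex]; simpa using hz)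
  rw [← this]
  exact (rectContour ha hH).eval_congr fun w _ => (resolvent_complex z w).symm

end Rect

/-! ### The function `z / (1 - e^{-z})` of an operator -/

theorem exp_neg_ne_one_of_abs_im_lt {z : ℂ} (hz : z ≠ 0) (h : |z.im| < 2 * π) :
    Complex.exp (-z) ≠ 1 := by
  intro h1
  obtain ⟨n, hn⟩ := Complex.exp_eq_one_iff.mp h1
  have him := congrArg Complex.im hn
  have hre := congrArg Complex.re hn
  simp only [neg_re, neg_im, mul_re, mul_im, intCast_re, intCast_im, re_ofNat, im_ofNat,
    ofReal_re, ofReal_im, I_re, I_im, mul_zero, zero_mul, sub_zero, add_zero, mul_one,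
    neg_eq_zero] at him hre
  rw [abs_lt] at h
  have h2 : (n : ℝ) < 1 := by nlinarith [Real.pi_pos]
  have h3 : (-1 : ℝ) < n := by nlinarith [Real.pi_pos]
  have h4 : n < 1 := by exact_mod_cast h2
  have h5 : -1 < n := by exact_mod_cast h3
  have h6 : n = 0 := by omega
  subst h6
  exact hz (Complex.ext (by simpa using hre) (by simpa using him))

theorem exp_neg_ne_one_of_re_ne_zero {z : ℂ} (hz : z.re ≠ 0) : Complex.exp (-z) ≠ 1 := by
  intro h1
  have := congrArg norm h1
  rw [Complex.norm_exp, norm_one, Real.exp_eq_one_iff, neg_re, neg_eq_zero] at this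
  exact hz this

/-- The function `1 - e^{-z}` has a simple zero at the origin, so `bchG` is the reciprocal of an
entire function. -/
theorem bchG_eq_inv_dslope (z : ℂ) :
    bchG z = (dslope (fun z => 1 - Complex.exp (-z)) 0 z)⁻¹ := by
  unfold bchG
  split_ifs with h
  · subst h
    rw [dslope_same]
    have : HasDerivAt (fun z : ℂ => 1 - Complex.exp (-z)) (-(Complex.exp (-0) * -1)) 0 :=
      ((hasDerivAt_id (0 : ℂ)).neg.cexp).const_sub 1
    rw [this.deriv]; simp
  · rw [dslope_of_ne _ h, slope_def_field]
    simp

theorem differentiable_dslope_one_sub_exp_neg :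
    Differentiable ℂ (dslope (fun z => 1 - Complex.exp (-z)) 0) := by
  rw [← differentiableOn_univ, Complex.differentiableOn_dslope Filter.univ_mem]
  fun_prop

theorem differentiableAt_bchG {z : ℂ} (h : z = 0 ∨ Complex.exp (-z) ≠ 1) :
    DifferentiableAt ℂ bchG z := by
  rw [funext bchG_eq_inv_dslope]
  refine (differentiable_dslope_one_sub_exp_neg z).inv fun h0 => ?_
  have h1 := bchG_eq_inv_dslope z
  rw [h0, inv_zero] at h1
  unfold bchG at h1
  split_ifs at h1 with hz
  · exact one_ne_zero h1
  · rcases h with h | h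
    · exact hz h
    · exact (div_ne_zero hz (sub_ne_zero.mpr h.symm)) h1

theorem differentiableAt_bchG_of_abs_im_lt {z : ℂ} (h : |z.im| < 2 * π) :
    DifferentiableAt ℂ bchG z := by
  refine differentiableAt_bchG ?_
  by_cases hz : z = 0
  · exact Or.inl hz
  · exact Or.inr (exp_neg_ne_one_of_abs_im_lt hz h)

theorem analyticAt_bchG {z : ℂ} (h : |z.im| < 2 * π) : AnalyticAt ℂ bchG z := by
  have hopen : IsOpen {z : ℂ | |z.im| < 2 * π} :=
    isOpen_lt (continuous_abs.comp Complex.continuous_im) continuous_const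
  exact DifferentiableOn.analyticAt (s := {z : ℂ | |z.im| < 2 * π})
    (fun w hw => (differentiableAt_bchG_of_abs_im_lt hw).differentiableWithinAt)
    (hopen.mem_nhds h)

section BchG

variable {a H : ℝ} (ha : 0 < a) (hH : 0 < H) (hH2 : H < 2 * π)

theorem continuous_bchG_comp_pt (hH2 : H < 2 * π) (i : Fin 4) :
    Continuous fun s => bchG ((rectContour ha hH).pt i s) := by
  have key : ∀ s, DifferentiableAt ℂ bchG ((rectContour ha hH).pt i s) := by
    intro s
    fin_cases i
    · refine differentiableAt_bchG_of_abs_im_lt (z := s + (-H : ℝ) * I) ?_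
      simpa [abs_of_pos hH] using hH2
    · refine differentiableAt_bchG_of_abs_im_lt (z := s + H * I) ?_
      simpa [abs_of_pos hH] using hH2
    · refine differentiableAt_bchG (z := a + s * I) (Or.inr (exp_neg_ne_one_of_re_ne_zero ?_))
      simpa using ha.ne'
    · refine differentiableAt_bchG (z := (-a : ℝ) + s * I)
        (Or.inr (exp_neg_ne_one_of_re_ne_zero ?_))
      simpa using ha.ne'
  exact continuous_iff_continuousAt.mpr fun s =>
    (key s).continuousAt.comp ((rectContour ha hH).continuous_pt i).continuousAt

/-- The boundary of the rectangle, weighted with `bchG`. -/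
def bchContour : WeightedContour (Fin 4) :=
  (rectContour ha hH).reweight bchG (continuous_bchG_comp_pt ha hH hH2)

theorem bchContour_eval {F : Type*} [NormedAddCommGroup F] [NormedSpace ℂ F] (f : ℂ → F) :
    (bchContour ha hH hH2).eval f = (rectContour ha hH).eval fun z => bchG z • f z :=
  (rectContour ha hH).reweight_eval _ f

theorem abs_im_le_of_mem_rectContour {z : ℂ} (hz : z ∈ (rectContour ha hH).carrier) :
    |z.im| ≤ H := by
  rcases rectContour_cases ha hH hz with h | h
  exacts [h.2.le, h.2]

theorem ne_zero_of_mem_rectContour {z : ℂ} (hz : z ∈ (rectContour ha hH).carrier) : z ≠ 0 := by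
  rintro rfl
  exact Set.disjoint_left.mp (disjoint_rectContour_openRect ha hH) hz (by simp [openRect, ha, hH])

theorem continuousOn_bchG (hH2 : H < 2 * π) : ContinuousOn bchG (rectContour ha hH).carrier :=
  fun _ hz => (differentiableAt_bchG_of_abs_im_lt
    ((abs_im_le_of_mem_rectContour ha hH hz).trans_lt hH2)).continuousAt.continuousWithinAt

/-- Cauchy's formula for `bchG` on the rectangle. -/
theorem bchContour_eval_inv_sub {z : ℂ} (hz : z ∈ openRect a H) :
    (bchContour ha hH hH2).eval (fun w => (w - z)⁻¹) = bchG z := by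
  have hne : ∀ w ∈ (rectContour ha hH).carrier, w - z ≠ 0 := by
    intro w hw h
    rw [sub_eq_zero.mp h] at hw
    exact Set.disjoint_left.mp (disjoint_rectContour_openRect ha hH) hw hz
  have hinv : ContinuousOn (fun w => (w - z)⁻¹) (rectContour ha hH).carrier :=
    ContinuousOn.inv₀ (by fun_prop) hne
  have hzim : |z.im| < 2 * π := hz.2.trans hH2
  have h0 : (rectContour ha hH).eval (dslope bchG z) = 0 := by
    refine rectContour_eval_eq_zero ha hH (Set.countable_singleton z) (fun w hw => ?_)
      (fun w hw hwz => ?_)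
    · by_cases h : w = z
      · rw [h, continuousAt_dslope_same]
        exact differentiableAt_bchG_of_abs_im_lt hzim
      · rw [continuousAt_dslope_of_ne h]
        exact (differentiableAt_bchG_of_abs_im_lt (hw.trans_lt hH2)).continuousAt
    · rw [differentiableAt_dslope_of_ne hwz]
      exact differentiableAt_bchG_of_abs_im_lt (hw.trans hH2)
  have h1 : ∀ w ∈ (rectContour ha hH).carrier,
      dslope bchG z w = bchG w • (w - z)⁻¹ - bchG z • (w - z)⁻¹ := by
    intro w hw
    rw [dslope_of_ne _ (sub_ne_zero.mp (hne w hw)), slope_def_field, smul_eq_mul, smul_eq_mul]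
    ring
  have h2 : ContinuousOn (fun w => bchG w • (w - z)⁻¹) (rectContour ha hH).carrier :=
    (continuousOn_bchG ha hH hH2).smul hinv
  have h3 : ContinuousOn (fun w => bchG z • (w - z)⁻¹) (rectContour ha hH).carrier :=
    continuousOn_const (c := bchG z) |>.smul hinv
  rw [(rectContour ha hH).eval_congr h1, (rectContour ha hH).eval_sub h2 h3,
    (rectContour ha hH).eval_smul _ hinv, rectContour_eval_inv_sub ha hH hz, sub_eq_zero,
    smul_eq_mul, mul_one] at h0
  rw [bchContour_eval, h0]

theorem norm_bchG {z : ℂ} (hz : z ≠ 0) : ‖bchG z‖ = ‖z‖ / ‖1 - Complex.exp (-z)‖ := by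
  rw [bchG, if_neg hz, norm_div]

/-- The distance of the ray with argument `θ` from the point `1`. -/
theorem le_norm_one_sub_mul_exp (θ : ℝ) {u : ℝ} (hu : 0 ≤ u) :
    (if 0 < Real.cos θ then |Real.sin θ| else 1) ≤ ‖(1 : ℂ) - u * Complex.exp (θ * I)‖ := by
  have h : ‖(1 : ℂ) - u * Complex.exp (θ * I)‖ ^ 2 =
      (1 - u * Real.cos θ) ^ 2 + (u * Real.sin θ) ^ 2 := by
    rw [Complex.exp_mul_I, ← Complex.ofReal_cos, ← Complex.ofReal_sin, ← Complex.normSq_eq_norm_sq,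
      Complex.normSq_apply]
    simp only [sub_re, one_re, mul_re, ofReal_re, add_re, I_re, mul_zero, ofReal_im, I_im, mul_one,
      sub_self, add_zero, add_im, mul_im, zero_mul, sub_zero, zero_add, sub_im, one_im]
    ring
  have hsc := Real.sin_sq_add_cos_sq θ
  split_ifs with hc
  · refine abs_le_of_sq_le_sq ?_ (norm_nonneg _)
    rw [h]
    nlinarith [sq_nonneg (u - Real.cos θ)]
  · refine le_of_sq_le_sq ?_ (norm_nonneg _)
    rw [h]
    push Not at hc
    nlinarith [mul_nonneg hu (neg_nonneg.mpr hc), sq_nonneg u]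

/-- On a horizontal line the values of `e^{-z}` lie on a ray, whose distance from `1` is bounded below. -/
theorem norm_one_sub_exp_neg_ge_of_im {z : ℂ} (hz : |z.im| = H) :
    (if 0 < Real.cos H then |Real.sin H| else 1) ≤ ‖1 - Complex.exp (-z)‖ := by
  have h1 : Complex.exp (-z) = (Real.exp (-z.re) : ℝ) * Complex.exp ((-z.im : ℝ) * I) := by
    rw [Complex.ofReal_exp, ← Complex.exp_add]
    congr 1
    apply Complex.ext <;> simp
  rw [h1]
  have h2 := le_norm_one_sub_mul_exp (-z.im) (Real.exp_pos (-z.re)).le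
  have h3 : |Real.sin z.im| = |Real.sin H| := by
    rcases abs_choice z.im with h | h
    · rw [← hz, h]
    · rw [← hz, h, Real.sin_neg, abs_neg]
  rwa [Real.cos_neg, Real.sin_neg, abs_neg, ← Real.cos_abs, hz, h3] at h2

/-- On the contour `|z|` is at most `√(a² + H²)`. The bound for `1 / |1 - e^{-z}|` gives the hyperbolic
cotangent on the two vertical sides together and the denominator with the sine on the horizontal
ones. -/
theorem bchContour_mass_le (hs : 0 < if 0 < Real.cos H then |Real.sin H| else 1) :
    (bchContour ha hH hH2).mass ≤ 2 / π * √(a ^ 2 + H ^ 2) *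
      (H / 2 * (Real.cosh (a / 2) / Real.sinh (a / 2)) +
        a / (if 0 < Real.cos H then |Real.sin H| else 1)) := by
  set s := (if 0 < Real.cos H then |Real.sin H| else 1) with hsdef
  set m := √(a ^ 2 + H ^ 2) with hm
  have hpi := Real.pi_pos
  have hm0 : 0 ≤ m := Real.sqrt_nonneg _
  have hwt : ∀ i t, ‖(bchContour ha hH hH2).wt i t‖ =
      (2 * π)⁻¹ * ‖bchG ((rectContour ha hH).pt i t)‖ := by
    intro i t
    change ‖(rectContour ha hH).wt i t * bchG ((rectContour ha hH).pt i t)‖ = _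
    rw [norm_mul]
    congr 1
    change ‖(2 * π * I : ℂ)⁻¹ * ![1, -1, I, -I] i‖ = _
    fin_cases i <;> simp [abs_of_pos hpi]
  have hzm : ∀ z ∈ (rectContour ha hH).carrier, ‖z‖ ≤ m := by
    intro z hz
    rw [← Complex.re_add_im z, Complex.norm_add_mul_I, hm]
    apply Real.sqrt_le_sqrt
    rw [← sq_abs z.re, ← sq_abs z.im]
    rcases rectContour_cases ha hH hz with h | h
    · rw [h.2]
      nlinarith [abs_nonneg z.re, h.1]
    · rw [h.1]
      nlinarith [abs_nonneg z.im, h.2]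
  have hside : ∀ i (d : ℝ), 0 < d → (∀ t ∈ Set.Icc ((rectContour ha hH).lo i)
      ((rectContour ha hH).hi i), d ≤ ‖1 - Complex.exp (-(rectContour ha hH).pt i t)‖) →
      ∫ t in (rectContour ha hH).lo i..(rectContour ha hH).hi i, ‖(bchContour ha hH hH2).wt i t‖ ≤
      ((rectContour ha hH).hi i - (rectContour ha hH).lo i) * ((2 * π)⁻¹ * (m / d)) := by
    intro i d hd hi
    have h1 := intervalIntegral.integral_mono_on (μ := volume) ((rectContour ha hH).le i)
      (((bchContour ha hH hH2).continuous_wt i).norm.intervalIntegrable _ _)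
      (continuous_const.intervalIntegrable _ _) (g := fun _ => (2 * π)⁻¹ * (m / d)) fun t ht => by
        have hz := (rectContour ha hH).pt_mem ht
        rw [hwt, norm_bchG (ne_zero_of_mem_rectContour ha hH hz)]
        have := hzm _ hz
        have := hi t ht
        gcongr
    rwa [intervalIntegral.integral_const, smul_eq_mul] at h1
  have hr : ∀ z : ℂ, |1 - Real.exp (-z.re)| ≤ ‖1 - Complex.exp (-z)‖ := by
    intro z
    have := abs_norm_sub_norm_le 1 (Complex.exp (-z))
    rwa [norm_one, Complex.norm_exp, neg_re] at this
  have he1 : Real.exp (-a) < 1 := by rw [Real.exp_lt_one_iff]; linarith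
  have he2 : 1 < Real.exp a := Real.one_lt_exp_iff.mpr ha
  have h0 := hside 0 s hs fun t _ =>
    norm_one_sub_exp_neg_ge_of_im (z := t + (-H : ℝ) * I) (by simp [abs_of_pos hH])
  have h1 := hside 1 s hs fun t _ =>
    norm_one_sub_exp_neg_ge_of_im (z := t + H * I) (by simp [abs_of_pos hH])
  have h2 := hside 2 (1 - Real.exp (-a)) (by linarith) fun t _ => by
    have := hr (a + t * I)
    simp only [add_re, ofReal_re, mul_re, ofReal_im, I_re, I_im, mul_zero, zero_mul, sub_zero,
      add_zero] at this
    rw [abs_of_pos (by linarith)] at this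
    exact this
  have h3 := hside 3 (Real.exp a - 1) (by linarith) fun t _ => by
    have := hr ((-a : ℝ) + t * I)
    simp only [add_re, ofReal_re, mul_re, ofReal_im, I_re, I_im, mul_zero, zero_mul, sub_zero,
      add_zero, neg_neg] at this
    rw [abs_of_neg (by linarith), neg_sub] at this
    exact this
  have hcoth : Real.cosh (a / 2) / Real.sinh (a / 2) =
      1 / (1 - Real.exp (-a)) + 1 / (Real.exp a - 1) := by
    have ha2 : Real.exp a = Real.exp (a / 2) ^ 2 := by rw [← Real.exp_nat_mul]; congr 1; push_cast; ring
    have hx : 1 < Real.exp (a / 2) := Real.one_lt_exp_iff.mpr (by linarith)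
    rw [Real.cosh_eq, Real.sinh_eq, Real.exp_neg, Real.exp_neg, ha2]
    generalize Real.exp (a / 2) = x at hx
    have hx1 : x ^ 2 - 1 ≠ 0 := by nlinarith
    have hx0 : x ≠ 0 := by linarith
    have e1 : x - x⁻¹ = (x ^ 2 - 1) / x := by field_simp
    have e2 : 1 - (x ^ 2)⁻¹ = (x ^ 2 - 1) / x ^ 2 := by field_simp
    rw [e1, e2]
    field_simp
  rw [WeightedContour.mass, Fin.sum_univ_four, hcoth]
  refine (add_le_add (add_le_add (add_le_add h0 h1) h2) h3).trans (le_of_eq ?_)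
  change (a - -a) * _ + (a - -a) * _ + (H - -H) * _ + (H - -H) * _ = _
  have hd1 : 1 - Real.exp (-a) ≠ 0 := by linarith
  have hd2 : Real.exp a - 1 ≠ 0 := by linarith
  field_simp
  ring

variable {A : Type*} [NormedRing A] [NormedAlgebra ℂ A] [CompleteSpace A] [FiniteDimensional ℂ A]

theorem disjoint_bchContour {b : A} (hb : spectrum ℂ b ⊆ openRect a H) :
    Disjoint (bchContour ha hH hH2).carrier (spectrum ℂ b) :=
  (disjoint_rectContour_openRect ha hH).mono_right hb

theorem isPrimaryFunction_bchG {b : A} (hb : spectrum ℂ b ⊆ openRect a H) :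
    IsPrimaryFunction bchG b ((bchContour ha hH hH2).resInt b) := by
  refine isPrimaryFunction_resInt _ (disjoint_bchContour ha hH hH2 hb)
    (fun x hx => analyticAt_bchG ((hb hx).2.trans hH2)) fun x hx => ?_
  have h1 : ∀ᶠ z : ℂ in 𝓝 x, |z.re| < a :=
    (continuous_abs.comp Complex.continuous_re).tendsto x |>.eventually_lt_const (hb hx).1
  have h2 : ∀ᶠ z : ℂ in 𝓝 x, |z.im| < H :=
    (continuous_abs.comp Complex.continuous_im).tendsto x |>.eventually_lt_const (hb hx).2
  filter_upwards [h1, h2] with z hz1 hz2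
  exact (bchContour_eval_inv_sub ha hH hH2 ⟨hz1, hz2⟩).symm

/-- The operator `bchG b` inverts `∫₀¹ e^{-ub} du = (1 - e^{-b}) / b`. The integrals of
`bchG z e^{-uz}` and `bchG z e^{-uz} / z` against the resolvent satisfy first order differential
equations in `u`. -/
theorem bchG_mul_integral_exp {b : A} (hb : spectrum ℂ b ⊆ openRect a H) :
    (bchContour ha hH hH2).resInt b * ∫ u in (0 : ℝ)..1, NormedSpace.exp (-((u : ℂ) • b)) = 1 := by
  simp only [Complex.coe_smul]
  set C := rectContour ha hH with hC
  set G := (bchContour ha hH hH2).resInt b with hG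
  have hd : Disjoint C.carrier (spectrum ℂ b) := disjoint_bchContour ha hH hH2 hb
  have hR := C.continuousOn_resolvent hd
  have hg : ContinuousOn bchG C.carrier := continuousOn_bchG ha hH hH2
  have hgR : ContinuousOn (fun z => bchG z • resolvent b z) C.carrier := hg.smul hR
  have hne : ∀ z ∈ C.carrier, z ≠ 0 := fun z hz => ne_zero_of_mem_rectContour ha hH hz
  have hkR : ContinuousOn (fun z => z⁻¹ • bchG z • resolvent b z) C.carrier :=
    (ContinuousOn.inv₀ continuousOn_id hne).smul hgR
  set P : ℝ → A := fun u => C.eval fun z => Complex.exp (-(u * z)) • bchG z • resolvent b z with hP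
  set Q : ℝ → A := fun u => C.eval fun z =>
    Complex.exp (-(u * z)) • z⁻¹ • bchG z • resolvent b z with hQ
  have hPd : ∀ u, HasDerivAt P (-(b * P u)) u := by
    intro u
    refine (C.hasDerivAt_eval_exp hgR u).congr_deriv ?_
    have he : ContinuousOn (fun z => Complex.exp (-(u * z))) C.carrier :=
      (by fun_prop : Continuous fun z : ℂ => Complex.exp (-(u * z))).continuousOn
    have hfR : ContinuousOn (fun z => Complex.exp (-(u * z)) • bchG z • resolvent b z) C.carrier :=
      he.smul hgR
    have h1 := C.eval_clm (-(ContinuousLinearMap.mul ℂ A b)) hfR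
    simp only [neg_apply, ContinuousLinearMap.mul_apply'] at h1
    have h2 : C.eval (fun z => (Complex.exp (-(u * z)) * bchG z) • (1 : A)) = 0 := by
      refine rectContour_eval_eq_zero ha hH Set.countable_empty (fun z hz => ?_) (fun z hz _ => ?_)
      · have := (differentiableAt_bchG_of_abs_im_lt (hz.trans_lt hH2)).continuousAt
        have h3 : ContinuousAt (fun z => Complex.exp (-(u * z)) * bchG z) z :=
          ContinuousAt.mul (by fun_prop) this
        exact h3.smul continuousAt_const
      · have := differentiableAt_bchG_of_abs_im_lt (hz.trans hH2)
        have h3 : DifferentiableAt ℂ (fun z => Complex.exp (-(u * z)) * bchG z) z :=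
          DifferentiableAt.mul (by fun_prop) this
        exact h3.smul_const _
    have h3 : ContinuousOn (fun z => (Complex.exp (-(u * z)) * bchG z) • (1 : A)) C.carrier :=
      (he.mul hg).smul continuousOn_const
    rw [hP]
    simp only
    rw [← h1, ← sub_zero (C.eval fun z => -(b * _)), ← h2, ← C.eval_sub _ h3]
    · refine C.eval_congr fun z hz => ?_
      have h4 := smul_resolvent (Set.disjoint_left.mp hd hz)
      simp only [mul_smul_comm]
      rw [← sub_eq_iff_eq_add] at h4
      rw [← h4, smul_sub, smul_sub]
      simp only [smul_smul]
      rw [neg_sub, sub_sub_cancel_left, ← neg_smul]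
      congr 1; ring
    · have h5 := continuousOn_const (c := b) |>.mul hfR
      exact h5.neg
  have hQd : ∀ u, HasDerivAt Q (-P u) u := by
    intro u
    refine (C.hasDerivAt_eval_exp hkR u).congr_deriv ?_
    have he : ContinuousOn (fun z => Complex.exp (-(u * z))) C.carrier :=
      (by fun_prop : Continuous fun z : ℂ => Complex.exp (-(u * z))).continuousOn
    have h1 : ContinuousOn (fun z => Complex.exp (-(u * z)) • bchG z • resolvent b z) C.carrier :=
      he.smul hgR
    rw [hP, ← neg_one_smul ℂ]
    simp only
    rw [← C.eval_smul (-1) h1]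
    refine C.eval_congr fun z hz => ?_
    simp only [smul_smul]
    congr 1
    have := hne z hz
    field_simp
  have hP0 : P 0 = G := by
    rw [hG, WeightedContour.resInt, bchContour_eval, hP]
    simp [hC]
  have hPe : ∀ u, P u = NormedSpace.exp (-(u • b)) * G := by
    intro u
    have h1 : ∀ u, HasDerivAt (fun u => NormedSpace.exp (u • b) * P u) 0 u := fun u => by
      refine ((hasDerivAt_exp_smul b u).mul (hPd u)).congr_deriv ?_
      have : Commute b (NormedSpace.exp (u • b)) :=
        commute_exp_right ((Commute.refl b).smul_right u)
      rw [mul_neg, ← mul_assoc, this.eq, add_neg_cancel]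
    have h2 := is_const_of_deriv_eq_zero (fun u => (h1 u).differentiableAt)
      (fun u => (h1 u).deriv) u 0
    simp only [zero_smul, NormedSpace.exp_zero, one_mul] at h2
    rw [← hP0, ← h2, ← mul_assoc, exp_neg_mul_exp, one_mul]
  have hQ01 : Q 0 - Q 1 = 1 := by
    have he : ∀ u : ℝ, ContinuousOn (fun z => Complex.exp (-(u * z))) C.carrier := fun u =>
      (by fun_prop : Continuous fun z : ℂ => Complex.exp (-(u * z))).continuousOn
    rw [hQ]
    simp only
    have h3 : ∀ u : ℝ, ContinuousOn
        (fun z => Complex.exp (-(u * z)) • z⁻¹ • bchG z • resolvent b z) C.carrier :=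
      fun u => (he u).smul hkR
    rw [← C.eval_sub (h3 0) (h3 1), ← rectContour_resInt ha hH hb]
    refine C.eval_congr fun z hz => ?_
    have h0 := hne z hz
    have h1 : 1 - Complex.exp (-z) ≠ 0 := sub_ne_zero.mpr (exp_neg_ne_one_of_abs_im_lt h0
      ((abs_im_le_of_mem_rectContour ha hH hz).trans_lt hH2)).symm
    simp only [ofReal_zero, zero_mul, neg_zero, Complex.exp_zero, ofReal_one, one_mul]
    rw [← sub_smul, smul_smul, smul_smul, bchG, if_neg h0]
    rw [show (1 - Complex.exp (-z)) * z⁻¹ * (z / (1 - Complex.exp (-z))) = 1 by field_simp,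
      one_smul]
  have hec : Continuous fun u : ℝ => NormedSpace.exp (-(u • b)) := by
    have := continuous_exp (A := A)
    fun_prop
  have hPc : Continuous P := continuous_iff_continuousAt.mpr fun u => (hPd u).continuousAt
  have hint := intervalIntegral.integral_eq_sub_of_hasDerivAt (a := 0) (b := 1)
    (fun u _ => (hQd u).neg) ((hPc.neg.neg).intervalIntegrable _ _)
  have hcG : ∀ u : ℝ, Commute G (NormedSpace.exp (-(u • b))) := fun u =>
    commute_exp_right (((bchContour ha hH hH2).commute_resInt
      (disjoint_bchContour ha hH hH2 hb) (Commute.refl b)).smul_right u).neg_right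
  have h5 := (ContinuousLinearMap.mul ℂ A G).intervalIntegral_comp_comm
    (hec.intervalIntegrable (μ := volume) 0 1)
  simp only [ContinuousLinearMap.mul_apply'] at h5
  rw [← h5, ← hQ01]
  simp only [Pi.neg_apply, neg_neg, neg_sub_neg] at hint
  rw [← hint]
  refine intervalIntegral.integral_congr fun u _ => ?_
  simp only [hPe, (hcG u).eq]

end BchG

/-! ### The derivative of `log (e^J e^{sB})` -/

section Duhamel

variable {A : Type*} [NormedRing A] [NormedAlgebra ℂ A]

theorem ad_sub (a b : A) : ad (a - b) = ad a - ad b := by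
  ext c
  simp only [ad_apply, sub_apply]
  noncomm_ring

theorem norm_ad_le (a : A) : ‖ad a‖ ≤ 2 * ‖a‖ := by
  refine ContinuousLinearMap.opNorm_le_bound _ (by positivity) fun b => ?_
  rw [ad_apply]
  calc ‖a * b - b * a‖ ≤ ‖a * b‖ + ‖b * a‖ := norm_sub_le _ _
    _ ≤ ‖a‖ * ‖b‖ + ‖b‖ * ‖a‖ := add_le_add (norm_mul_le _ _) (norm_mul_le _ _)
    _ = 2 * ‖a‖ * ‖b‖ := by ring

variable [CompleteSpace A]

/-- Undoing the right side with `e^{u ad a}` gives a function of `u` with derivative zero. -/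
theorem exp_neg_smul_ad_apply (a b : A) (u : ℂ) :
    NormedSpace.exp (-(u • ad a)) b = NormedSpace.exp (-(u • a)) * b * NormedSpace.exp (u • a) := by
  have hc : ∀ u : ℂ, HasDerivAt (fun u : ℂ => NormedSpace.exp (-(u • a)))
      (-(a * NormedSpace.exp (-(u • a)))) u := fun u => by
    simpa [smul_neg] using hasDerivAt_exp_smul_const' (𝕂 := ℂ) (-a) u
  have hd : ∀ u : ℂ, HasDerivAt (fun u : ℂ => NormedSpace.exp (u • ad a)
      (NormedSpace.exp (-(u • a)) * b * NormedSpace.exp (u • a))) 0 u := fun u => by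
    have h1 := hasDerivAt_exp_smul_const (𝕂 := ℂ) (ad a) u
    have h2 := ((hc u).mul_const b).mul (hasDerivAt_exp_smul_const' (𝕂 := ℂ) a u)
    refine (h1.clm_apply h2).congr_deriv ?_
    have hx : Commute a (NormedSpace.exp (u • a)) :=
      commute_exp_right ((Commute.refl a).smul_right u)
    rw [mul_apply_eq_comp, ← map_add, ad_apply]
    convert (NormedSpace.exp (u • ad a)).map_zero using 2
    simp only [Pi.mul_apply]
    rw [hx.eq]
    noncomm_ring
  have h := is_const_of_deriv_eq_zero (fun u => (hd u).differentiableAt)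
    (fun u => (hd u).deriv) u 0
  have h0 : NormedSpace.exp ((0 : ℂ) • ad a) = 1 :=
    (congrArg NormedSpace.exp (zero_smul ℂ (ad a))).trans NormedSpace.exp_zero
  rw [h0, one_apply_eq_self, zero_smul, neg_zero, NormedSpace.exp_zero, one_mul, mul_one] at h
  have h2 := congrArg (NormedSpace.exp (-(u • ad a)) : A →L[ℂ] A) h
  rw [← mul_apply_eq_comp, exp_neg_mul_exp, one_apply_eq_self] at h2
  exact h2.symm

variable [FiniteDimensional ℂ A]

/-- If `e^{Z_t} = a e^{tb}`, then `b = ∫₀¹ e^{-u ad Z} Z' du` by Duhamel's formula, and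
`g(ad Z)` solves this equation for `Z'`. -/
theorem deriv_eq_bchG_ad_apply {a H : ℝ} (ha : 0 < a) (hH : 0 < H) (hH2 : H < 2 * π)
    {Z : ℝ → A} {Z' c b : A} {s : ℝ} (hZ : HasDerivAt Z Z' s)
    (he : ∀ᶠ t in 𝓝 s, NormedSpace.exp (Z t) = c * NormedSpace.exp (t • b))
    (hspec : spectrum ℂ (ad (Z s)) ⊆ openRect a H) :
    Z' = (bchContour ha hH hH2).resInt (ad (Z s)) b := by
  have h1 := hasDerivAt_exp_comp hZ
  have h2 : HasDerivAt (fun t : ℝ => NormedSpace.exp (Z t))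
      (NormedSpace.exp (Z s) * b) s := by
    refine (((hasDerivAt_exp_smul b s).const_mul c).congr_of_eventuallyEq he).congr_deriv ?_
    rw [he.self_of_nhds, mul_assoc, (commute_exp_right ((Commute.refl b).smul_right s)).eq]
  have h3 := h1.unique h2
  have hec : Continuous fun u : ℝ => NormedSpace.exp (-((u : ℂ) • ad (Z s))) := by
    have := continuous_exp (A := A →L[ℂ] A)
    fun_prop
  have h4 : ∫ u in (0 : ℝ)..1, NormedSpace.exp (-((u : ℂ) • ad (Z s))) Z' = b := by
    have h5 := congrArg (NormedSpace.exp (-Z s) * ·) h3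
    beta_reduce at h5
    rw [← mul_assoc (NormedSpace.exp (-Z s)) (NormedSpace.exp (Z s)), exp_neg_mul_exp, one_mul] at h5
    have hc2 : Continuous fun u : ℝ =>
        NormedSpace.exp (u • Z s) * Z' * NormedSpace.exp ((1 - u) • Z s) := by
      have := continuous_exp (A := A)
      fun_prop
    have h6 := (ContinuousLinearMap.mul ℂ A (NormedSpace.exp (-Z s))).intervalIntegral_comp_comm
      (hc2.intervalIntegrable (μ := volume) 0 1)
    simp only [ContinuousLinearMap.mul_apply'] at h6
    rw [← h5, ← h6]
    have h9 := intervalIntegral.integral_comp_sub_left (a := 0) (b := 1)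
      (fun u : ℝ => NormedSpace.exp (-((u : ℂ) • ad (Z s))) Z') 1
    rw [sub_self, sub_zero] at h9
    rw [← h9]
    refine intervalIntegral.integral_congr fun u _ => ?_
    rw [exp_neg_smul_ad_apply, Complex.coe_smul, ← mul_assoc, ← mul_assoc, ← exp_add_of_commute]
    · congr 3
      rw [sub_smul, one_smul]; abel
    · exact ((Commute.refl (Z s)).smul_right u).neg_left
  have h7 := ContinuousLinearMap.intervalIntegral_apply
    (hec.intervalIntegrable (μ := volume) 0 1) Z'
  have h8 := congrArg (fun L : A →L[ℂ] A => L Z') (bchG_mul_integral_exp ha hH hH2 hspec)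
  simp only [mul_apply_eq_comp, one_apply_eq_self] at h8
  rw [← h8, h7, h4]

end Duhamel

/-! ### The second order estimate -/

section Estimate

variable {A : Type*} [NormedRing A] [NormedAlgebra ℂ A] [CompleteSpace A] [FiniteDimensional ℂ A]

theorem spectrum_subset_of_norm_sub_le {a b : A} {U : Set ℂ} {κ δ : ℝ}
    (ha : spectrum ℂ a ⊆ U) (hκ : ∀ z ∉ U, ‖resolvent a z‖ ≤ κ) (hδ : ‖b - a‖ ≤ δ)
    (h : κ * δ < 1) : spectrum ℂ b ⊆ U := fun z hz => by
  by_contra hzU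
  exact notMem_spectrum_of_norm_sub_lt (fun hza => hzU (ha hza)) (hκ z hzU) hδ h hz

/-- The deviation of `log (e^J e^{tb})` from its linearization, in terms of bounds `κ₁` and `κ₂`
for the resolvents of `e^J` and `ad J` outside the slit disc and the rectangle. The derivative of
the deviation is `(g(ad Z) - g(ad J)) b`. -/
theorem norm_log_exp_mul_exp_sub_le [NormOneClass A] {φ ρ : ℝ} (hρ : 0 < ρ) {a H : ℝ}
    (ha : 0 < a) (hH : 0 < H) (hH2 : H < 2 * π) {J b : A} {N β κ₁ κ₂ M t : ℝ}
    (hJ : (logContour φ hρ).resInt (NormedSpace.exp J) = J)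
    (hs₁ : spectrum ℂ (NormedSpace.exp J) ⊆ slitDisc φ ρ)
    (hκ₁ : ∀ z ∉ slitDisc φ ρ, ‖resolvent (NormedSpace.exp J) z‖ ≤ κ₁) (hκ₁0 : 0 ≤ κ₁)
    (hM₁ : (logContour φ hρ).mass ≤ M)
    (hs₂ : spectrum ℂ (ad J) ⊆ openRect a H)
    (hκ₂ : ∀ z ∉ openRect a H, ‖resolvent (ad J) z‖ ≤ κ₂)
    (hM₂ : (bchContour ha hH hH2).mass ≤ M)
    (hN : ‖NormedSpace.exp J‖ ≤ N) (hb : ‖b‖ ≤ β) (ht : 0 ≤ t) {ε δ : ℝ}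
    (hε : ε = N * (t * β * Real.exp (t * β))) (h₁ : κ₁ * ε < 1)
    (hδ : δ = 2 * (M * (κ₁ ^ 2 * ε / (1 - κ₁ * ε)))) (h₂ : κ₂ * δ < 1) :
    spectrum ℂ (NormedSpace.exp J * NormedSpace.exp (t • b)) ⊆ slitDisc φ ρ ∧
    ‖(logContour φ hρ).resInt (NormedSpace.exp J * NormedSpace.exp (t • b)) - J -
        t • (bchContour ha hH hH2).resInt (ad J) b‖ ≤
      M * (κ₂ ^ 2 * δ / (1 - κ₂ * δ)) * β * t := by
  set C₁ := logContour φ hρ with hC₁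
  set C₂ := bchContour ha hH hH2 with hC₂
  set f : ℝ → A := fun s => NormedSpace.exp J * NormedSpace.exp (s • b) with hf
  have hβ0 : 0 ≤ β := (norm_nonneg _).trans hb
  have hN0 : 0 ≤ N := (norm_nonneg _).trans hN
  have hM0 : 0 ≤ M := C₁.mass_nonneg.trans hM₁
  have hε0 : 0 ≤ ε := by rw [hε]; positivity
  have hδ0 : 0 ≤ δ := by
    have := sub_pos.mpr h₁
    rw [hδ]; positivity
  have hout₁ : ∀ z ∈ C₁.carrier, z ∉ slitDisc φ ρ := fun z hz =>
    Set.disjoint_left.mp (disjoint_logContour_slitDisc hρ) hz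
  have hout₂ : ∀ z ∈ C₂.carrier, z ∉ openRect a H := fun z hz =>
    Set.disjoint_left.mp (disjoint_rectContour_openRect ha hH) hz
  have hfε : ∀ s ∈ Set.Icc 0 t, ‖f s - NormedSpace.exp J‖ ≤ ε := by
    intro s hs
    have h1 : f s - NormedSpace.exp J = NormedSpace.exp J * (NormedSpace.exp (s • b) - 1) := by
      rw [hf]; noncomm_ring
    have h2 : ‖s • b‖ ≤ t * β := by
      rw [norm_smul, Real.norm_of_nonneg hs.1]
      exact mul_le_mul hs.2 hb (norm_nonneg _) ht
    rw [h1, hε]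
    refine (norm_mul_le _ _).trans (mul_le_mul hN ((norm_exp_sub_one_le _).trans ?_)
      (norm_nonneg _) hN0)
    gcongr
  have hfd : ∀ s, HasDerivAt f (NormedSpace.exp J * (b * NormedSpace.exp (s • b))) s := fun s =>
    (hasDerivAt_exp_smul b s).const_mul _
  have hfspec : ∀ s, κ₁ * ‖f s - NormedSpace.exp J‖ < 1 → spectrum ℂ (f s) ⊆ slitDisc φ ρ :=
    fun s hs => spectrum_subset_of_norm_sub_le hs₁ hκ₁ le_rfl hs
  have hlt : ∀ s ∈ Set.Icc 0 t, κ₁ * ‖f s - NormedSpace.exp J‖ < 1 := fun s hs =>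
    (mul_le_mul_of_nonneg_left (hfε s hs) hκ₁0).trans_lt h₁
  have hev : ∀ s ∈ Set.Icc 0 t, ∀ᶠ r in 𝓝 s, NormedSpace.exp (C₁.resInt (f r)) = f r := by
    intro s hs
    have hcont : ContinuousAt (fun r => κ₁ * ‖f r - NormedSpace.exp J‖) s :=
      continuousAt_const.mul ((hfd s).continuousAt.sub continuousAt_const).norm
    filter_upwards [hcont.eventually_lt_const (hlt s hs)] with r hr
    exact exp_log hρ (hfspec r hr)
  have hZδ : ∀ s ∈ Set.Icc 0 t, ‖ad (C₁.resInt (f s)) - ad J‖ ≤ δ := by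
    intro s hs
    rw [← ad_sub]
    refine (norm_ad_le _).trans ?_
    rw [hδ]
    refine mul_le_mul_of_nonneg_left ?_ zero_le_two
    have h3 := C₁.norm_resInt_sub_le (disjoint_logContour hρ hs₁)
      (fun z hz => hκ₁ z (hout₁ z hz)) (hfε s hs) h₁
    rw [hJ] at h3
    refine h3.trans (mul_le_mul_of_nonneg_right hM₁ ?_)
    have := sub_pos.mpr h₁
    positivity
  have hadspec : ∀ s ∈ Set.Icc 0 t, spectrum ℂ (ad (C₁.resInt (f s))) ⊆ openRect a H :=
    fun s hs => spectrum_subset_of_norm_sub_le hs₂ hκ₂ (hZδ s hs) h₂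
  have hZd : ∀ s ∈ Set.Icc 0 t,
      HasDerivAt (fun r => C₁.resInt (f r)) (C₂.resInt (ad (C₁.resInt (f s))) b) s := by
    intro s hs
    have h4 := C₁.hasDerivAt_resInt (hfd s) (disjoint_logContour hρ (hfspec s (hlt s hs)))
    exact h4.congr_deriv (deriv_eq_bchG_ad_apply (Z := fun r => C₁.resInt (f r))
      (c := NormedSpace.exp J) ha hH hH2 h4 (hev s hs) (hadspec s hs))
  refine ⟨hfspec t (hlt t ⟨ht, le_rfl⟩), ?_⟩
  have hWd : ∀ s ∈ Set.Icc 0 t, HasDerivWithinAt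
      (fun r : ℝ => C₁.resInt (f r) - r • C₂.resInt (ad J) b)
      (C₂.resInt (ad (C₁.resInt (f s))) b - C₂.resInt (ad J) b) (Set.Icc 0 t) s := by
    intro s hs
    have h5 := (hasDerivAt_id s).smul_const (C₂.resInt (ad J) b)
    simp only [one_smul] at h5
    exact ((hZd s hs).sub h5).hasDerivWithinAt
  have hbound : ∀ s ∈ Set.Ico 0 t, ‖C₂.resInt (ad (C₁.resInt (f s))) b - C₂.resInt (ad J) b‖ ≤
      M * (κ₂ ^ 2 * δ / (1 - κ₂ * δ)) * β := by
    intro s hs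
    have hs' := Set.Ico_subset_Icc_self hs
    have h6 := C₂.norm_resInt_sub_le (disjoint_bchContour ha hH hH2 hs₂)
      (fun z hz => hκ₂ z (hout₂ z hz)) (hZδ s hs') h₂
    rw [← sub_apply]
    have := sub_pos.mpr h₂
    refine (ContinuousLinearMap.le_opNorm _ _).trans (mul_le_mul (h6.trans ?_) hb
      (norm_nonneg _) (by positivity))
    exact mul_le_mul_of_nonneg_right hM₂ (by positivity)
  have h7 := norm_image_sub_le_of_norm_deriv_le_segment' hWd hbound t ⟨ht, le_rfl⟩
  have h8 : f 0 = NormedSpace.exp J := by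
    simp only [hf, zero_smul, NormedSpace.exp_zero, mul_one]
  rw [zero_smul, sub_zero, sub_zero, h8, hJ] at h7
  rwa [sub_right_comm] at h7

end Estimate

/-! ### Norms of Jordan matrices with small superdiagonal entries -/

section Jordan

open scoped Matrix Matrix.Norms.L2Operator

variable {n : Type*} [Fintype n] [DecidableEq n]

theorem norm_entry_le (B : Matrix n n ℂ) (i j : n) : ‖B i j‖ ≤ ‖B‖ := by
  have h := Matrix.l2_opNorm_mulVec B (EuclideanSpace.single j 1)
  have h2 := PiLp.norm_apply_le ((WithLp.toLp 2 (B *ᵥ (EuclideanSpace.single j (1 : ℂ)).ofLp) :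
    EuclideanSpace ℂ n)) i
  simp only [PiLp.ofLp_single, Matrix.mulVec_single_one, Matrix.col_apply] at h2
  rw [PiLp.norm_single, norm_one, mul_one] at h
  exact h2.trans (by simpa using h)

/-- The operator norm of a matrix with entries at most `m` is at most that of the matrix with all
entries equal to `m`. -/
theorem norm_le_card_mul {B : Matrix n n ℂ} {m : ℝ} (hm : 0 ≤ m) (h : ∀ i j, ‖B i j‖ ≤ m) :
    ‖B‖ ≤ Fintype.card n * m := by
  rw [Matrix.cstar_norm_def]
  refine ContinuousLinearMap.opNorm_le_bound _ (by positivity) fun x => ?_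
  refine le_of_sq_le_sq ?_ (by positivity)
  rw [EuclideanSpace.norm_sq_eq, mul_pow, EuclideanSpace.norm_sq_eq]
  have h1 : ∀ i, ‖(Matrix.toEuclideanCLM (n := n) (𝕜 := ℂ) B x) i‖ ^ 2 ≤
      m ^ 2 * (Fintype.card n * ∑ j, ‖x j‖ ^ 2) := by
    intro i
    have h2 : ‖(Matrix.toEuclideanCLM (n := n) (𝕜 := ℂ) B x) i‖ ≤ m * ∑ j, ‖x j‖ := by
      rw [Matrix.ofLp_toEuclideanCLM, Matrix.mulVec, dotProduct, Finset.mul_sum]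
      refine (norm_sum_le _ _).trans (Finset.sum_le_sum fun j _ => ?_)
      rw [norm_mul]
      exact mul_le_mul_of_nonneg_right (h i j) (norm_nonneg _)
    calc _ ≤ (m * ∑ j, ‖x j‖) ^ 2 := by gcongr
      _ ≤ _ := by
        rw [mul_pow]
        exact mul_le_mul_of_nonneg_left sq_sum_le_card_mul_sum_sq (by positivity)
  refine (Finset.sum_le_sum fun i _ => h1 i).trans (le_of_eq ?_)
  rw [Finset.sum_const, Finset.card_univ, nsmul_eq_mul]
  ring

/-- Entrywise multiplication by a matrix. -/
def schurCLM (c : Matrix n n ℂ) : Matrix n n ℂ →L[ℂ] Matrix n n ℂ :=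
  LinearMap.toContinuousLinearMap
    { toFun := fun B => Matrix.of fun i j => c i j * B i j
      map_add' := fun B B' => by ext; simp [mul_add]
      map_smul' := fun z B => by ext; simp [mul_left_comm] }

theorem schurCLM_apply (c B : Matrix n n ℂ) (i j : n) : schurCLM c B i j = c i j * B i j := rfl

theorem norm_schurCLM_le {c : Matrix n n ℂ} {m : ℝ} (hm : 0 ≤ m) (h : ∀ i j, ‖c i j‖ ≤ m) :
    ‖schurCLM c‖ ≤ Fintype.card n * m := by
  refine ContinuousLinearMap.opNorm_le_bound _ (by positivity) fun B => ?_
  rw [mul_assoc]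
  refine norm_le_card_mul (by positivity) fun i j => ?_
  rw [schurCLM_apply, norm_mul]
  exact mul_le_mul (h i j) (norm_entry_le B i j) (norm_nonneg _) hm

theorem ad_diagonal_apply (d : n → ℂ) (B : Matrix n n ℂ) (i j : n) :
    ad (Matrix.diagonal d) B i j = (d i - d j) * B i j := by
  rw [ad_apply, Matrix.sub_apply, Matrix.diagonal_mul, Matrix.mul_diagonal]
  ring

/-- The resolvent of `ad` of a diagonal matrix is a Schur multiplier. -/
theorem resolvent_ad_diagonal {d : n → ℂ} {z : ℂ} {R : ℝ} (hR : 0 < R)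
    (h : ∀ i j, R ≤ ‖z - (d i - d j)‖) : z ∉ spectrum ℂ (ad (Matrix.diagonal d)) ∧
      ‖resolvent (ad (Matrix.diagonal d)) z‖ ≤ Fintype.card n / R := by
  have hne : ∀ i j, z - (d i - d j) ≠ 0 := fun i j h0 => by
    have := h i j
    rw [h0, norm_zero] at this
    linarith
  set S := schurCLM (Matrix.of fun i j => (z - (d i - d j))⁻¹) with hS
  have h1 : (algebraMap ℂ _ z - ad (Matrix.diagonal d)) * S = 1 := by
    ext B i j
    rw [mul_apply_eq_comp, sub_apply, Matrix.sub_apply, ad_diagonal_apply,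
      Algebra.algebraMap_eq_smul_one, smul_apply, one_apply_eq_self,
      one_apply_eq_self, Matrix.smul_apply, smul_eq_mul, ← sub_mul, hS, schurCLM_apply,
      Matrix.of_apply, ← mul_assoc, mul_inv_cancel₀ (hne i j), one_mul]
  have h2 : S * (algebraMap ℂ _ z - ad (Matrix.diagonal d)) = 1 := by
    ext B i j
    rw [mul_apply_eq_comp, hS, schurCLM_apply, sub_apply, Matrix.sub_apply, ad_diagonal_apply,
      Algebra.algebraMap_eq_smul_one, smul_apply, one_apply_eq_self,
      Matrix.smul_apply, smul_eq_mul, ← sub_mul,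
      Matrix.of_apply, ← mul_assoc, inv_mul_cancel₀ (hne i j), one_mul]
  have hz : z ∉ spectrum ℂ (ad (Matrix.diagonal d)) :=
    spectrum.notMem_iff.mpr (isUnit_iff_exists.mpr ⟨S, h1, h2⟩)
  refine ⟨hz, ?_⟩
  rw [resolvent_eq_of_mul_eq_one hz h1, div_eq_mul_inv]
  refine norm_schurCLM_le (by positivity) fun i j => ?_
  rw [Matrix.of_apply, norm_inv]
  exact inv_anti₀ hR (h i j)

theorem resolvent_diagonal {d : n → ℂ} {z : ℂ} {R : ℝ} (hR : 0 < R)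
    (h : ∀ i, R ≤ ‖z - d i‖) : z ∉ spectrum ℂ (Matrix.diagonal d) ∧
      ‖resolvent (Matrix.diagonal d) z‖ ≤ R⁻¹ := by
  have hne : ∀ i, z - d i ≠ 0 := fun i h0 => by
    have := h i
    rw [h0, norm_zero] at this
    linarith
  have h1 : algebraMap ℂ (Matrix n n ℂ) z - Matrix.diagonal d =
      Matrix.diagonal fun i => z - d i := by
    rw [Matrix.algebraMap_eq_diagonal, Matrix.diagonal_sub]; rfl
  have h2 : (algebraMap ℂ _ z - Matrix.diagonal d) *
      Matrix.diagonal (fun i => (z - d i)⁻¹) = 1 := by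
    rw [h1, Matrix.diagonal_mul_diagonal, ← Matrix.diagonal_one]
    congr 1; ext i; exact mul_inv_cancel₀ (hne i)
  have h3 : Matrix.diagonal (fun i => (z - d i)⁻¹) *
      (algebraMap ℂ _ z - Matrix.diagonal d) = 1 := by
    rw [h1, Matrix.diagonal_mul_diagonal, ← Matrix.diagonal_one]
    congr 1; ext i; exact inv_mul_cancel₀ (hne i)
  have hz : z ∉ spectrum ℂ (Matrix.diagonal d) :=
    spectrum.notMem_iff.mpr (isUnit_iff_exists.mpr ⟨_, h2, h3⟩)
  refine ⟨hz, ?_⟩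
  rw [resolvent_eq_of_mul_eq_one hz h2, Matrix.l2_opNorm_diagonal,
    pi_norm_le_iff_of_nonneg (by positivity)]
  intro i
  rw [norm_inv]
  exact inv_anti₀ hR (h i)

variable {D : ℕ} {ν : ℝ} {J : Matrix (Fin D) (Fin D) ℂ}

theorem IsScaledJordan.isUpperTriangular (hJ : IsScaledJordan ν J) {i j : Fin D} (h : j < i) :
    J i j = 0 := by
  by_contra h0
  have := (hJ i j h.ne' h0).1
  have h2 : (j : ℕ) < i := h
  omega

theorem IsScaledJordan.mem_spectrum (hJ : IsScaledJordan ν J) {z : ℂ} :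
    z ∈ spectrum ℂ J ↔ ∃ i, z = J i i := by
  have ht : (algebraMap ℂ _ z - J).BlockTriangular id := by
    intro i j h
    have h' : j < i := h
    rw [Matrix.sub_apply, hJ.isUpperTriangular h', Matrix.algebraMap_matrix_apply, if_neg h'.ne',
      sub_zero]
  rw [spectrum.mem_iff, Matrix.isUnit_iff_isUnit_det, Matrix.det_of_isUpperTriangular ht,
    isUnit_iff_ne_zero, not_not, Finset.prod_eq_zero_iff]
  simp [Matrix.algebraMap_matrix_apply, sub_eq_zero]

/-- The nilpotent part of a scaled Jordan matrix. -/
def nilPart (J : Matrix (Fin D) (Fin D) ℂ) : Matrix (Fin D) (Fin D) ℂ :=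
  J - Matrix.diagonal fun i => J i i

theorem diagonal_add_nilPart (J : Matrix (Fin D) (Fin D) ℂ) :
    Matrix.diagonal (fun i => J i i) + nilPart J = J := by
  rw [nilPart, add_sub_cancel]

theorem nilPart_self (J : Matrix (Fin D) (Fin D) ℂ) (i : Fin D) : nilPart J i i = 0 := by
  simp [nilPart]

theorem nilPart_of_ne (J : Matrix (Fin D) (Fin D) ℂ) {i j : Fin D} (h : i ≠ j) :
    nilPart J i j = J i j := by
  simp [nilPart, h]

theorem IsScaledJordan.nilPart_ne_zero (hJ : IsScaledJordan ν J) {i j : Fin D}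
    (h : nilPart J i j ≠ 0) : (j : ℕ) = i + 1 ∧ nilPart J i j = ν ∧ J i i = J j j := by
  have hij : i ≠ j := by
    rintro rfl
    exact h (nilPart_self J i)
  rw [nilPart_of_ne J hij] at h ⊢
  exact hJ i j hij h

theorem IsScaledJordan.commute (hJ : IsScaledJordan ν J) :
    Commute (Matrix.diagonal fun i => J i i) (nilPart J) := by
  ext i j
  rw [Matrix.diagonal_mul, Matrix.mul_diagonal]
  by_cases h : nilPart J i j = 0
  · rw [h, mul_zero, zero_mul]
  · rw [(hJ.nilPart_ne_zero h).2.2, mul_comm]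

/-- For the nilpotent part `K` the matrix `K Kᴴ` is diagonal. -/
theorem IsScaledJordan.norm_nilPart_le (hJ : IsScaledJordan ν J) (hν : 0 ≤ ν) :
    ‖nilPart J‖ ≤ ν := by
  set K := nilPart J with hK
  have h1 : K * Kᴴ = Matrix.diagonal fun i => ∑ j, K i j * star (K i j) := by
    ext i k
    rw [Matrix.mul_apply]
    by_cases hik : i = k
    · subst hik
      rw [Matrix.diagonal_apply_eq]; rfl
    · rw [Matrix.diagonal_apply_ne _ hik]
      refine Finset.sum_eq_zero fun j _ => ?_
      rw [Matrix.conjTranspose_apply]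
      by_contra h
      obtain ⟨h2, h3⟩ := mul_ne_zero_iff.mp h
      have h4 := (hJ.nilPart_ne_zero h2).1
      have h5 := (hJ.nilPart_ne_zero (star_ne_zero.mp h3)).1
      exact hik (Fin.ext (by omega))
  have h2 : ‖K * Kᴴ‖ ≤ ν * ν := by
    rw [h1, Matrix.l2_opNorm_diagonal, pi_norm_le_iff_of_nonneg (by positivity)]
    intro i
    by_cases h : ∃ j, K i j ≠ 0
    · obtain ⟨j, hj⟩ := h
      obtain ⟨h3, h4, -⟩ := hJ.nilPart_ne_zero hj
      rw [Finset.sum_eq_single j, norm_mul, norm_star, hK, h4, Complex.norm_real,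
        Real.norm_of_nonneg hν]
      · intro k _ hkj
        by_contra h5
        have h6 := (hJ.nilPart_ne_zero (mul_ne_zero_iff.mp h5).1).1
        exact hkj (Fin.ext (by omega))
      · intro h5
        exact absurd (Finset.mem_univ j) h5
    · push Not at h
      simp only [h, zero_mul, Finset.sum_const_zero, norm_zero]
      positivity
  have h3 : ‖K * Kᴴ‖ = ‖K‖ * ‖K‖ := CStarRing.norm_self_mul_star
  rw [h3] at h2
  exact le_of_sq_le_sq (by nlinarith) hν

theorem IsScaledJordan.exp_eq (hJ : IsScaledJordan ν J) : NormedSpace.exp J =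
    Matrix.diagonal (fun i => Complex.exp (J i i)) * NormedSpace.exp (nilPart J) := by
  conv_lhs => rw [← diagonal_add_nilPart J, exp_add_of_commute hJ.commute, Matrix.exp_diagonal]
  congr 2
  ext i
  rw [Pi.coe_exp, Complex.exp_eq_exp_ℂ]

theorem norm_diagonal_exp_le {α : ℝ} (hα : ∀ i, (J i i).re ≤ α) :
    ‖Matrix.diagonal (fun i => Complex.exp (J i i))‖ ≤ Real.exp α := by
  rw [Matrix.l2_opNorm_diagonal, pi_norm_le_iff_of_nonneg (Real.exp_pos α).le]
  intro i
  rw [Complex.norm_exp]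
  exact Real.exp_le_exp.mpr (hα i)

/-- The exponential is `e^Λ e^K`, where `Λ` is the diagonal and `K` the nilpotent part. -/
theorem IsScaledJordan.norm_exp_le [NeZero D] (hJ : IsScaledJordan ν J) (hν : 0 ≤ ν) {α : ℝ}
    (hα : ∀ i, (J i i).re ≤ α) : ‖NormedSpace.exp J‖ ≤ Real.exp (α + ν) := by
  rw [hJ.exp_eq, Real.exp_add]
  refine (norm_mul_le _ _).trans (mul_le_mul (norm_diagonal_exp_le hα)
    ((BCHBound.norm_exp_le _).trans (Real.exp_le_exp.mpr (hJ.norm_nilPart_le hν)))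
    (norm_nonneg _) (Real.exp_pos α).le)

/-- The exponential of `J` differs by at most `R / 2` from the exponential of its diagonal part, whose
resolvent is bounded by `1 / R`. -/
theorem IsScaledJordan.resolvent_exp [NeZero D] (hJ : IsScaledJordan ν J) (hν : 0 ≤ ν) {α R : ℝ}
    (hα : ∀ i, (J i i).re ≤ α) (hR : 0 < R) (hνR : ν * Real.exp (α + ν) ≤ R / 2) {z : ℂ}
    (hz : ∀ i, R ≤ ‖z - Complex.exp (J i i)‖) :
    z ∉ spectrum ℂ (NormedSpace.exp J) ∧ ‖resolvent (NormedSpace.exp J) z‖ ≤ 2 / R := by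
  obtain ⟨h1, h2⟩ := resolvent_diagonal hR hz
  have h3 : ‖NormedSpace.exp J - Matrix.diagonal (fun i => Complex.exp (J i i))‖ ≤ R / 2 := by
    rw [hJ.exp_eq, ← mul_sub_one]
    refine (norm_mul_le _ _).trans ((mul_le_mul (norm_diagonal_exp_le hα)
      (norm_exp_sub_one_le _) (norm_nonneg _) (Real.exp_pos α).le).trans (le_trans ?_ hνR))
    rw [Real.exp_add, mul_left_comm]
    have := hJ.norm_nilPart_le hν
    gcongr
  have h4 : R⁻¹ * (R / 2) < 1 := by
    rw [show R⁻¹ * (R / 2) = 1 / 2 by field_simp]; norm_num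
  refine ⟨notMem_spectrum_of_norm_sub_lt h1 h2 h3 h4,
    (norm_resolvent_le_of_norm_sub_le h1 h2 h3 h4).trans (le_of_eq ?_)⟩
  field_simp; norm_num

/-- The operator `ad J` differs by at most `2ν` from `ad` of the diagonal part of `J`, whose resolvent
is bounded by `D / R`. -/
theorem IsScaledJordan.resolvent_ad (hJ : IsScaledJordan ν J) (hν : 0 ≤ ν) {R : ℝ}
    (hR : 0 < R) (hνR : 2 * (D : ℝ) * ν ≤ R / 2) {z : ℂ}
    (hz : ∀ i j, R ≤ ‖z - (J i i - J j j)‖) :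
    z ∉ spectrum ℂ (ad J) ∧ ‖resolvent (ad J) z‖ ≤ 2 * D / R := by
  obtain ⟨h1, h2⟩ := resolvent_ad_diagonal (d := fun i => J i i) hR hz
  rw [Fintype.card_fin] at h2
  have h3 : ‖ad J - ad (Matrix.diagonal fun i => J i i)‖ ≤ 2 * ν := by
    rw [← ad_sub]
    exact (norm_ad_le _).trans (mul_le_mul_of_nonneg_left (hJ.norm_nilPart_le hν) zero_le_two)
  have h4 : (D : ℝ) / R * (2 * ν) ≤ 1 / 2 := by
    rw [show (D : ℝ) / R * (2 * ν) = 2 * D * ν / R by ring, div_le_iff₀ hR]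
    linarith
  have h5 : (D : ℝ) / R * (2 * ν) < 1 := by linarith
  refine ⟨notMem_spectrum_of_norm_sub_lt h1 h2 h3 h5,
    (norm_resolvent_le_of_norm_sub_le h1 h2 h3 h5).trans ?_⟩
  rw [div_le_iff₀ (by linarith)]
  have h6 : (0 : ℝ) ≤ D / R := by positivity
  have h7 : 2 * (D : ℝ) / R = 2 * (D / R) := by ring
  rw [h7]
  nlinarith

end Jordan

/-! ### The constants in terms of the spectrum -/

section Constants

variable {A : Type*} [NormedRing A] [NormedAlgebra ℂ A] [CompleteSpace A]

theorem norm_le_toReal_spectralRadius {a : A} {x : ℂ} (hx : x ∈ spectrum ℂ a) :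
    ‖x‖ ≤ (spectralRadius ℂ a).toReal := by
  have h1 : (‖x‖₊ : ENNReal) ≤ spectralRadius ℂ a :=
    le_iSup₂ (f := fun k (_ : k ∈ spectrum ℂ a) => (‖k‖₊ : ENNReal)) x hx
  have h2 : spectralRadius ℂ a ≠ ⊤ := by
    refine ne_top_of_le_ne_top (b := ((‖a‖₊ * ‖(1 : A)‖₊ : NNReal) : ENNReal))
      ENNReal.coe_ne_top (iSup₂_le fun k hk => ?_)
    exact_mod_cast spectrum.norm_le_norm_mul_of_mem hk
  simpa using ENNReal.toReal_mono h2 h1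

theorem gapOne_le {a : A} {x : ℂ} (hx : x ∈ spectrum ℂ a) (φ : ℝ) {y : ℝ} (hy : 0 ≤ y) :
    gapOne φ a ≤ ‖Complex.exp x - y * Complex.exp (φ * I)‖ := by
  have h1 : ∀ x : spectrum ℂ a, BddBelow (Set.range fun y : Set.Ici (0 : ℝ) =>
      ‖Complex.exp (x : ℂ) - ((y : ℝ) : ℂ) * Complex.exp ((φ : ℂ) * I)‖) := fun x =>
    ⟨0, by rintro _ ⟨y, rfl⟩; exact norm_nonneg _⟩
  have h2 : BddBelow (Set.range fun x : spectrum ℂ a => ⨅ y : Set.Ici (0 : ℝ),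
      ‖Complex.exp (x : ℂ) - ((y : ℝ) : ℂ) * Complex.exp ((φ : ℂ) * I)‖) :=
    ⟨0, by rintro _ ⟨x, rfl⟩; exact Real.iInf_nonneg fun _ => norm_nonneg _⟩
  exact (ciInf_le h2 ⟨x, hx⟩).trans (ciInf_le (h1 ⟨x, hx⟩) ⟨y, hy⟩)

variable [FiniteDimensional ℂ A]

theorem bddAbove_range_spectrum (a : A) (f : spectrum ℂ a → ℝ) : BddAbove (Set.range f) := by
  have := (spectrum_finite a).to_subtype
  exact (Set.finite_range f).bddAbove

theorem im_sub_le_of_mem_spectrum {a : A} {x y : ℂ} (hx : x ∈ spectrum ℂ a)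
    (hy : y ∈ spectrum ℂ a) : (x - y).im ≤ 2 * π - gapTwo a := by
  rw [gapTwo, sub_sub_cancel]
  exact (le_ciSup (bddAbove_range_spectrum a fun y => (x - (y : ℂ)).im) ⟨y, hy⟩).trans
    (le_ciSup (bddAbove_range_spectrum a fun x => ⨆ y : spectrum ℂ a, ((x : ℂ) - (y : ℂ)).im)
      ⟨x, hx⟩)

theorem re_le_maxRe {a : A} {x : ℂ} (hx : x ∈ spectrum ℂ a) : x.re ≤ maxRe a :=
  le_ciSup (bddAbove_range_spectrum a fun x => (x : ℂ).re) ⟨x, hx⟩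

/-- The differences of the points of the spectrum contain the spectrum of `ad`: an eigenspace of
`ad a` contains an eigenvector of left multiplication by `a`. -/
theorem spectrum_ad_subset {a : A} {z : ℂ} (hz : z ∈ spectrum ℂ (ad a)) :
    ∃ x ∈ spectrum ℂ a, ∃ y ∈ spectrum ℂ a, z = x - y := by
  obtain ⟨F, hF, h⟩ := exists_mul_eq_smul hz
  obtain ⟨b, hb⟩ : ∃ b, F b ≠ 0 := by
    by_contra! h0
    exact hF (ContinuousLinearMap.ext h0)
  have h1 : ad a (F b) = z • F b := by
    rw [← mul_apply_eq_comp, h, smul_apply]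
  have hc : Commute (Algebra.lmul ℂ A a) ((ad a : A →L[ℂ] A) : Module.End ℂ A) := by
    ext c
    change a * ad a c = ad a (a * c)
    rw [ad_apply, ad_apply]
    noncomm_ring
  obtain ⟨w, hw, x, h2, h3⟩ := exists_joint_eigenvector hc hb h1
  have h2' : a * w = x • w := h2
  have h3' : a * w - w * a = z • w := by rw [← ad_apply]; exact h3
  refine ⟨x, mem_spectrum_of_mul_eq_smul hw h2', x - z,
    mem_spectrum_of_mul_eq_smul_right hw ?_, by ring⟩
  rw [sub_smul, ← h2', ← h3', sub_sub_cancel]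

/-- In terms of the half height `H` of the rectangle, the numbers `2π - δ + R` and `δ - R` in `mG` are
`H` and `2π - H`. -/
theorem bchContour_mass_le_mG {b : A} {R a H : ℝ} (ha : 0 < a) (hH : 0 < H) (hH2 : H < 2 * π)
    (ha' : a = (spectralRadius ℂ b).toReal + R)
    (hH' : H = (⨆ x : spectrum ℂ b, |(x : ℂ).im|) + R) :
    (bchContour ha hH hH2).mass ≤ mG b R := by
  have hs : 0 < if 0 < Real.cos H then |Real.sin H| else 1 := by
    split_ifs with hc
    · refine abs_pos.mpr fun h0 => ?_
      obtain ⟨k, hk⟩ := Real.sin_eq_zero_iff.mp h0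
      have hpi := Real.pi_pos
      have h1 : (0 : ℝ) < k := by nlinarith
      have h2 : (k : ℝ) < 2 := by nlinarith
      have h3 : 0 < k := by exact_mod_cast h1
      have h4 : k < 2 := by exact_mod_cast h2
      have h5 : k = 1 := by omega
      rw [← hk, h5, Int.cast_one, one_mul, Real.cos_pi] at hc
      linarith
    · exact one_pos
  refine (bchContour_mass_le ha hH hH2 hs).trans (le_of_eq ?_)
  rw [mG]
  have e1 : 2 * π - (2 * π - ⨆ x : spectrum ℂ b, |(x : ℂ).im|) + R = H := by rw [hH']; ring
  have e2 : 2 * π - (⨆ x : spectrum ℂ b, |(x : ℂ).im|) - R = 2 * π - H := by rw [hH']; ring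
  simp only [e1, e2, ← ha', Real.cos_two_pi_sub, Real.sin_two_pi_sub, abs_neg]

end Constants

/-! ### The estimate for Jordan matrices -/

section Matrix

open scoped Matrix Matrix.Norms.L2Operator

/-- Differences of eigenvalues are eigenvalues of `ad`. -/
theorem sub_mem_spectrum_ad {n : Type*} [Fintype n] [DecidableEq n] {J : Matrix n n ℂ} {x y : ℂ}
    (hx : x ∈ spectrum ℂ J) (hy : y ∈ spectrum ℂ J) : x - y ∈ spectrum ℂ (ad J) := by
  obtain ⟨V, hV, h1⟩ := exists_mul_eq_smul hx
  have hy' : y ∈ spectrum ℂ Jᵀ := by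
    rw [spectrum.mem_iff, ← Matrix.isUnit_transpose, Matrix.transpose_sub,
      Matrix.transpose_transpose, Matrix.algebraMap_eq_diagonal, Matrix.diagonal_transpose,
      ← Matrix.algebraMap_eq_diagonal]
    exact hy
  obtain ⟨U, hU, h2⟩ := exists_mul_eq_smul hy'
  have h3 : Uᵀ * J = y • Uᵀ := by
    rw [← Matrix.transpose_smul, ← h2, Matrix.transpose_mul, Matrix.transpose_transpose]
  obtain ⟨i, k, hik⟩ : ∃ i k, V i k ≠ 0 := by
    by_contra! h; exact hV (Matrix.ext h)
  obtain ⟨j, l, hjl⟩ : ∃ j l, U j l ≠ 0 := by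
    by_contra! h; exact hU (Matrix.ext h)
  set S : Matrix n n ℂ := V * Matrix.single k l 1 * Uᵀ with hS
  have hS0 : S ≠ 0 := by
    intro h
    have := congrFun (congrFun h i) j
    rw [hS, Matrix.mul_assoc, Matrix.mul_apply, Finset.sum_eq_single k] at this
    · rw [Matrix.single_mul_apply_same, one_mul, Matrix.transpose_apply] at this
      exact mul_ne_zero hik hjl this
    · intro m _ hm
      rw [Matrix.single_mul_apply_of_ne _ _ _ _ _ hm, mul_zero]
    · simp
  have h4 : ad J S = (x - y) • S := by
    rw [ad_apply, hS, sub_smul]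
    congr 1
    · rw [← Matrix.mul_assoc, ← Matrix.mul_assoc, h1, Matrix.smul_mul, Matrix.smul_mul]
    · rw [Matrix.mul_assoc, h3, Matrix.mul_smul]
  refine mem_spectrum_of_mul_eq_smul (v := ContinuousLinearMap.toSpanSingleton ℂ S ∘L
    LinearMap.toContinuousLinearMap (Matrix.entryLinearMap ℂ ℂ i i)) ?_ ?_
  · intro h0
    apply hS0
    have := congrArg (fun L => L (1 : Matrix n n ℂ)) h0
    simpa using this
  · ext1 B
    simp only [mul_apply_eq_comp, ContinuousLinearMap.comp_apply,
      ContinuousLinearMap.toSpanSingleton_apply, map_smul, h4, smul_apply]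
    rw [smul_comm]

/-- The bound of `norm_log_exp_mul_exp_sub_le` with `κ₁ = 2 / R` and `κ₂ = 2 D / R`. Its two smallness
conditions combine into one. -/
theorem second_order_constant_eq {M D R ε β t : ℝ} (hM : 0 ≤ M) (hD : 0 ≤ D) (hR : 0 < R)
    (hε : 0 ≤ ε) (h : (1 + 8 * M * D / R ^ 2) * (2 * ε / R) < 1) {δ : ℝ}
    (hδ : δ = 2 * (M * ((2 / R) ^ 2 * ε / (1 - 2 / R * ε)))) :
    2 / R * ε < 1 ∧ 2 * D / R * δ < 1 ∧
    M * ((2 * D / R) ^ 2 * δ / (1 - 2 * D / R * δ)) * β * t =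
      32 * M ^ 2 * D ^ 2 * ε / R ^ 4 * β * t /
        (1 - (1 + 8 * M * D / R ^ 2) * (2 * ε / R)) := by
  have h0 : 0 ≤ 8 * M * D / R ^ 2 * (2 * ε / R) := by positivity
  have h1 : 2 / R * ε < 1 := by
    have : 2 / R * ε = 2 * ε / R := by ring
    rw [this]; linarith
  have h1' : 0 < 1 - 2 / R * ε := by linarith
  have h2 : 1 - 2 * D / R * δ =
      (1 - (1 + 8 * M * D / R ^ 2) * (2 * ε / R)) / (1 - 2 / R * ε) := by
    rw [eq_div_iff h1'.ne', sub_mul, hδ]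
    have : 2 * D / R * (2 * (M * ((2 / R) ^ 2 * ε / (1 - 2 / R * ε)))) * (1 - 2 / R * ε) =
        2 * D / R * (2 * (M * ((2 / R) ^ 2 * ε))) := by
      generalize 1 - 2 / R * ε = v at h1'
      field_simp
    rw [this]
    field_simp
    ring
  have h3 : 0 < 1 - (1 + 8 * M * D / R ^ 2) * (2 * ε / R) := by linarith
  refine ⟨h1, ?_, ?_⟩
  · have : 0 < 1 - 2 * D / R * δ := h2 ▸ div_pos h3 h1'
    linarith
  · rw [h2, hδ]
    generalize 1 - (1 + 8 * M * D / R ^ 2) * (2 * ε / R) = u at h3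
    generalize 1 - 2 / R * ε = v at h1'
    field_simp
    ring

/-- The expansion of `log (e^J e^{tb})` for a scaled Jordan matrix `J`. -/
theorem IsScaledJordan.exists_log_exp_mul_exp {D : ℕ} [NeZero D] {ν : ℝ}
    {J : Matrix (Fin D) (Fin D) ℂ} (hJ : IsScaledJordan ν J) (hν : 0 ≤ ν) {φ R M α : ℝ}
    (hstrip : ∀ x ∈ spectrum ℂ J, φ < x.im ∧ x.im < φ + 2 * π) (hR : 0 < R)
    (hR₁ : R < gapOne φ J) (hR₂ : R < gapTwo J) (hM₁ : mLog φ (NormedSpace.exp J) R ≤ M)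
    (hM₂ : mG (ad J) R ≤ M) (hα : maxRe J ≤ α) (hν₁ : ν * Real.exp (α + ν) ≤ R / 2)
    (hν₂ : 2 * (D : ℝ) * ν ≤ R / 2) :
    0 ≤ M ∧ IsPrimaryFunction (logBranch φ) (NormedSpace.exp J) J ∧
    ∃ G, IsPrimaryFunction bchG (ad J) G ∧
      ∀ (b : Matrix (Fin D) (Fin D) ℂ) (β t : ℝ), ‖b‖ ≤ β → 0 ≤ t →
        (1 + 8 * M * D / R ^ 2) *
          (2 * (Real.exp (α + ν) * (t * β * Real.exp (t * β))) / R) < 1 →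
        ∃ Z, IsPrimaryFunction (logBranch φ)
            (NormedSpace.exp J * NormedSpace.exp ((t : ℂ) • b)) Z ∧
          ‖Z - J - (t : ℂ) • G b‖ ≤
            32 * M ^ 2 * (D : ℝ) ^ 2 * (Real.exp (α + ν) * (t * β * Real.exp (t * β))) / R ^ 4 *
              β * t / (1 - (1 + 8 * M * D / R ^ 2) *
                (2 * (Real.exp (α + ν) * (t * β * Real.exp (t * β))) / R)) := by
  have hdiag : ∀ i, J i i ∈ spectrum ℂ J := fun i => hJ.mem_spectrum.mpr ⟨i, rfl⟩
  have hre : ∀ i, (J i i).re ≤ α := fun i => (re_le_maxRe (hdiag i)).trans hα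
  -- The logarithm is evaluated on the slit disc whose radius exceeds the spectral radius by `R`.
  set ρ := (spectralRadius ℂ (NormedSpace.exp J)).toReal + R with hρdef
  have hρ : 0 < ρ := by
    have : 0 ≤ (spectralRadius ℂ (NormedSpace.exp J)).toReal := ENNReal.toReal_nonneg
    linarith
  have hexp : ∀ x ∈ spectrum ℂ J,
      ‖Complex.exp x‖ ≤ (spectralRadius ℂ (NormedSpace.exp J)).toReal := by
    intro x hx
    have := spectrum.exp_mem_exp J hx
    rw [← Complex.exp_eq_exp_ℂ] at this
    exact norm_le_toReal_spectralRadius this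
  have hfar₁ : ∀ z ∉ slitDisc φ ρ, ∀ i, R ≤ ‖z - Complex.exp (J i i)‖ := by
    intro z hz i
    by_cases h : ‖z‖ < ρ
    · have h2 : ∃ y : ℝ, 0 ≤ y ∧ z = y * Complex.exp (φ * I) := by
        by_contra! h2
        exact hz ⟨h, h2⟩
      obtain ⟨y, hy, rfl⟩ := h2
      rw [norm_sub_rev]
      exact hR₁.le.trans (gapOne_le (hdiag i) φ hy)
    · have h3 := norm_sub_norm_le z (Complex.exp (J i i))
      have h4 := hexp _ (hdiag i)
      linarith
  have hres₁ := fun z hz => hJ.resolvent_exp hν hre hR hν₁ (hfar₁ z hz)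
  have hs₁ : spectrum ℂ (NormedSpace.exp J) ⊆ slitDisc φ ρ := fun z hz => by
    by_contra h
    exact (hres₁ z h).1 hz
  have hmass₁ : (logContour φ hρ).mass ≤ M := (logContour_mass_le hρ).trans hM₁
  have hlog : (logContour φ hρ).resInt (NormedSpace.exp J) = J := by
    refine log_exp hρ hstrip fun x hx => ?_
    have := hexp x hx
    rw [Complex.norm_exp] at this
    linarith
  -- The function `g` is evaluated on a rectangle at distance `R` from the spectrum of `ad J`.
  set a := (spectralRadius ℂ (ad J)).toReal + R with hadef
  have ha : 0 < a := by
    have : 0 ≤ (spectralRadius ℂ (ad J)).toReal := ENNReal.toReal_nonneg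
    linarith
  set H := (⨆ x : spectrum ℂ (ad J), |(x : ℂ).im|) + R with hHdef
  have hH : 0 < H := by
    have : 0 ≤ ⨆ x : spectrum ℂ (ad J), |(x : ℂ).im| := Real.iSup_nonneg fun _ => abs_nonneg _
    linarith
  have hH2 : H < 2 * π := by
    have h0 : (0 : ℝ) ≤ 2 * π - gapTwo J := by
      simpa using im_sub_le_of_mem_spectrum (hdiag 0) (hdiag 0)
    have : ⨆ x : spectrum ℂ (ad J), |(x : ℂ).im| ≤ 2 * π - gapTwo J := by
      refine Real.iSup_le (fun ⟨z, hz⟩ => ?_) h0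
      obtain ⟨x, hx, y, hy, rfl⟩ := spectrum_ad_subset hz
      refine abs_le'.mpr ⟨im_sub_le_of_mem_spectrum hx hy, ?_⟩
      have := im_sub_le_of_mem_spectrum hy hx
      rwa [← neg_sub, Complex.neg_im] at this
    linarith
  have hfar₂ : ∀ z ∉ openRect a H, ∀ i j, R ≤ ‖z - (J i i - J j j)‖ := by
    intro z hz i j
    have hm := sub_mem_spectrum_ad (hdiag i) (hdiag j)
    set d := J i i - J j j with hd
    have h1 : |d.re| ≤ (spectralRadius ℂ (ad J)).toReal :=
      (Complex.abs_re_le_norm d).trans (norm_le_toReal_spectralRadius hm)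
    have h2 : |d.im| ≤ ⨆ x : spectrum ℂ (ad J), |(x : ℂ).im| :=
      le_ciSup (bddAbove_range_spectrum (ad J) fun x => |(x : ℂ).im|) ⟨d, hm⟩
    by_cases h : |z.re| < a
    · have h3 : H ≤ |z.im| := by
        by_contra! h3
        exact hz ⟨h, h3⟩
      have h4 := Complex.abs_im_le_norm (z - d)
      have h5 := abs_sub_abs_le_abs_sub z.im d.im
      rw [Complex.sub_im] at h4
      linarith
    · have h4 := Complex.abs_re_le_norm (z - d)
      have h5 := abs_sub_abs_le_abs_sub z.re d.re
      rw [Complex.sub_re] at h4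
      linarith
  have hres₂ := fun z hz => hJ.resolvent_ad hν hR hν₂ (hfar₂ z hz)
  have hs₂ : spectrum ℂ (ad J) ⊆ openRect a H := fun z hz => by
    by_contra h
    exact (hres₂ z h).1 hz
  have hmass₂ : (bchContour ha hH hH2).mass ≤ M :=
    (bchContour_mass_le_mG ha hH hH2 hadef hHdef).trans hM₂
  have hM0 : 0 ≤ M := (logContour φ hρ).mass_nonneg.trans hmass₁
  refine ⟨hM0, ?_, _, isPrimaryFunction_bchG ha hH hH2 hs₂, ?_⟩
  · have := isPrimaryFunction_log hρ hs₁
    rwa [hlog] at this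
  intro b β t hb ht hq
  have hβ : 0 ≤ β := (norm_nonneg _).trans hb
  obtain ⟨h1, h2, h3⟩ := second_order_constant_eq (β := β) (t := t) hM0 (Nat.cast_nonneg D) hR
    (by positivity) hq rfl
  obtain ⟨h4, h5⟩ := norm_log_exp_mul_exp_sub_le hρ ha hH hH2 hlog hs₁
    (fun z hz => (hres₁ z hz).2) (by positivity) hmass₁ hs₂ (fun z hz => (hres₂ z hz).2) hmass₂
    (hJ.norm_exp_le hν hre) hb ht rfl h1 rfl h2
  rw [h3] at h5
  rw [Complex.coe_smul, Complex.coe_smul]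
  exact ⟨_, isPrimaryFunction_log hρ h4, h5⟩

end Matrix

/-! ### Transport along isomorphisms of algebras -/

section Transport

variable {A B : Type*} [NormedRing A] [NormedAlgebra ℂ A] [NormedRing B] [NormedAlgebra ℂ B]

theorem resolvent_map (Φ : A ≃ₐ[ℂ] B) (a : A) (z : ℂ) :
    resolvent (Φ a) z = Φ (resolvent a z) := by
  by_cases hz : z ∈ spectrum ℂ a
  · rw [spectrum.resolvent_zero_of_mem_spectrum hz, map_zero,
      spectrum.resolvent_zero_of_mem_spectrum (by rwa [AlgEquiv.spectrum_eq Φ a])]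
  · refine resolvent_eq_of_mul_eq_one (by rwa [AlgEquiv.spectrum_eq Φ a]) ?_
    rw [← AlgEquiv.commutes Φ, ← map_sub, ← map_mul, sub_mul_resolvent hz, map_one]

variable [FiniteDimensional ℂ A]

/-- An isomorphism of algebras as a topological isomorphism. -/
def toCLE (Φ : A ≃ₐ[ℂ] B) : A ≃L[ℂ] B :=
  have : FiniteDimensional ℂ B := Φ.toLinearEquiv.finiteDimensional
  Φ.toLinearEquiv.toContinuousLinearEquiv

theorem toCLE_apply (Φ : A ≃ₐ[ℂ] B) (a : A) : toCLE Φ a = Φ a := rfl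

theorem toCLE_symm_apply (Φ : A ≃ₐ[ℂ] B) (b : B) : (toCLE Φ).symm b = Φ.symm b := rfl

/-- An isomorphism of algebras preserves primary functions. -/
theorem IsPrimaryFunction.map (Φ : A ≃ₐ[ℂ] B) {h : ℂ → ℂ} {a b : A}
    (hb : IsPrimaryFunction h a b) : IsPrimaryFunction h (Φ a) (Φ b) := by
  set L := toCLE Φ with hL
  have hLΦ : ∀ x, L x = Φ x := toCLE_apply Φ
  have hspec : spectrum ℂ (Φ a) = spectrum ℂ a := AlgEquiv.spectrum_eq Φ a
  refine ⟨fun x hx => hb.1 x (hspec ▸ hx), hb.2.mono fun r hr => ?_⟩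
  have hcirc : ∀ x : ℂ, (∮ z in C(x, r), h z • resolvent (Φ a) z) =
      Φ (∮ z in C(x, r), h z • resolvent a z) := by
    intro x
    change _ = L _
    rw [circleIntegral, circleIntegral, intervalIntegral, intervalIntegral, map_sub,
      ← L.integral_comp_comm, ← L.integral_comp_comm]
    simp only [map_smul, hLΦ, resolvent_map]
  rw [← hr, map_smul, hspec]
  congr 1
  simp only [hcirc]
  exact ((Φ : A →+ B).map_finsum_mem _ (spectrum_finite a)).symm

theorem map_exp [CompleteSpace A] (Φ : A ≃ₐ[ℂ] B) (a : A) :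
    Φ (NormedSpace.exp a) = NormedSpace.exp (Φ a) := by
  let +nondep : NormedAlgebra ℚ A := .restrictScalars ℚ ℂ A
  let +nondep : NormedAlgebra ℚ B := .restrictScalars ℚ ℂ B
  exact NormedSpace.map_exp Φ Φ.toLinearMap.continuous_of_finiteDimensional a

/-- Conjugation by a continuous linear equivalence. -/
def conjEquiv {V W : Type*} [NormedAddCommGroup V] [NormedSpace ℂ V] [NormedAddCommGroup W]
    [NormedSpace ℂ W] (T : V ≃L[ℂ] W) : (V →L[ℂ] V) ≃ₐ[ℂ] (W →L[ℂ] W) where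
  toFun L := (T : V →L[ℂ] W) ∘L L ∘L (T.symm : W →L[ℂ] V)
  invFun L := (T.symm : W →L[ℂ] V) ∘L L ∘L (T : V →L[ℂ] W)
  left_inv L := by ext x; simp
  right_inv L := by ext x; simp
  map_mul' L L' := by ext x; simp
  map_add' L L' := by ext x; simp
  commutes' z := by ext x; simp [Algebra.algebraMap_eq_smul_one]

theorem conjEquiv_apply {V W : Type*} [NormedAddCommGroup V] [NormedSpace ℂ V]
    [NormedAddCommGroup W] [NormedSpace ℂ W] (T : V ≃L[ℂ] W) (L : V →L[ℂ] V) (w : W) :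
    conjEquiv T L w = T (L (T.symm w)) := rfl

theorem norm_conjEquiv_le {V W : Type*} [NormedAddCommGroup V] [NormedSpace ℂ V]
    [NormedAddCommGroup W] [NormedSpace ℂ W] (T : V ≃L[ℂ] W) (L : V →L[ℂ] V) :
    ‖conjEquiv T L‖ ≤ ‖(T.symm : W →L[ℂ] V)‖ * ‖(T : V →L[ℂ] W)‖ * ‖L‖ := by
  refine (ContinuousLinearMap.opNorm_comp_le _ _).trans
    ((mul_le_mul_of_nonneg_left (ContinuousLinearMap.opNorm_comp_le _ _) (norm_nonneg _)).trans
      (le_of_eq (by ring)))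

theorem conjEquiv_ad (Φ : A ≃ₐ[ℂ] B) (a : A) : conjEquiv (toCLE Φ) (ad a) = ad (Φ a) := by
  ext b
  obtain ⟨c, rfl⟩ := Φ.surjective b
  rw [conjEquiv_apply, toCLE_symm_apply, Φ.symm_apply_apply, toCLE_apply, ad_apply, ad_apply,
    map_sub, map_mul, map_mul]

theorem spectrum_ad_map (Φ : A ≃ₐ[ℂ] B) (a : A) :
    spectrum ℂ (ad (Φ a)) = spectrum ℂ (ad a) := by
  rw [← conjEquiv_ad, AlgEquiv.spectrum_eq]

theorem isPrimaryFunction_ad_map (Φ : A ≃ₐ[ℂ] B) {h : ℂ → ℂ} {a : A} {G : A →L[ℂ] A}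
    (hG : IsPrimaryFunction h (ad a) G) :
    IsPrimaryFunction h (ad (Φ a)) (conjEquiv (toCLE Φ) G) := by
  rw [← conjEquiv_ad]
  exact hG.map _


theorem spectrum_exp_map [CompleteSpace A] (Φ : A ≃ₐ[ℂ] B) (a : A) :
    spectrum ℂ (NormedSpace.exp (Φ a)) = spectrum ℂ (NormedSpace.exp a) := by
  rw [← map_exp, AlgEquiv.spectrum_eq]

theorem mLog_exp_map [CompleteSpace A] (Φ : A ≃ₐ[ℂ] B) (a : A) (φ R : ℝ) :
    mLog φ (NormedSpace.exp (Φ a)) R = mLog φ (NormedSpace.exp a) R := by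
  rw [mLog, mLog, spectralRadius, spectralRadius, spectrum_exp_map]

theorem mG_ad_map (Φ : A ≃ₐ[ℂ] B) (a : A) (R : ℝ) : mG (ad (Φ a)) R = mG (ad a) R := by
  rw [mG, mG, spectralRadius, spectralRadius, spectrum_ad_map]

theorem gapOne_map (Φ : A ≃ₐ[ℂ] B) (a : A) (φ : ℝ) : gapOne φ (Φ a) = gapOne φ a := by
  rw [gapOne, gapOne, AlgEquiv.spectrum_eq]

theorem gapTwo_map (Φ : A ≃ₐ[ℂ] B) (a : A) : gapTwo (Φ a) = gapTwo a := by
  rw [gapTwo, gapTwo, AlgEquiv.spectrum_eq]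

theorem maxRe_map (Φ : A ≃ₐ[ℂ] B) (a : A) : maxRe (Φ a) = maxRe a := by
  rw [maxRe, maxRe, AlgEquiv.spectrum_eq]

end Transport

/-- The comparison of the error bound in terms of `D²` with the one in terms of `D⁹`. -/
theorem error_bound_le {D : ℕ} (hD : 1 ≤ D) {M R N β t w χ y : ℝ} (hM : 0 ≤ M) (hR : 0 < R)
    (hN : 0 ≤ N) (ht : 0 ≤ t) (hχ : 0 ≤ χ) (hy : 0 ≤ y) (hβ : β = χ * y)
    (hq : (1 + 8 * M * (D : ℝ) ^ 4 / R ^ 2) * (2 * (D : ℝ) ^ 2 * N / R) * t * χ * y *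
      Real.exp (t * χ * y) < 1) :
    (1 + 8 * M * D / R ^ 2) * (2 * (N * (t * β * Real.exp (t * β))) / R) < 1 ∧
    (w ≤ 32 * M ^ 2 * (D : ℝ) ^ 2 * (N * (t * β * Real.exp (t * β))) / R ^ 4 * β * t /
        (1 - (1 + 8 * M * D / R ^ 2) * (2 * (N * (t * β * Real.exp (t * β))) / R)) →
      χ * w ≤ (32 * M ^ 2 * (D : ℝ) ^ 9 * N / R ^ 4) * t ^ 2 * χ ^ 3 * y ^ 2 *
        Real.exp (t * χ * y) / (1 - (1 + 8 * M * (D : ℝ) ^ 4 / R ^ 2) *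
          (2 * (D : ℝ) ^ 2 * N / R) * t * χ * y * Real.exp (t * χ * y))) := by
  have hD1 : (1 : ℝ) ≤ D := by exact_mod_cast hD
  have htβ : t * χ * y = t * β := by rw [hβ]; ring
  have hβ0 : 0 ≤ β := by rw [hβ]; positivity
  rw [htβ] at hq ⊢
  set e := Real.exp (t * β) with he
  have he0 : 0 ≤ e := (Real.exp_pos _).le
  have hle : (1 + 8 * M * D / R ^ 2) * (2 * (N * (t * β * e)) / R) ≤
      (1 + 8 * M * (D : ℝ) ^ 4 / R ^ 2) * (2 * (D : ℝ) ^ 2 * N / R) * t * χ * y * e := by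
    have h1 : (1 + 8 * M * (D : ℝ) ^ 4 / R ^ 2) * (2 * (D : ℝ) ^ 2 * N / R) * t * χ * y * e =
        (1 + 8 * M * (D : ℝ) ^ 4 / R ^ 2) * ((D : ℝ) ^ 2 * (2 * (N * (t * β * e)) / R)) := by
      rw [hβ]; ring
    rw [h1]
    have h2 : (D : ℝ) ≤ (D : ℝ) ^ 4 := le_self_pow₀ hD1 (by norm_num)
    have h3 : (1 : ℝ) ≤ (D : ℝ) ^ 2 := one_le_pow₀ hD1
    refine mul_le_mul (by gcongr) (le_mul_of_one_le_left (by positivity) h3) (by positivity)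
      (by positivity)
  refine ⟨hle.trans_lt hq, fun hw => ?_⟩
  have h5 : (D : ℝ) ^ 2 ≤ (D : ℝ) ^ 9 := pow_le_pow_right₀ hD1 (by norm_num)
  calc χ * w ≤ χ * (32 * M ^ 2 * (D : ℝ) ^ 2 * (N * (t * β * e)) / R ^ 4 * β * t /
        (1 - (1 + 8 * M * D / R ^ 2) * (2 * (N * (t * β * e)) / R))) := by gcongr
    _ ≤ χ * (32 * M ^ 2 * (D : ℝ) ^ 9 * (N * (t * β * e)) / R ^ 4 * β * t /
        (1 - (1 + 8 * M * (D : ℝ) ^ 4 / R ^ 2) * (2 * (D : ℝ) ^ 2 * N / R) * t * χ * y * e)) := by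
      have h6 := sub_pos.mpr hq
      gcongr
    _ = _ := by
      rw [hβ]
      ring

open scoped Matrix.Norms.L2Operator in
/-- The isomorphism from matrices to operators given by coordinates `T`. -/
theorem exists_algEquiv_of_coordinates {E : Type*} [NormedAddCommGroup E] [NormedSpace ℂ E] {D : ℕ}
    (T : EuclideanSpace ℂ (Fin D) ≃L[ℂ] E) {X : E →L[ℂ] E} {J : Matrix (Fin D) (Fin D) ℂ}
    (hT : (T.symm : E →L[ℂ] EuclideanSpace ℂ (Fin D)) ∘L X ∘L
        (T : EuclideanSpace ℂ (Fin D) →L[ℂ] E) = Matrix.toEuclideanCLM (𝕜 := ℂ) J)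
    {χ : ℝ} (hχ : χ = ‖(T.symm : E →L[ℂ] EuclideanSpace ℂ (Fin D))‖ *
        ‖(T : EuclideanSpace ℂ (Fin D) →L[ℂ] E)‖) :
    ∃ Φ : Matrix (Fin D) (Fin D) ℂ ≃ₐ[ℂ] (E →L[ℂ] E), Φ J = X ∧
      (∀ B, ‖Φ B‖ ≤ χ * ‖B‖) ∧ ∀ Y, ‖Φ.symm Y‖ ≤ χ * ‖Y‖ := by
  refine ⟨(Matrix.toEuclideanCLM (n := Fin D) (𝕜 := ℂ)).toAlgEquiv.trans (conjEquiv T), ?_,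
    fun B => ?_, fun Y => ?_⟩
  · exact ((conjEquiv T).toEquiv.eq_symm_apply).mp hT.symm
  · rw [hχ]
    exact norm_conjEquiv_le T _
  · have h := norm_conjEquiv_le T.symm Y
    rw [T.symm_symm, mul_comm ‖(T : EuclideanSpace ℂ (Fin D) →L[ℂ] E)‖, ← hχ] at h
    refine le_trans (le_of_eq ?_) h
    rw [Matrix.cstar_norm_def]
    exact congrArg norm ((Matrix.toEuclideanCLM (n := Fin D) (𝕜 := ℂ)).apply_symm_apply _)

end BCHBound

end

theorem proposition2
    {E : Type*} [NormedAddCommGroup E] [NormedSpace ℂ E] [FiniteDimensional ℂ E] [Nontrivial E]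
    (D : ℕ) (hD : Module.finrank ℂ E = D)
    (X Y : E →L[ℂ] E) (φ : ℝ)
    (hstrip : ∀ x ∈ spectrum ℂ X, φ < x.im ∧ x.im < φ + 2 * Real.pi)
    (R : ℝ) (hR : 0 < R) (hR₁ : R < BCHBound.gapOne φ X) (hR₂ : R < BCHBound.gapTwo X)
    (M : ℝ) (hM : M = max (BCHBound.mLog φ (NormedSpace.exp X) R)
      (BCHBound.mG (BCHBound.ad X) R))
    (α : ℝ) (hα : α = BCHBound.maxRe X)
    (ν : ℝ) (hν : 0 < ν)
    (hν₁ : ν * Real.exp (α + ν) ≤ R / 2) (hν₂ : 2 * (D : ℝ) * ν ≤ R / 2)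
    (T : EuclideanSpace ℂ (Fin D) ≃L[ℂ] E)
    (J : Matrix (Fin D) (Fin D) ℂ) (hJ : BCHBound.IsScaledJordan ν J)
    (hT : (T.symm : E →L[ℂ] EuclideanSpace ℂ (Fin D)) ∘L X ∘L
        (T : EuclideanSpace ℂ (Fin D) →L[ℂ] E) = Matrix.toEuclideanCLM (𝕜 := ℂ) J)
    (χ : ℝ) (hχ : χ = ‖(T.symm : E →L[ℂ] EuclideanSpace ℂ (Fin D))‖ *
        ‖(T : EuclideanSpace ℂ (Fin D) →L[ℂ] E)‖) :
    BCHBound.IsPrimaryFunction (BCHBound.logBranch φ) (NormedSpace.exp X) X ∧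
    ∃ G : (E →L[ℂ] E) →L[ℂ] (E →L[ℂ] E),
      BCHBound.IsPrimaryFunction BCHBound.bchG (BCHBound.ad X) G ∧
      ∀ t : ℝ, 0 ≤ t →
        (1 + 8 * M * (D : ℝ) ^ 4 / R ^ 2) * (2 * (D : ℝ) ^ 2 * Real.exp (α + ν) / R) *
            t * χ * ‖Y‖ * Real.exp (t * χ * ‖Y‖) < 1 →
        ∃ Z W : E →L[ℂ] E,
          BCHBound.IsPrimaryFunction (BCHBound.logBranch φ)
            (NormedSpace.exp X * NormedSpace.exp ((t : ℂ) • Y)) Z ∧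
          Z = X + (t : ℂ) • G Y + W ∧
          ‖W‖ ≤
            (32 * M ^ 2 * (D : ℝ) ^ 9 * Real.exp (α + ν) / R ^ 4) *
                t ^ 2 * χ ^ 3 * ‖Y‖ ^ 2 * Real.exp (t * χ * ‖Y‖) /
              (1 - (1 + 8 * M * (D : ℝ) ^ 4 / R ^ 2) *
                (2 * (D : ℝ) ^ 2 * Real.exp (α + ν) / R) *
                t * χ * ‖Y‖ * Real.exp (t * χ * ‖Y‖)) := by
  have hD1 : 1 ≤ D := hD ▸ Module.finrank_pos
  have : NeZero D := ⟨by omega⟩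
  open scoped Matrix.Norms.L2Operator in
  obtain ⟨Φ, hX, hΦ, hΦ'⟩ := BCHBound.exists_algEquiv_of_coordinates T hT hχ
  subst hX
  rw [BCHBound.gapOne_map] at hR₁
  rw [BCHBound.gapTwo_map] at hR₂
  rw [BCHBound.mLog_exp_map, BCHBound.mG_ad_map] at hM
  rw [BCHBound.maxRe_map] at hα
  rw [AlgEquiv.spectrum_eq] at hstrip
  obtain ⟨hM0, h1, G, hG, h2⟩ := hJ.exists_log_exp_mul_exp hν.le hstrip hR hR₁ hR₂
    (hM ▸ le_max_left _ _) (hM ▸ le_max_right _ _) hα.ge hν₁ hν₂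
  have h3 := h1.map Φ
  rw [BCHBound.map_exp] at h3
  refine ⟨h3, _, BCHBound.isPrimaryFunction_ad_map Φ hG, fun t ht hq => ?_⟩
  have hχ0 : 0 ≤ χ := by rw [hχ]; positivity
  have hbound := fun w => BCHBound.error_bound_le (w := w) hD1 hM0 hR (Real.exp_pos (α + ν)).le ht
    hχ0 (norm_nonneg Y) rfl hq
  obtain ⟨Z, hZ, hW⟩ := h2 (Φ.symm Y) (χ * ‖Y‖) t (hΦ' Y) ht (hbound 0).1
  refine ⟨Φ Z, Φ (Z - J - (t : ℂ) • G (Φ.symm Y)), ?_, ?_, (hΦ _).trans ((hbound _).2 hW)⟩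
  · have h4 := hZ.map Φ
    rwa [map_mul, BCHBound.map_exp, BCHBound.map_exp, map_smul, Φ.apply_symm_apply] at h4
  · rw [BCHBound.conjEquiv_apply, BCHBound.toCLE_apply, BCHBound.toCLE_symm_apply, map_sub, map_sub,
      map_smul]
    abel
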